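/- Let $\xi$ be a smooth ($C^\infty$) real vector bundle of rank $k$ over a closed (compact, Hausdorff, boundaryless) smooth manifold $B$ of dimension $m$, equipped with a smooth Euclidean metric. Let $V$ be the total space of $\xi$, let $D\subset V$ be the unit disk bundle of $\xi$ and $\partial D$ its unit sphere bundle, and let $S$ be the double of $D$ along $\partial D$: the closed smooth $(m+k)$-manifold, unique up to diffeomorphism, that is the union of the images of two smooth embeddings $j_1,j_2\colon D\to S$ with $j_1=j_2$ on $\partial D$ and $j_1(D)\cap j_2(D)=j_1(\partial D)$. For a vector bundle $\eta$ over $X$ let $w_i(\eta)\in H^i(X;\mathbb{Z}/2)$ be its $i$-th Stiefel--Whitney class, and for a smooth manifold $M$ put $w_i(M)=w_i(TM)$. Then for every $i\ge 0$ \[ w_i(S)=0\iff w_i(\xi\oplus TB)=0\iff w_i(V)=0, \] where $w_i(S)\in H^i(S;\mathbb{Z}/2)$, $w_i(\xi\oplus TB)\in H^i(B;\mathbb{Z}/2)$ and $w_i(V)\in H^i(V;\mathbb{Z}/2)$. -/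

import Mathlib

open Bundle Set
open scoped Manifold ContDiff

noncomputable section

namespace SW

/-! ### Singular cohomology with coefficients in `ℤ/2` -/

/-- Singular `m`-simplices of `X`. -/
abbrev Simplex (m : ℕ) (X : Type*) [TopologicalSpace X] : Type _ :=
  C(stdSimplex ℝ (Fin (m + 1)), X)

/-- The affine map of standard simplices given by a map of vertices. -/
def simplexMap {l m : ℕ} (f : Fin (l + 1) → Fin (m + 1)) :
    C(stdSimplex ℝ (Fin (l + 1)), stdSimplex ℝ (Fin (m + 1))) :=
  ⟨stdSimplex.map f, stdSimplex.continuous_map f⟩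

/-- The `j`-th face of a singular simplex. -/
def face {m : ℕ} {X : Type*} [TopologicalSpace X] (j : Fin (m + 2)) (σ : Simplex (m + 1) X) :
    Simplex m X :=
  σ.comp (simplexMap j.succAbove)

/-- The `k`-th edge of a singular `m`-simplex, from its vertex `k` to its vertex `k + 1`. -/
def edge {m : ℕ} {X : Type*} [TopologicalSpace X] (k : Fin m) (σ : Simplex m X) : Simplex 1 X :=
  σ.comp (simplexMap ![k.castSucc, k.succ])

/-- Singular cochains with coefficients in `ℤ/2`. -/
abbrev Cochain (m : ℕ) (X : Type*) [TopologicalSpace X] : Type _ := Simplex m X → ZMod 2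

/-- The coboundary operator (no signs are needed mod `2`). -/
def d (m : ℕ) (X : Type*) [TopologicalSpace X] : Cochain m X →ₗ[ZMod 2] Cochain (m + 1) X where
  toFun c σ := ∑ j, c (face j σ)
  map_add' c c' := by ext σ; simp [Finset.sum_add_distrib]
  map_smul' r c := by ext σ; simp [Finset.mul_sum]

/-- The pullback of cochains along a continuous map. -/
def pullCochain {X Y : Type*} [TopologicalSpace X] [TopologicalSpace Y] (f : C(X, Y)) (m : ℕ) :
    Cochain m Y →ₗ[ZMod 2] Cochain m X where
  toFun c σ := c (f.comp σ)
  map_add' _ _ := rfl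
  map_smul' _ _ := rfl

theorem d_pullCochain {X Y : Type*} [TopologicalSpace X] [TopologicalSpace Y] (f : C(X, Y))
    (m : ℕ) (c : Cochain m Y) : d m X (pullCochain f m c) = pullCochain f (m + 1) (d m Y c) :=
  rfl

/-- Singular cocycles. -/
def cocycles (m : ℕ) (X : Type*) [TopologicalSpace X] : Submodule (ZMod 2) (Cochain m X) :=
  LinearMap.ker (d m X)

/-- Singular coboundaries. -/
def coboundaries : ∀ (m : ℕ) (X : Type*) [TopologicalSpace X], Submodule (ZMod 2) (Cochain m X)
  | 0, _, _ => ⊥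
  | m + 1, X, _ => LinearMap.range (d m X)

theorem pullCochain_mem_cocycles {X Y : Type*} [TopologicalSpace X] [TopologicalSpace Y]
    (f : C(X, Y)) (m : ℕ) {c : Cochain m Y} (hc : c ∈ cocycles m Y) :
    pullCochain f m c ∈ cocycles m X := by
  rw [cocycles, LinearMap.mem_ker] at hc ⊢
  rw [d_pullCochain, hc, map_zero]

theorem pullCochain_mem_coboundaries {X Y : Type*} [TopologicalSpace X] [TopologicalSpace Y]
    (f : C(X, Y)) (m : ℕ) {c : Cochain m Y} (hc : c ∈ coboundaries m Y) :
    pullCochain f m c ∈ coboundaries m X := by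
  cases m with
  | zero =>
    have h : c = 0 := by simpa [coboundaries] using hc
    rw [h, map_zero]
    exact Submodule.zero_mem _
  | succ m =>
    obtain ⟨b, rfl⟩ := hc
    exact ⟨pullCochain f m b, d_pullCochain f m b⟩

/-- The singular cohomology group `H^m(X; ℤ/2)`. -/
abbrev H (m : ℕ) (X : Type*) [TopologicalSpace X] : Type _ :=
  cocycles m X ⧸ (coboundaries m X).submoduleOf (cocycles m X)

/-- The homomorphism induced on cohomology by a continuous map. -/
def pull {X Y : Type*} [TopologicalSpace X] [TopologicalSpace Y] (f : C(X, Y)) (m : ℕ) :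
    H m Y →ₗ[ZMod 2] H m X :=
  Submodule.mapQ _ _
    ((pullCochain f m).restrict fun _ hc => pullCochain_mem_cocycles f m hc)
    (fun _ hc => pullCochain_mem_coboundaries f m hc)

/-- The `i`-th elementary symmetric polynomial in the `1`-cochains `a 0, …, a (n - 1)`, with
respect to the (Alexander–Whitney) cup product of cochains:
`∑_{j₁ < ⋯ < jᵢ} a j₁ ∪ ⋯ ∪ a jᵢ`. A product of `i` cochains of degree one takes on an `i`-simplex
the product of the values of the factors on its `i` consecutive edges. -/
def esymmCochain {X : Type*} [TopologicalSpace X] (i : ℕ) {n : ℕ} (a : Fin n → Cochain 1 X) :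
    Cochain i X :=
  fun σ => ∑ j : Fin i ↪o Fin n, ∏ k, a (j k) (edge k σ)

/-! ### The classifying spaces `BO(n)` -/

/-- The Hilbert space `ℓ²`. -/
abbrev Hilb : Type := lp (fun _ : ℕ => ℝ) 2

/-- `P` is an orthogonal projection of `ℓ²` onto an `n`-dimensional subspace. -/
def IsProj (n : ℕ) (P : Hilb →L[ℝ] Hilb) : Prop :=
  IsStarProjection P ∧ Module.rank ℝ (LinearMap.range (P : Hilb →ₗ[ℝ] Hilb)) = n

/-- The Grassmannian of `n`-dimensional subspaces of `ℓ²`, a subspace being identified with the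
orthogonal projection onto it, with the topology of the operator norm. It is the quotient of the
contractible space of orthonormal `n`-frames in `ℓ²` by the free action of `O(n)`, thus a
model of `BO(n)`; in particular `Gr 1` is a model of `ℝP^∞`. -/
abbrev Gr (n : ℕ) : Type := {P : Hilb →L[ℝ] Hilb // IsProj n P}

/-- The space of `n`-tuples of pairwise orthogonal lines in `ℓ²`: the quotient of the space of
orthonormal `n`-frames in `ℓ²` by the group `O(1)ⁿ`, thus a model of `BO(1)ⁿ`. -/
abbrev Lines (n : ℕ) : Type :=
  {L : Fin n → Gr 1 // Pairwise fun j k => (L j).1 * (L k).1 = 0}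

theorem IsProj.add {m n : ℕ} {P Q : Hilb →L[ℝ] Hilb} (hP : IsProj m P) (hQ : IsProj n Q)
    (hPQ : P * Q = 0) (hQP : Q * P = 0) : IsProj (m + n) (P + Q) := by
  refine ⟨hP.1.add hQ.1 hPQ, ?_⟩
  have hPP : ∀ x, P (P x) = P x := fun x => congrArg (fun T : Hilb →L[ℝ] Hilb => T x) hP.1.1
  have hQQ : ∀ x, Q (Q x) = Q x := fun x => congrArg (fun T : Hilb →L[ℝ] Hilb => T x) hQ.1.1
  have h₁ : ∀ x, P (Q x) = 0 := fun x => congrArg (fun T : Hilb →L[ℝ] Hilb => T x) hPQ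
  have h₂ : ∀ x, Q (P x) = 0 := fun x => congrArg (fun T : Hilb →L[ℝ] Hilb => T x) hQP
  have hr : LinearMap.range ((P + Q : Hilb →L[ℝ] Hilb) : Hilb →ₗ[ℝ] Hilb) =
      LinearMap.range (P : Hilb →ₗ[ℝ] Hilb) ⊔ LinearMap.range (Q : Hilb →ₗ[ℝ] Hilb) := by
    apply le_antisymm
    · rintro _ ⟨x, rfl⟩
      exact Submodule.add_mem_sup ⟨x, rfl⟩ ⟨x, rfl⟩
    · refine sup_le ?_ ?_
      · rintro _ ⟨x, rfl⟩
        exact ⟨P x, by simp [hPP, h₂]⟩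
      · rintro _ ⟨x, rfl⟩
        exact ⟨Q x, by simp [hQQ, h₁]⟩
  have hi : LinearMap.range (P : Hilb →ₗ[ℝ] Hilb) ⊓ LinearMap.range (Q : Hilb →ₗ[ℝ] Hilb) = ⊥ := by
    rw [eq_bot_iff]
    rintro _ ⟨⟨x, rfl⟩, ⟨y, hy⟩⟩
    have hy' : Q y = P x := hy
    have h0 : P x = 0 := by rw [← hPP, ← hy', h₁]
    exact h0
  have h := Submodule.rank_sup_add_rank_inf_eq (LinearMap.range (P : Hilb →ₗ[ℝ] Hilb))
    (LinearMap.range (Q : Hilb →ₗ[ℝ] Hilb))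
  rw [hi, rank_bot, add_zero, hP.2, hQ.2] at h
  rw [hr, h, Nat.cast_add]

theorem isProj_sum {n : ℕ} (L : Lines n) : IsProj n (∑ j, (L.1 j).1) := by
  classical
  have key : ∀ s : Finset (Fin n), IsProj s.card (∑ j ∈ s, (L.1 j).1) := by
    intro s
    induction s using Finset.induction_on with
    | empty =>
      refine ⟨by simp, ?_⟩
      have h0 : LinearMap.range ((0 : Hilb →L[ℝ] Hilb) : Hilb →ₗ[ℝ] Hilb) = ⊥ :=
        LinearMap.range_eq_bot.2 rfl
      rw [Finset.sum_empty, h0, rank_bot, Finset.card_empty, Nat.cast_zero]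
    | insert j s hj ih =>
      rw [Finset.sum_insert hj, Finset.card_insert_of_notMem hj, add_comm s.card 1]
      refine (L.1 j).2.add ih ?_ ?_
      · rw [Finset.mul_sum]
        exact Finset.sum_eq_zero fun k hk => L.2 (by rintro rfl; exact hj hk)
      · rw [Finset.sum_mul]
        exact Finset.sum_eq_zero fun k hk => L.2 (by rintro rfl; exact hj hk)
  simpa using key Finset.univ

/-- The map `BO(1)ⁿ → BO(n)` that sends pairwise orthogonal lines to their direct sum. -/
def sumLines (n : ℕ) : C(Lines n, Gr n) where
  toFun L := ⟨∑ j, (L.1 j).1, isProj_sum L⟩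
  continuous_toFun := Continuous.subtype_mk (continuous_finsetSum _ fun j _ =>
    continuous_subtype_val.comp ((continuous_apply j).comp continuous_subtype_val)) _

/-- The `j`-th projection `BO(1)ⁿ → BO(1)`. -/
def line {n : ℕ} (j : Fin n) : C(Lines n, Gr 1) where
  toFun L := L.1 j
  continuous_toFun := (continuous_apply j).comp continuous_subtype_val

/-! ### Stiefel–Whitney classes -/

/-- The classes `c n ∈ H^i(BO(n); ℤ/2)`, `n ≥ 0`, restrict along `BO(1)ⁿ → BO(n)` to the `i`-th
elementary symmetric polynomials in `x₁, …, xₙ`, where `xⱼ` is the pullback along the `j`-th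
projection `BO(1)ⁿ → BO(1) = ℝP^∞` of the nonzero class `x` of `H¹(ℝP^∞; ℤ/2) = ℤ/2`
(here `a` is a cocycle that represents `x`, and `z` one that represents `c n`). -/
def IsUniversalSW (i : ℕ) (c : ∀ n, H i (Gr n)) : Prop :=
  ∀ n, ∀ a ∈ cocycles 1 (Gr 1), a ∉ coboundaries 1 (Gr 1) →
    ∃ z : cocycles i (Gr n), Submodule.Quotient.mk z = c n ∧
      pullCochain (sumLines n) i z.1 - esymmCochain i (fun j => pullCochain (line j) 1 a) ∈
        coboundaries i (Lines n)

open Classical in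
/-- The `i`-th universal Stiefel–Whitney classes `w_i ∈ H^i(BO(n); ℤ/2)`, `n ≥ 0`: the unique
classes that restrict to the elementary symmetric polynomials. (`H^*(BO(n); ℤ/2)` is mapped
isomorphically onto the symmetric polynomials in `H^*(BO(1)ⁿ; ℤ/2) = ℤ/2[x₁, …, xₙ]`, so they
exist and are unique.) -/
def universalSW (i : ℕ) : ∀ n, H i (Gr n) :=
  if h : ∃! c : ∀ n, H i (Gr n), IsUniversalSW i c then h.choose else 0

/-- `f : X → BO(n)` classifies the rank `n` vector bundle `E` over `X`: there is a bundle map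
from `E` to the tautological bundle over `BO(n)` that covers `f` and is an isomorphism on fibres;
in other words, a continuous map from the total space to `ℓ²` that sends each `E x`
isomorphically onto the subspace `f x`. -/
def IsClassifyingMap {X : Type*} [TopologicalSpace X] (F : Type*) [NormedAddCommGroup F]
    [NormedSpace ℝ F] (E : X → Type*) [∀ x, AddCommGroup (E x)] [∀ x, Module ℝ (E x)]
    [TopologicalSpace (TotalSpace F E)] (f : C(X, Gr (Module.finrank ℝ F))) : Prop :=
  ∃ g : ∀ x, E x →ₗ[ℝ] Hilb,
    Continuous (fun v : TotalSpace F E => g v.proj v.snd) ∧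
    ∀ x, Function.Injective (g x) ∧
      LinearMap.range (g x) = LinearMap.range ((f x).1 : Hilb →ₗ[ℝ] Hilb)

open Classical in
/-- The `i`-th Stiefel–Whitney class `w_i(E) ∈ H^i(X; ℤ/2)` of a real vector bundle `E` over a
paracompact Hausdorff space `X`: the pullback of the universal class along a classifying map
of `E`, which exists and is unique up to homotopy. (The value is `0` in the absence of a
classifying map, which does not occur over a paracompact Hausdorff space.) -/
def swClass {X : Type*} [TopologicalSpace X] (F : Type*) [NormedAddCommGroup F]
    [NormedSpace ℝ F] [FiniteDimensional ℝ F] (E : X → Type*) [∀ x, AddCommGroup (E x)]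
    [∀ x, Module ℝ (E x)] [∀ x, TopologicalSpace (E x)] [TopologicalSpace (TotalSpace F E)]
    [FiberBundle F E] [VectorBundle ℝ F E] (i : ℕ) : H i X :=
  if h : ∃ f : C(X, Gr (Module.finrank ℝ F)), IsClassifyingMap F E f then
    pull h.choose i (universalSW i (Module.finrank ℝ F))
  else 0

/-- The `i`-th Stiefel–Whitney class of a smooth manifold: that of its tangent bundle. -/
def manifoldSW {W : Type*} [NormedAddCommGroup W] [NormedSpace ℝ W] [FiniteDimensional ℝ W]
    {K : Type*} [TopologicalSpace K] (I : ModelWithCorners ℝ W K)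
    (M : Type*) [TopologicalSpace M] [ChartedSpace K M] [IsManifold I ∞ M] (i : ℕ) : H i M :=
  swClass W (TangentSpace I : M → Type _) i

/-! ### Disk bundles and doubles -/

section Disk

variable {EB : Type*} [NormedAddCommGroup EB] [NormedSpace ℝ EB]
  {HB : Type*} [TopologicalSpace HB] {IB : ModelWithCorners ℝ EB HB}
  {B : Type*} [TopologicalSpace B] [ChartedSpace HB B]
  {F : Type*} [NormedAddCommGroup F] [NormedSpace ℝ F]
  {E : B → Type*} [TopologicalSpace (TotalSpace F E)]
  [∀ b, TopologicalSpace (E b)] [∀ b, AddCommGroup (E b)] [∀ b, Module ℝ (E b)]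
  [∀ b, IsTopologicalAddGroup (E b)] [∀ b, ContinuousConstSMul ℝ (E b)]
  [FiberBundle F E] [VectorBundle ℝ F E]

/-- The unit disk bundle of a smooth Euclidean vector bundle, a subset of the total space. -/
def diskBundle (g : ContMDiffRiemannianMetric IB ∞ F E) : Set (TotalSpace F E) :=
  {v | g.inner v.proj v.snd v.snd ≤ 1}

/-- The unit sphere bundle, which is the boundary of the unit disk bundle. -/
def sphereBundle (g : ContMDiffRiemannianMetric IB ∞ F E) : Set (TotalSpace F E) :=
  {v | g.inner v.proj v.snd v.snd = 1}

end Disk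

/-- Let `D` be a compact domain with smooth boundary `A` in a manifold `M`. The structure says
that the manifold `S` without boundary is the double of `D` along `A`, by means of `j₁` and `j₂`:
these are smooth embeddings of `D` (smooth injective immersions of the compact manifold with
boundary `D`) whose images cover `S`, and that coincide on `A` and have only `j₁ A = j₂ A` in
common. These conditions determine `S` up to diffeomorphism. -/
structure IsDouble {W₁ K₁ : Type*} [NormedAddCommGroup W₁] [NormedSpace ℝ W₁]
    [TopologicalSpace K₁] (I₁ : ModelWithCorners ℝ W₁ K₁)
    {M : Type*} [TopologicalSpace M] [ChartedSpace K₁ M]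
    {W₂ K₂ : Type*} [NormedAddCommGroup W₂] [NormedSpace ℝ W₂]
    [TopologicalSpace K₂] (I₂ : ModelWithCorners ℝ W₂ K₂)
    {S : Type*} [TopologicalSpace S] [ChartedSpace K₂ S]
    (D A : Set M) (j₁ j₂ : M → S) : Prop where
  contMDiffOn₁ : ContMDiffOn I₁ I₂ ∞ j₁ D
  contMDiffOn₂ : ContMDiffOn I₁ I₂ ∞ j₂ D
  injOn₁ : InjOn j₁ D
  injOn₂ : InjOn j₂ D
  immersion₁ : ∀ x ∈ D, Function.Injective (mfderivWithin I₁ I₂ j₁ D x)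
  immersion₂ : ∀ x ∈ D, Function.Injective (mfderivWithin I₁ I₂ j₂ D x)
  cover : j₁ '' D ∪ j₂ '' D = univ
  eqOn : EqOn j₁ j₂ A
  inter : j₁ '' D ∩ j₂ '' D = j₁ '' A

end SW

end

set_option linter.unusedSectionVars false

noncomputable section

namespace SW

/-! ### Homotopy invariance of cohomology -/

section Homotopy

variable {X Y Z : Type*} [TopologicalSpace X] [TopologicalSpace Y] [TopologicalSpace Z]

/-! Folding the two halves of `S` onto each other gives a map `r : S → V` with values in the disk
bundle and `r ∘ j₁ = r ∘ j₂ = id` there. The heart of the proof is a stable isomorphism `TS ⊕ ℝ ≅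
r*TV ⊕ ℝ`, whence `w_i(S) = r* w_i(V)`. The zero section `z : B → V` is a homotopy equivalence and
`z*TV ≅ ξ ⊕ TB`, so `w_i(ξ ⊕ TB) = z* w_i(V)` with `z*` injective; this settles the second
equivalence. Since `z = r ∘ s` with `s = j₁ ∘ z`, also `w_i(ξ ⊕ TB) = s* w_i(S)`, and the first
equivalence follows.

For the stable isomorphism, the inverse derivatives of `j₁` and `j₂` identify `TS` with `r*TV` over
the two halves. Along the seam they agree on vectors tangent to the sphere bundle, and they give
opposite signs in the normal direction because the halves lie on opposite sides
(`IsDouble.opposite`). They thus differ by a reflection, up to a positive factor and a shear. After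
a trivial line is added, with its sign reversed on the second half, the two can be joined by a path
of isomorphisms, which is used in a neighbourhood of the seam (`stab_homotopic_of_reflection`).

The passage to classes rests on three facts. Homotopic maps agree on cohomology (`prism_d`).
Isomorphic bundles have homotopic maps into the Grassmannian of `ℓ²` (`homotopic_of_bundleIso`). The
universal classes are stable (`pull_stab_universalSW`): the family pulled back from `BO(n + 1)`
satisfies the characterization again, so uniqueness applies, and without unique existence all
classes are `0` by definition. Existence of the classes is therefore never needed. -/

theorem simplexMap_comp {a b c : ℕ} (f : Fin (a + 1) → Fin (b + 1))
    (g : Fin (b + 1) → Fin (c + 1)) :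
    (simplexMap g).comp (simplexMap f) = simplexMap (g ∘ f) := by
  ext1 x
  exact stdSimplex.map_comp_apply f g x

theorem simplexMap_id {a : ℕ} : simplexMap (id : Fin (a + 1) → Fin (a + 1)) = .id _ := by
  ext1 x
  exact stdSimplex.map_id_apply x

/-- The threshold function on vertices that is `1` from the vertex `n` on. -/
def threshold (l n : ℕ) : Fin (l + 1) → Fin 2 := fun j => if n ≤ (j : ℕ) then 1 else 0

/-- The coordinate on the standard `1`-simplex, as a map to the unit interval. -/
def simplexCoord : C(stdSimplex ℝ (Fin 2), unitInterval) where
  toFun t := ⟨t 1, t.2.1 1, by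
    have h := t.2.2
    rw [Fin.sum_univ_two] at h
    have := t.2.1 0
    change t.1 1 ≤ 1
    linarith⟩
  continuous_toFun := by
    refine Continuous.subtype_mk ?_ _
    exact (continuous_apply (1 : Fin 2)).comp continuous_subtype_val

/-- The simplex of `Y` obtained by restricting a homotopy to an affine simplex of
`[0, 1] × Δ`. -/
def prismSimplex {f₀ f₁ : C(X, Y)} (h : f₀.Homotopy f₁) {l m : ℕ} (σ : Simplex m X)
    (f : Fin (l + 1) → Fin (m + 1)) (g : Fin (l + 1) → Fin 2) : Simplex l Y :=
  h.toContinuousMap.comp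
    ((simplexCoord.comp (simplexMap (m := 1) g)).prodMk (σ.comp (simplexMap f)))

theorem prismSimplex_comp {f₀ f₁ : C(X, Y)} (h : f₀.Homotopy f₁) {j l m : ℕ} (σ : Simplex m X)
    (f : Fin (l + 1) → Fin (m + 1)) (g : Fin (l + 1) → Fin 2) (e : Fin (j + 1) → Fin (l + 1)) :
    (prismSimplex h σ f g).comp (simplexMap e) = prismSimplex h σ (f ∘ e) (g ∘ e) := by
  rw [prismSimplex, prismSimplex, ← simplexMap_comp, ← simplexMap_comp]
  rfl

theorem prismSimplex_face {f₀ f₁ : C(X, Y)} (h : f₀.Homotopy f₁) {l m : ℕ}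
    (σ : Simplex (m + 1) X) (j : Fin (m + 2))
    (f : Fin (l + 1) → Fin (m + 1)) (g : Fin (l + 1) → Fin 2) :
    prismSimplex h (face j σ) f g = prismSimplex h σ (j.succAbove ∘ f) g := by
  rw [prismSimplex, prismSimplex, face, ← simplexMap_comp]
  rfl

theorem simplexCoord_comp_zero {l : ℕ} (t : stdSimplex ℝ (Fin (l + 1))) :
    simplexCoord (simplexMap (m := 1) (fun _ => 0) t) = 0 := by
  apply Subtype.ext
  change (FunOnFinite.linearMap ℝ ℝ (fun _ : Fin (l + 1) => (0 : Fin 2)) t) 1 = 0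
  simp [FunOnFinite.linearMap_apply_apply]

theorem simplexCoord_comp_one {l : ℕ} (t : stdSimplex ℝ (Fin (l + 1))) :
    simplexCoord (simplexMap (m := 1) (fun _ => 1) t) = 1 := by
  apply Subtype.ext
  change (FunOnFinite.linearMap ℝ ℝ (fun _ : Fin (l + 1) => (1 : Fin 2)) t) 1 = 1
  simp [FunOnFinite.linearMap_apply_apply]

theorem prismSimplex_zero {f₀ f₁ : C(X, Y)} (h : f₀.Homotopy f₁) {m : ℕ} (σ : Simplex m X) :
    prismSimplex h σ id (threshold m (m + 1)) = f₀.comp σ := by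
  have e : threshold m (m + 1) = fun _ => 0 := by
    funext j
    exact if_neg (by omega)
  ext1 t
  rw [e, prismSimplex, simplexMap_id]
  change h (simplexCoord (simplexMap (m := 1) (fun _ => 0) t), σ t) = _
  rw [simplexCoord_comp_zero, h.apply_zero]
  rfl

theorem prismSimplex_one {f₀ f₁ : C(X, Y)} (h : f₀.Homotopy f₁) {m : ℕ} (σ : Simplex m X) :
    prismSimplex h σ id (threshold m 0) = f₁.comp σ := by
  have e : threshold m 0 = fun _ => 1 := by
    funext j; simp [threshold]
  ext1 t
  rw [e, prismSimplex, simplexMap_id]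
  change h (simplexCoord (simplexMap (m := 1) (fun _ => 1) t), σ t) = _
  rw [simplexCoord_comp_one, h.apply_one]
  rfl

/-- The prism operator of a homotopy. -/
def prism {f₀ f₁ : C(X, Y)} (h : f₀.Homotopy f₁) (m : ℕ) (c : Cochain (m + 1) Y) : Cochain m X :=
  -- `i.predAbove` repeats the vertex `i`, and the threshold `i + 1` puts the first copy at the
  -- bottom and the second at the top. These are the simplices of the standard triangulation of the
  -- prism.
  fun σ => ∑ i : Fin (m + 1), c (prismSimplex h σ i.predAbove (threshold (m + 1) (i + 1)))

/-! ### Simplicial identities for the faces of the prism -/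

theorem val_succAbove {n : ℕ} (p : Fin (n + 1)) (i : Fin n) :
    (p.succAbove i : ℕ) = if (i : ℕ) < p then (i : ℕ) else i + 1 := by
  rw [Fin.succAbove]
  split_ifs <;> simp_all [Fin.lt_def]

theorem val_predAbove {n : ℕ} (p : Fin n) (i : Fin (n + 1)) :
    (p.predAbove i : ℕ) = if (p : ℕ) < i then (i : ℕ) - 1 else i := by
  by_cases h : p.castSucc < i
  · rw [Fin.predAbove_of_castSucc_lt _ _ h, if_pos (by simpa [Fin.lt_def] using h), Fin.val_pred]
  · rw [Fin.predAbove_of_le_castSucc _ _ (not_lt.1 h), if_neg (by simpa [Fin.lt_def] using h)]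
    rfl

/-- The faces `i` and `i + 1` of the `i`-th prism simplex omit one of the two copies of the vertex
`i`. What is left is the full simplex with threshold `i` or `i + 1`, so these faces telescope over
`i`. -/
theorem predAbove_comp_castSucc_succAbove {m : ℕ} (i : Fin (m + 1)) :
    i.predAbove ∘ i.castSucc.succAbove = id := by
  funext j; simp

theorem predAbove_comp_succ_succAbove {m : ℕ} (i : Fin (m + 1)) :
    i.predAbove ∘ i.succ.succAbove = id := by
  funext j
  apply Fin.ext
  simp only [Function.comp, val_predAbove, val_succAbove, Fin.val_succ, id]
  split_ifs <;> omega

theorem threshold_comp_castSucc_succAbove {m : ℕ} (i : Fin (m + 1)) :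
    threshold (m + 1) (i + 1) ∘ i.castSucc.succAbove = threshold m i := by
  funext j
  simp only [threshold, Function.comp, val_succAbove, Fin.val_castSucc]
  split_ifs <;> first | rfl | omega

theorem threshold_comp_succ_succAbove {m : ℕ} (i : Fin (m + 1)) :
    threshold (m + 1) (i + 1) ∘ i.succ.succAbove = threshold m (i + 1) := by
  funext j
  simp only [threshold, Function.comp, val_succAbove, Fin.val_succ]
  split_ifs <;> first | rfl | omega

/-- The index `i.castSucc.succAbove (i.succAbove j)` runs over the faces other than `i` and `i + 1`.
Each of them is a prism simplex of the face `i.succAbove j`. -/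
theorem predAbove_comp_succAbove {m : ℕ} (i : Fin (m + 2)) (j : Fin (m + 1)) :
    i.predAbove ∘ (i.castSucc.succAbove (i.succAbove j)).succAbove =
      (i.succAbove j).succAbove ∘ (j.predAbove i).predAbove := by
  funext x
  apply Fin.ext
  simp only [Function.comp, val_predAbove, val_succAbove, Fin.val_castSucc]
  split_ifs <;> omega

theorem threshold_comp_succAbove {m : ℕ} (i : Fin (m + 2)) (j : Fin (m + 1)) :
    threshold (m + 2) (i + 1) ∘ (i.castSucc.succAbove (i.succAbove j)).succAbove =
      threshold (m + 1) ((j.predAbove i : Fin (m + 1)) + 1) := by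
  funext x
  simp only [threshold, Function.comp, val_predAbove, val_succAbove, Fin.val_castSucc]
  split_ifs <;> first | rfl | omega

theorem sum_telescope {m : ℕ} (a : ℕ → ZMod 2) :
    ∑ i : Fin (m + 1), (a i + a (i + 1)) = a 0 + a (m + 1) := by
  rw [Fin.sum_univ_eq_sum_range (fun i => a i + a (i + 1))]
  have : ∀ n, ∑ i ∈ Finset.range n, (a i + a (i + 1)) = a 0 + a n := by
    intro n
    induction n with
    | zero => simp [CharTwo.add_self_eq_zero]
    | succ n ih =>
      rw [Finset.sum_range_succ, ih]
      linear_combination CharTwo.add_self_eq_zero (a n)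
  exact this _

/-- The map `(i, j) ↦ (i.succAbove j, j.predAbove i)` is an involution. It matches the faces of
prism simplices with the prism simplices of faces. -/
theorem sum_succAbove_predAbove {M : Type*} [AddCommMonoid M] {m : ℕ}
    (a : Fin (m + 2) → Fin (m + 1) → M) :
    ∑ i : Fin (m + 2), ∑ j : Fin (m + 1), a (i.succAbove j) (j.predAbove i) =
      ∑ i : Fin (m + 2), ∑ j : Fin (m + 1), a i j := by
  rw [← Fintype.sum_prod_type', ← Fintype.sum_prod_type']
  have key : ∀ p : Fin (m + 2) × Fin (m + 1),
      ((p.1.succAbove p.2).succAbove (p.2.predAbove p.1),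
        (p.2.predAbove p.1).predAbove (p.1.succAbove p.2)) = p := by
    rintro ⟨i, j⟩
    refine Prod.ext (Fin.ext ?_) (Fin.ext ?_) <;>
      simp only [val_predAbove, val_succAbove] <;> split_ifs <;> omega
  exact Finset.sum_nbij' (fun p => (p.1.succAbove p.2, p.2.predAbove p.1))
    (fun p => (p.1.succAbove p.2, p.2.predAbove p.1)) (by simp) (by simp)
    (fun p _ => key p) (fun p _ => key p) (by simp)

/-- The interior and top and bottom faces telescope to `f₁.comp σ` and `f₀.comp σ`. The side faces
occur in both terms on the left and cancel mod 2. -/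
theorem prism_d {f₀ f₁ : C(X, Y)} (h : f₀.Homotopy f₁) (m : ℕ) (c : Cochain (m + 1) Y) :
    prism h (m + 1) (d (m + 1) Y c) + d m X (prism h m c) =
      pullCochain f₁ (m + 1) c + pullCochain f₀ (m + 1) c := by
  funext σ
  have h1 : prism h (m + 1) (d (m + 1) Y c) σ =
      (c (f₁.comp σ) + c (f₀.comp σ)) + ∑ i : Fin (m + 2), ∑ j : Fin (m + 1),
        c (prismSimplex h σ ((i.succAbove j).succAbove ∘ (j.predAbove i).predAbove)
          (threshold (m + 1) ((j.predAbove i : Fin (m + 1)) + 1))) := by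
    rw [← prismSimplex_zero h σ, ← prismSimplex_one h σ,
      ← sum_telescope (m := m + 1) fun n => c (prismSimplex h σ id (threshold (m + 1) n)),
      ← Finset.sum_add_distrib]
    refine Finset.sum_congr rfl fun i _ => ?_
    change ∑ j : Fin (m + 3), c (face j _) = _
    simp only [face, prismSimplex_comp]
    -- The faces `i` and `i + 1` are split off from the side faces.
    rw [Fin.sum_univ_succAbove _ i.castSucc, Fin.sum_univ_succAbove _ i, ← add_assoc]
    congr 1
    · congr 1
      · rw [predAbove_comp_castSucc_succAbove, threshold_comp_castSucc_succAbove]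
      · rw [Fin.succAbove_castSucc_self, predAbove_comp_succ_succAbove,
          threshold_comp_succ_succAbove]
    · refine Finset.sum_congr rfl fun j _ => ?_
      rw [predAbove_comp_succAbove, threshold_comp_succAbove]
  have h2 : d m X (prism h m c) σ = ∑ i : Fin (m + 2), ∑ j : Fin (m + 1),
        c (prismSimplex h σ ((i.succAbove j).succAbove ∘ (j.predAbove i).predAbove)
          (threshold (m + 1) ((j.predAbove i : Fin (m + 1)) + 1))) := by
    rw [sum_succAbove_predAbove fun i j =>
      c (prismSimplex h σ (i.succAbove ∘ j.predAbove) (threshold (m + 1) ((j : ℕ) + 1)))]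
    change ∑ i : Fin (m + 2), ∑ j : Fin (m + 1), _ = _
    simp only [prismSimplex_face]
  change prism h (m + 1) (d (m + 1) Y c) σ + d m X (prism h m c) σ =
    c (f₁.comp σ) + c (f₀.comp σ)
  rw [h1, h2, add_assoc, CharTwo.add_self_eq_zero, add_zero]

/-- In degree `0` there are no side faces, and `coboundaries 0` is zero, so the two pullbacks of a
`0`-cocycle are equal as cochains. -/
theorem prism_d_zero {f₀ f₁ : C(X, Y)} (h : f₀.Homotopy f₁) (c : Cochain 0 Y) :
    prism h 0 (d 0 Y c) = pullCochain f₁ 0 c + pullCochain f₀ 0 c := by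
  funext σ
  change _ = c (f₁.comp σ) + c (f₀.comp σ)
  rw [← prismSimplex_zero h σ, ← prismSimplex_one h σ]
  change ∑ i : Fin 1, ∑ j : Fin 2, c (face j _) = _
  simp only [face, prismSimplex_comp]
  rw [Fin.sum_univ_one, Fin.sum_univ_two]
  have e0 := predAbove_comp_castSucc_succAbove (0 : Fin 1)
  have e1 := predAbove_comp_succ_succAbove (0 : Fin 1)
  have t0 := threshold_comp_castSucc_succAbove (0 : Fin 1)
  have t1 := threshold_comp_succ_succAbove (0 : Fin 1)
  simp only [Fin.castSucc_zero, Fin.succ_zero_eq_one] at e0 e1 t0 t1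
  rw [e0, e1, t0, t1]
  rfl

/-! ### Homotopy invariance of induced maps -/

theorem pullCochain_sub_mem_coboundaries {f₀ f₁ : C(X, Y)} (h : f₀.Homotopic f₁) (m : ℕ)
    {c : Cochain m Y} (hc : c ∈ cocycles m Y) :
    pullCochain f₁ m c - pullCochain f₀ m c ∈ coboundaries m X := by
  obtain ⟨h⟩ := h
  have hc' : d m Y c = 0 := hc
  rw [sub_eq_add_neg, ZModModule.neg_eq_self]
  have hz : ∀ n, prism h n 0 = 0 := fun n => by
    funext σ
    simp [prism]
  cases m with
  | zero =>
    rw [← prism_d_zero h, hc', hz]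
    exact Submodule.zero_mem _
  | succ m =>
    rw [← prism_d h, hc', hz, zero_add]
    exact ⟨_, rfl⟩

theorem pull_eq_of_homotopic {f₀ f₁ : C(X, Y)} (h : f₀.Homotopic f₁) (m : ℕ) :
    pull f₀ m = pull f₁ m := by
  ext1
  ext1 c
  change Submodule.Quotient.mk _ = Submodule.Quotient.mk _
  rw [Submodule.Quotient.eq]
  exact pullCochain_sub_mem_coboundaries h.symm m c.2

theorem pull_comp (f : C(X, Y)) (g : C(Y, Z)) (m : ℕ) (c : H m Z) :
    pull (g.comp f) m c = pull f m (pull g m c) := by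
  induction c using Submodule.Quotient.induction_on with
  | H c => rfl

theorem pull_id (m : ℕ) (c : H m X) : pull (.id X) m c = c := by
  induction c using Submodule.Quotient.induction_on with
  | H c => rfl

end Homotopy

end SW
end

noncomputable section

namespace SW

/-! ### Projections onto images -/

/-- The bounded operators of `ℓ²`. -/
abbrev Op : Type := Hilb →L[ℝ] Hilb

theorem IsProj.mul_self {n : ℕ} {P : Op} (hP : IsProj n P) : P * P = P := hP.1.1

theorem IsProj.star_eq {n : ℕ} {P : Op} (hP : IsProj n P) : star P = P := hP.1.2

theorem IsProj.finrank {n : ℕ} {P : Op} (hP : IsProj n P) :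
    Module.finrank ℝ (LinearMap.range (P : Hilb →ₗ[ℝ] Hilb)) = n :=
  Module.finrank_eq_of_rank_eq hP.2

theorem IsProj.finiteDimensional {n : ℕ} {P : Op} (hP : IsProj n P) :
    FiniteDimensional ℝ (LinearMap.range (P : Hilb →ₗ[ℝ] Hilb)) :=
  Module.rank_lt_aleph0_iff.1 (by rw [hP.2]; exact Cardinal.natCast_lt_aleph0)

theorem IsProj.mem_range {n : ℕ} {P : Op} (hP : IsProj n P) {x : Hilb} :
    x ∈ LinearMap.range (P : Hilb →ₗ[ℝ] Hilb) ↔ P x = x := by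
  refine ⟨?_, fun h => ⟨x, h⟩⟩
  rintro ⟨y, rfl⟩
  exact congrArg (fun T : Op => T y) hP.mul_self

/-- The hypothesis gives one inclusion of ranges and equality of dimensions does the rest. Below,
subspaces are identified by checking a single inclusion. -/
theorem IsProj.eq_of_mul_eq {n : ℕ} {P Q : Op} (hP : IsProj n P) (hQ : IsProj n Q)
    (h : P * Q = Q) : P = Q := by
  have hle : LinearMap.range (Q : Hilb →ₗ[ℝ] Hilb) ≤ LinearMap.range (P : Hilb →ₗ[ℝ] Hilb) := by
    rintro _ ⟨y, rfl⟩
    exact ⟨Q y, congrArg (fun T : Op => T y) h⟩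
  have := hP.finiteDimensional
  have heq := Submodule.eq_of_le_of_finrank_eq hle (by rw [hP.finrank, hQ.finrank])
  exact ContinuousLinearMap.IsStarProjection.ext hP.1 hQ.1 heq.symm

/-- The operator `A* A + (1 - P)`. -/
def gram (A P : Op) : Op := star A * A + (1 - P)

/-- The left inverse `(A* A + (1 - P))⁻¹ A*` of an operator `A` that is injective on the range
of the projection `P` and zero on its complement. -/
def leftInv (A P : Op) : Op := Ring.inverse (gram A P) * star A

/-- The orthogonal projection onto the range of such an operator. -/
def rangeProj (A P : Op) : Op := A * leftInv A P

theorem eq_zero_of_star_mul_self_apply {A : Op} {x : Hilb} (h : (star A * A) x = 0) : A x = 0 := by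
  have h1 : inner ℝ (A x) (A x) = (0 : ℝ) := by
    have h2 := ContinuousLinearMap.adjoint_inner_left A x (A x)
    rw [← h2]
    change inner ℝ ((star A * A) x) x = (0 : ℝ)
    rw [h, inner_zero_left]
  exact inner_self_eq_zero.1 h1

theorem mul_star_eq {n : ℕ} {A P : Op} (hP : IsProj n P) (hA : A * P = A) : P * star A = star A := by
  rw [← hP.star_eq, ← star_mul, hA]

theorem mul_gram {n : ℕ} {A P : Op} (hP : IsProj n P) (hA : A * P = A) : P * gram A P = star A * A := by
  rw [gram, mul_add, ← mul_assoc, mul_star_eq hP hA, mul_sub, mul_one, hP.mul_self, sub_self,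
    add_zero]

theorem gram_mul {n : ℕ} {A P : Op} (hP : IsProj n P) (hA : A * P = A) : gram A P * P = star A * A := by
  rw [gram, add_mul, mul_assoc, hA, sub_mul, one_mul, hP.mul_self, sub_self, add_zero]

/-- On the range of `P` the Gram operator is `A* A`, which is injective there if `A` is; on the
orthogonal complement it is the identity. Finite dimension of the range gives surjectivity. -/
theorem isUnit_gram {n : ℕ} {A P : Op} (hP : IsProj n P) (hA : A * P = A) (hinj : ∀ x, P x = x → A x = 0 → x = 0) : IsUnit (gram A P) := by
  have hfd := hP.finiteDimensional
  rw [ContinuousLinearMap.isUnit_iff_bijective]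
  constructor
  · rw [injective_iff_map_eq_zero]
    intro x hx
    have h1 : (star A * A) x = 0 := by
      rw [← mul_gram hP hA]
      change P (gram A P x) = 0
      rw [hx, map_zero]
    have h2 := eq_zero_of_star_mul_self_apply h1
    have h3 : (star A * A) x + (x - P x) = 0 := hx
    rw [h1, zero_add, sub_eq_zero] at h3
    exact hinj x h3.symm h2
  · intro y
    let W := LinearMap.range (P : Hilb →ₗ[ℝ] Hilb)
    let φ : W →ₗ[ℝ] W := ((star A * A : Op) : Hilb →ₗ[ℝ] Hilb).restrict (fun x _ => by
      rw [← mul_gram hP hA]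
      exact ⟨gram A P x, rfl⟩)
    have hφ : Function.Injective φ := by
      rw [injective_iff_map_eq_zero]
      rintro ⟨x, hx⟩ h
      have h1 : (star A * A) x = 0 := congrArg Subtype.val h
      exact Subtype.ext (hinj x (hP.mem_range.1 hx) (eq_zero_of_star_mul_self_apply h1))
    obtain ⟨⟨x, hx⟩, h⟩ := LinearMap.injective_iff_surjective.1 hφ ⟨P y, y, rfl⟩
    have h1 : (star A * A) x = P y := congrArg Subtype.val h
    have h2 : P x = x := hP.mem_range.1 hx
    have h3 : P (P y) = P y := congrArg (fun T : Op => T y) hP.mul_self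
    have h4 : A (P y) = A y := congrArg (fun T : Op => T y) hA
    refine ⟨x + (y - P y), ?_⟩
    change (star A * A) (x + (y - P y)) + ((x + (y - P y)) - P (x + (y - P y))) = y
    have h5 : (star A * A) (y - P y) = 0 := by
      change star A (A (y - P y)) = 0
      rw [map_sub, h4, sub_self, map_zero]
    rw [map_add, h1, h5, map_add, map_sub, h2, h3]
    abel

/-- Together with `isUnit_gram` this makes injectivity on the range of `P` an open condition,
because the units of a Banach algebra are open. -/
theorem eq_zero_of_isUnit_gram {A P : Op} (hu : IsUnit (gram A P)) {x : Hilb} (hx : P x = x)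
    (h : A x = 0) : x = 0 := by
  have h1 := (ContinuousLinearMap.isUnit_iff_bijective.1 hu).1
  apply h1
  rw [map_zero]
  change star A (A x) + (x - P x) = 0
  rw [h, hx, map_zero, sub_self, zero_add]

theorem leftInv_mul {n : ℕ} {A P : Op} (hP : IsProj n P) (hA : A * P = A)
    (hu : IsUnit (gram A P)) : leftInv A P * A = P := by
  rw [leftInv, mul_assoc, ← gram_mul hP hA, Ring.inverse_mul_cancel_left _ _ hu]

theorem mul_leftInv {n : ℕ} {A P : Op} (hP : IsProj n P) (hA : A * P = A)
    (hu : IsUnit (gram A P)) : P * leftInv A P = leftInv A P := by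
  have h : P * gram A P = gram A P * P := (mul_gram hP hA).trans (gram_mul hP hA).symm
  have h' : P * Ring.inverse (gram A P) = Ring.inverse (gram A P) * P := by
    rw [← Ring.inverse_mul_cancel_left _ (P * Ring.inverse (gram A P)) hu, ← mul_assoc (gram A P),
      ← h, mul_assoc P, Ring.mul_inverse_cancel _ hu, mul_one]
  rw [leftInv, ← mul_assoc, h', mul_assoc, mul_star_eq hP hA]

theorem rangeProj_mul {n : ℕ} {A P : Op} (hP : IsProj n P) (hA : A * P = A)
    (hu : IsUnit (gram A P)) : rangeProj A P * A = A := by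
  rw [rangeProj, mul_assoc, leftInv_mul hP hA hu, hA]

theorem range_rangeProj {n : ℕ} {A P : Op} (hP : IsProj n P) (hA : A * P = A)
    (hu : IsUnit (gram A P)) : LinearMap.range (rangeProj A P : Hilb →ₗ[ℝ] Hilb) =
    LinearMap.range (A : Hilb →ₗ[ℝ] Hilb) := by
  apply le_antisymm
  · rintro _ ⟨x, rfl⟩
    exact ⟨leftInv A P x, rfl⟩
  · rintro _ ⟨x, rfl⟩
    exact ⟨A x, congrArg (fun T : Op => T x) (rangeProj_mul hP hA hu)⟩

/-- Idempotence comes from `leftInv A P * A = P` and `P * leftInv A P = leftInv A P`,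
self-adjointness from that of the Gram operator. -/
theorem isProj_rangeProj {n : ℕ} {A P : Op} (hP : IsProj n P) (hA : A * P = A)
    (hu : IsUnit (gram A P)) : IsProj n (rangeProj A P) := by
  refine ⟨⟨?_, ?_⟩, ?_⟩
  · change A * leftInv A P * (A * leftInv A P) = A * leftInv A P
    rw [mul_assoc, ← mul_assoc (leftInv A P), leftInv_mul hP hA hu, mul_leftInv hP hA hu]
  · change star (A * (Ring.inverse (gram A P) * star A)) = A * (Ring.inverse (gram A P) * star A)
    have : star (gram A P) = gram A P := by
      rw [gram, star_add, star_mul, star_star, star_sub, star_one, hP.star_eq]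
    rw [star_mul, star_mul, star_star, ← Ring.inverse_star, this, mul_assoc]
  · rw [range_rangeProj hP hA hu, ← hP.2]
    have : LinearMap.range (A : Hilb →ₗ[ℝ] Hilb) =
        (LinearMap.range (P : Hilb →ₗ[ℝ] Hilb)).map (A : Hilb →ₗ[ℝ] Hilb) := by
      rw [← LinearMap.range_comp]
      exact congrArg (fun T : Op => LinearMap.range (T : Hilb →ₗ[ℝ] Hilb)) hA.symm
    rw [this, ← LinearMap.range_domRestrict]
    refine rank_range_of_injective _ ((injective_iff_map_eq_zero _).2 ?_)
    rintro ⟨x, hx⟩ h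
    exact Subtype.ext (eq_zero_of_isUnit_gram hu (hP.mem_range.1 hx) h)


theorem continuousWithinAt_leftInv {X : Type*} [TopologicalSpace X] {a p : X → Op} {s : Set X}
    {x : X} (ha : ContinuousWithinAt a s x) (hp : ContinuousWithinAt p s x)
    (hu : IsUnit (gram (a x) (p x))) :
    ContinuousWithinAt (fun y => leftInv (a y) (p y)) s x := by
  have hg : ContinuousWithinAt (fun y => gram (a y) (p y)) s x :=
    (ha.star.mul ha).add (continuousWithinAt_const.sub hp)
  obtain ⟨u, hu⟩ := hu
  have hi := NormedRing.inverse_continuousAt u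
  rw [hu] at hi
  exact (ContinuousAt.comp_continuousWithinAt (f := fun y => gram (a y) (p y)) hi hg).mul ha.star

/-! ### Homotopies of maps into Grassmannians -/

section Homotopies

variable {X : Type*} [TopologicalSpace X] {n : ℕ}

theorem apply_of_mul_eq {S T R : Op} (h : S * T = R) (x : Hilb) : S (T x) = R x :=
  congrArg (fun T : Op => T x) h

/-- The images of the subspaces `f x` under linear maps that are injective on them. -/
def imageMap (f : C(X, Gr n)) (T : X → Op) (hT : Continuous T)
    (hinj : ∀ x y, (f x).1 y = y → T x y = 0 → y = 0) : C(X, Gr n) where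
  toFun x := ⟨rangeProj (T x * (f x).1) (f x).1, by
    have hA : T x * (f x).1 * (f x).1 = T x * (f x).1 := by rw [mul_assoc, (f x).2.mul_self]
    refine isProj_rangeProj (f x).2 hA (isUnit_gram (f x).2 hA fun y hy h => hinj x y hy ?_)
    rw [← h]
    exact congrArg _ hy.symm⟩
  continuous_toFun := by
    refine Continuous.subtype_mk ?_ _
    have hf : Continuous fun x => (f x).1 := continuous_subtype_val.comp f.continuous
    rw [← continuousOn_univ]
    intro x _
    have hA : T x * (f x).1 * (f x).1 = T x * (f x).1 := by rw [mul_assoc, (f x).2.mul_self]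
    refine (hT.mul hf).continuousWithinAt.mul (continuousWithinAt_leftInv
      (hT.mul hf).continuousWithinAt hf.continuousWithinAt
      (isUnit_gram (f x).2 hA fun y hy h => hinj x y hy ?_))
    rw [← h]
    exact congrArg _ hy.symm

theorem imageMap_eq (f : C(X, Gr n)) (T : X → Op) (hT : Continuous T)
    (hinj : ∀ x y, (f x).1 y = y → T x y = 0 → y = 0) {x : X} {P : Gr n}
    (h : P.1 * (T x * (f x).1) = T x * (f x).1) : imageMap f T hT hinj x = P := by
  refine Subtype.ext (P.2.eq_of_mul_eq (imageMap f T hT hinj x).2 ?_).symm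
  change P.1 * (T x * (f x).1 * _) = T x * (f x).1 * _
  rw [← mul_assoc, h]

/-- A path of operators injective on the subspaces `f x` moves them by a homotopy. At the ends it is
enough that the images lie in `g₀ x` and `g₁ x`, since the dimensions agree. -/
theorem homotopic_of_path {f g₀ g₁ : C(X, Gr n)} (T : unitInterval × X → Op) (hT : Continuous T)
    (hinj : ∀ p y, (f p.2).1 y = y → T p y = 0 → y = 0)
    (h₀ : ∀ x, (g₀ x).1 * (T (0, x) * (f x).1) = T (0, x) * (f x).1)
    (h₁ : ∀ x, (g₁ x).1 * (T (1, x) * (f x).1) = T (1, x) * (f x).1) : g₀.Homotopic g₁ :=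
  ⟨{ toContinuousMap := imageMap (f.comp .snd) T hT hinj
     map_zero_left := fun x => imageMap_eq (f.comp .snd) T hT hinj (h₀ x)
     map_one_left := fun x => imageMap_eq (f.comp .snd) T hT hinj (h₁ x) }⟩

end Homotopies

/-! ### Two isometries of `ℓ²` -/

/-- The `n`-th standard basis vector of `ℓ²`. -/
def basisVec (n : ℕ) : Hilb := lp.single 2 n (1 : ℝ)

theorem inner_basisVec (n : ℕ) (x : Hilb) : inner ℝ (basisVec n) x = x n := by
  simp [basisVec, lp.inner_single_left]

theorem orthonormal_basisVec : Orthonormal ℝ basisVec := by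
  rw [orthonormal_iff_ite]
  intro i j
  rw [inner_basisVec, basisVec, lp.single_apply]
  simp [Pi.single_apply]

/-- The isometry of `ℓ²` that permutes basis vectors by an injective map. -/
def shift (s : ℕ → ℕ) (hs : Function.Injective s) : Op :=
  ((orthonormal_basisVec.comp s hs).orthogonalFamily.linearIsometry).toContinuousLinearMap

theorem shift_basisVec (s : ℕ → ℕ) (hs : Function.Injective s) (n : ℕ) :
    shift s hs (basisVec n) = basisVec (s n) := by
  change (orthonormal_basisVec.comp s hs).orthogonalFamily.linearIsometry (lp.single 2 n (1 : ℝ)) = _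
  rw [OrthogonalFamily.linearIsometry_apply_single]
  simp

theorem star_shift_mul_shift (s : ℕ → ℕ) (hs : Function.Injective s) :
    star (shift s hs) * shift s hs = 1 :=
  (ContinuousLinearMap.norm_map_iff_adjoint_comp_self _).1
    (orthonormal_basisVec.comp s hs).orthogonalFamily.linearIsometry.norm_map

theorem ext_inner_basisVec {x y : Hilb}
    (h : ∀ n, inner ℝ (basisVec n) x = (inner ℝ (basisVec n) y : ℝ)) : x = y := by
  ext n
  simpa only [inner_basisVec] using h n

theorem shift_apply_apply (s : ℕ → ℕ) (hs : Function.Injective s) (x : Hilb) (n : ℕ) :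
    shift s hs x (s n) = x n := by
  rw [← inner_basisVec, ← shift_basisVec s hs, ← ContinuousLinearMap.adjoint_inner_right,
    ← inner_basisVec]
  congr 1
  exact apply_of_mul_eq (star_shift_mul_shift s hs) x

theorem star_shift_basisVec (s : ℕ → ℕ) (hs : Function.Injective s) (n : ℕ)
    (hn : ∀ m, s m ≠ n) : star (shift s hs) (basisVec n) = 0 := by
  apply ext_inner_basisVec
  intro m
  rw [inner_zero_right, ContinuousLinearMap.star_eq_adjoint,
    ContinuousLinearMap.adjoint_inner_right, shift_basisVec]
  exact orthonormal_basisVec.2 (hn m)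

theorem shift_apply_eq_zero (s : ℕ → ℕ) (hs : Function.Injective s) (x : Hilb) (n : ℕ)
    (hn : ∀ m, s m ≠ n) : shift s hs x n = 0 := by
  rw [← inner_basisVec, ← ContinuousLinearMap.adjoint_inner_left]
  have := star_shift_basisVec s hs n hn
  rw [ContinuousLinearMap.star_eq_adjoint] at this
  rw [this, inner_zero_left]

theorem star_shift_mul_shift_eq_zero (s t : ℕ → ℕ) (hs : Function.Injective s)
    (ht : Function.Injective t) (h : ∀ m n, s m ≠ t n) : star (shift s hs) * shift t ht = 0 := by
  ext1 x
  apply ext_inner_basisVec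
  intro m
  change inner ℝ _ (star (shift s hs) (shift t ht x)) = (inner ℝ _ (0 : Hilb) : ℝ)
  rw [inner_zero_right, ContinuousLinearMap.star_eq_adjoint,
    ContinuousLinearMap.adjoint_inner_right, shift_basisVec, inner_basisVec]
  exact shift_apply_eq_zero t ht x _ fun n => (h m n).symm

theorem odd_injective : Function.Injective fun n : ℕ => 2 * n + 1 := fun a b h => by
  simp only at h; omega

/-- The choice `2 * n + 2` instead of `2 * n` leaves the basis vector `0` outside both ranges, free
for the stabilizing line, and makes `n < s n` hold for every `n`. -/
theorem even_injective : Function.Injective fun n : ℕ => 2 * n + 2 := fun a b h => by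
  simp only at h; omega

/-- The isometry `e n ↦ e (2 n + 1)`. -/
def oddShift : Op := shift _ odd_injective

/-- The isometry `e n ↦ e (2 n + 2)`. -/
def evenShift : Op := shift _ even_injective

theorem star_oddShift_mul : star oddShift * oddShift = 1 := star_shift_mul_shift _ _

theorem star_evenShift_mul : star evenShift * evenShift = 1 := star_shift_mul_shift _ _

theorem star_oddShift_mul_evenShift : star oddShift * evenShift = 0 :=
  star_shift_mul_shift_eq_zero _ _ _ _ fun m n => by omega

theorem star_evenShift_mul_oddShift : star evenShift * oddShift = 0 :=
  star_shift_mul_shift_eq_zero _ _ _ _ fun m n => by omega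

/-- A basis vector orthogonal to the ranges of both isometries. -/
def baseVec : Hilb := basisVec 0

theorem star_oddShift_baseVec : star oddShift baseVec = 0 :=
  star_shift_basisVec _ _ _ fun m => by omega

/-- If `a ≠ 0`, coordinate `n` of the equation expresses `x n` through an earlier coordinate of `x`,
or through nothing, so strong induction applies. If `a = 0` only the isometry remains. -/
theorem shift_path_injective {s : ℕ → ℕ} (hs : Function.Injective s) (hlt : ∀ n, n < s n)
    {a b : ℝ} (hab : a + b = 1) {x : Hilb} (h : a • x + b • shift s hs x = 0) : x = 0 := by
  have hc : ∀ n, a * x n + b * shift s hs x n = 0 := fun n => by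
    have := congrArg (fun z : Hilb => z n) h
    exact this
  ext n
  change x n = 0
  by_cases ha : a = 0
  · have hb : b = 1 := by linarith
    have := hc (s n)
    rwa [ha, hb, zero_mul, zero_add, one_mul, shift_apply_apply] at this
  · induction n using Nat.strong_induction_on with
    | _ n ih =>
      have h0 : shift s hs x n = 0 := by
        by_cases hn : ∃ m, s m = n
        · obtain ⟨m, rfl⟩ := hn
          rw [shift_apply_apply]
          exact ih m (hlt m)
        · exact shift_apply_eq_zero s hs x n (not_exists.1 hn)
      have := hc n
      rw [h0, mul_zero, add_zero] at this
      exact (mul_eq_zero.1 this).resolve_left ha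

end SW
end

noncomputable section

namespace SW

/-! ### Isomorphic bundles have homotopic classifying maps -/

theorem IsProj.conj {n : ℕ} {P U : Op} (hP : IsProj n P) (hU : star U * U = 1) :
    IsProj n (U * P * star U) := by
  have hg : gram (U * P) P = 1 := by
    rw [gram, star_mul, hP.star_eq, mul_assoc, ← mul_assoc (star U), hU, one_mul, hP.mul_self]
    abel
  have h := isProj_rangeProj (A := U * P) hP (by rw [mul_assoc, hP.mul_self])
    (by rw [hg]; exact isUnit_one)
  rwa [rangeProj, leftInv, hg, Ring.inverse_one, one_mul, star_mul, hP.star_eq, mul_assoc,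
    ← mul_assoc P P, hP.mul_self, ← mul_assoc] at h

/-- The self-map of the Grassmannian induced by an isometry of `ℓ²`. -/
def conj (U : Op) (hU : star U * U = 1) (n : ℕ) : C(Gr n, Gr n) where
  toFun P := ⟨U * P.1 * star U, P.2.conj hU⟩
  continuous_toFun :=
    Continuous.subtype_mk ((continuous_const.mul continuous_subtype_val).mul continuous_const) _

theorem homotopic_conj_shift {s : ℕ → ℕ} (hs : Function.Injective s) (hlt : ∀ n, n < s n) (n : ℕ) :
    (ContinuousMap.id (Gr n)).Homotopic (conj (shift s hs) (star_shift_mul_shift s hs) n) := by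
  refine homotopic_of_path (f := .id _)
    (fun p => (1 - (p.1 : ℝ)) • (1 : Op) + (p.1 : ℝ) • shift s hs) (by fun_prop) ?_ ?_ ?_
  · intro p y _ h
    exact shift_path_injective hs hlt (by ring) h
  · intro P
    simp [P.2.mul_self]
  · intro P
    have h : shift s hs * P.1 * star (shift s hs) * (shift s hs * P.1) = shift s hs * P.1 := by
      rw [mul_assoc, ← mul_assoc (star _), star_shift_mul_shift, one_mul, mul_assoc, P.2.mul_self]
    simpa [conj] using h

/-- First `f₀` is moved into the odd coordinates and `f₁` into the even ones. The straight path from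
the odd copy to the even copy of the isomorphism `T` is then injective, because its two components
are orthogonal. -/
theorem homotopic_of_bundleIso {X : Type*} [TopologicalSpace X] {n : ℕ} {f₀ f₁ : C(X, Gr n)}
    (T : X → Op) (hT : Continuous T) (hinj : ∀ x y, (f₀ x).1 y = y → T x y = 0 → y = 0)
    (hmem : ∀ x, (f₁ x).1 * (T x * (f₀ x).1) = T x * (f₀ x).1) : f₀.Homotopic f₁ := by
  have h₀ : f₀.Homotopic ((conj oddShift star_oddShift_mul n).comp f₀) := by
    have := (homotopic_conj_shift odd_injective (fun n => by omega) n).comp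
      (ContinuousMap.Homotopic.refl f₀)
    rwa [ContinuousMap.id_comp] at this
  have h₁ : f₁.Homotopic ((conj evenShift star_evenShift_mul n).comp f₁) := by
    have := (homotopic_conj_shift even_injective (fun n => by omega) n).comp
      (ContinuousMap.Homotopic.refl f₁)
    rwa [ContinuousMap.id_comp] at this
  refine h₀.trans (ContinuousMap.Homotopic.trans ?_ h₁.symm)
  refine homotopic_of_path (f := f₀)
    (fun p => (1 - (p.1 : ℝ)) • oddShift + (p.1 : ℝ) • (evenShift * T p.2)) (by fun_prop) ?_ ?_ ?_
  · intro p y hy h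
    have h' : (1 - (p.1 : ℝ)) • oddShift y + (p.1 : ℝ) • evenShift (T p.2 y) = 0 := h
    -- The adjoints of the two shifts separate the components: `(1 - t) y = 0` and `t T y = 0`.
    have e1 := congrArg (fun z => (star oddShift : Op) z) h'
    have e2 := congrArg (fun z => (star evenShift : Op) z) h'
    simp only [map_add, map_smul, map_zero, apply_of_mul_eq star_oddShift_mul,
      apply_of_mul_eq star_oddShift_mul_evenShift] at e1
    simp only [map_add, map_smul, map_zero, apply_of_mul_eq star_evenShift_mul,
      apply_of_mul_eq star_evenShift_mul_oddShift] at e2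
    simp only [zero_apply, one_apply_eq_self, smul_zero, add_zero,
      zero_add, smul_eq_zero] at e1 e2
    rcases e1 with e1 | e1
    · rcases e2 with e2 | e2
      · linarith
      · exact hinj _ _ hy e2
    · exact e1
  · intro x
    have h : oddShift * (f₀ x).1 * star oddShift * (oddShift * (f₀ x).1) =
        oddShift * (f₀ x).1 := by
      rw [mul_assoc, ← mul_assoc (star _), star_oddShift_mul, one_mul, mul_assoc,
        (f₀ x).2.mul_self]
    simpa [conj] using h
  · intro x
    have h : evenShift * (f₁ x).1 * star evenShift * (evenShift * T x * (f₀ x).1) =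
        evenShift * T x * (f₀ x).1 := by
      rw [mul_assoc evenShift (T x), mul_assoc, ← mul_assoc (star _), star_evenShift_mul, one_mul,
        mul_assoc, hmem]
    simpa [conj] using h

/-! ### Stability of the universal classes -/

/-- The orthogonal projection onto the line spanned by `baseVec`. -/
def baseProj : Op := InnerProductSpace.rankOne ℝ baseVec baseVec

theorem baseProj_apply (x : Hilb) : baseProj x = inner ℝ baseVec x • baseVec := rfl

theorem norm_baseVec : ‖baseVec‖ = 1 := orthonormal_basisVec.1 0

theorem baseVec_ne_zero : baseVec ≠ 0 := norm_ne_zero_iff.1 (by rw [norm_baseVec]; exact one_ne_zero)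

theorem baseProj_baseVec : baseProj baseVec = baseVec := by
  rw [baseProj_apply, real_inner_self_eq_norm_sq, norm_baseVec, one_pow, one_smul]

theorem isProj_baseProj : IsProj 1 baseProj := by
  refine ⟨InnerProductSpace.isStarProjection_rankOne_self norm_baseVec, ?_⟩
  have : LinearMap.range (baseProj : Hilb →ₗ[ℝ] Hilb) = Submodule.span ℝ {baseVec} := by
    apply le_antisymm
    · rintro _ ⟨x, rfl⟩
      exact Submodule.smul_mem _ _ (Submodule.mem_span_singleton_self _)
    · rw [Submodule.span_singleton_le_iff_mem]
      exact ⟨baseVec, baseProj_baseVec⟩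
  rw [this, ← (LinearEquiv.toSpanNonzeroSingleton ℝ Hilb baseVec baseVec_ne_zero).rank_eq,
    Module.rank_self, Nat.cast_one]

theorem star_oddShift_mul_baseProj : star oddShift * baseProj = 0 := by
  ext1 x
  change star oddShift (inner ℝ baseVec x • baseVec) = 0
  rw [map_smul, star_oddShift_baseVec, smul_zero]

theorem baseProj_mul_oddShift : baseProj * oddShift = 0 := by
  have := congrArg star star_oddShift_mul_baseProj
  rwa [star_mul, star_star, isProj_baseProj.star_eq, star_zero] at this

theorem IsProj.stab {n : ℕ} {P : Op} (hP : IsProj n P) :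
    IsProj (n + 1) (oddShift * P * star oddShift + baseProj) := by
  refine (hP.conj star_oddShift_mul).add isProj_baseProj ?_ ?_
  · rw [mul_assoc, star_oddShift_mul_baseProj, mul_zero]
  · rw [← mul_assoc, ← mul_assoc, baseProj_mul_oddShift, zero_mul, zero_mul]

/-- The stabilization map `BO(n) → BO(n + 1)`. -/
def stab (n : ℕ) : C(Gr n, Gr (n + 1)) where
  toFun P := ⟨oddShift * P.1 * star oddShift + baseProj, P.2.stab⟩
  continuous_toFun := Continuous.subtype_mk (((continuous_const.mul continuous_subtype_val).mul
    continuous_const).add continuous_const) _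

/-- The action of an isometry on tuples of orthogonal lines. -/
def conjLines (U : Op) (hU : star U * U = 1) (n : ℕ) : C(Lines n, Lines n) where
  toFun L := ⟨fun j => conj U hU 1 (L.1 j), fun j k hjk => by
    change U * (L.1 j).1 * star U * (U * (L.1 k).1 * star U) = 0
    have := L.2 hjk
    rw [mul_assoc, ← mul_assoc (star U), ← mul_assoc (star U), hU, one_mul,
      mul_assoc U, ← mul_assoc (L.1 j).1, this, zero_mul, mul_zero]⟩
  continuous_toFun := Continuous.subtype_mk (continuous_pi fun j =>
    (conj U hU 1).continuous.comp ((continuous_apply j).comp continuous_subtype_val)) _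

/-- The map `BO(1)ⁿ → BO(1)ⁿ⁺¹` that adds a constant line. -/
def stabLines (n : ℕ) : C(Lines n, Lines (n + 1)) where
  toFun L := ⟨Fin.cons ⟨baseProj, isProj_baseProj⟩
      fun j => conj oddShift star_oddShift_mul 1 (L.1 j), by
    intro j k hjk
    cases j using Fin.cases with
    | zero =>
      cases k using Fin.cases with
      | zero => exact absurd rfl hjk
      | succ k =>
        change baseProj * (oddShift * _ * _) = 0
        rw [← mul_assoc, ← mul_assoc, baseProj_mul_oddShift, zero_mul, zero_mul]
    | succ j =>
      cases k using Fin.cases with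
      | zero =>
        change oddShift * _ * _ * baseProj = 0
        rw [mul_assoc, star_oddShift_mul_baseProj, mul_zero]
      | succ k =>
        exact (conjLines oddShift star_oddShift_mul n L).2 fun h => hjk (congrArg Fin.succ h)⟩
  continuous_toFun := by
    refine Continuous.subtype_mk (continuous_pi fun j => ?_) _
    cases j using Fin.cases with
    | zero => exact continuous_const
    | succ j =>
      exact (conj oddShift star_oddShift_mul 1).continuous.comp
        ((continuous_apply j).comp continuous_subtype_val)

theorem stab_comp_sumLines (n : ℕ) :
    (stab n).comp (sumLines n) = (sumLines (n + 1)).comp (stabLines n) := by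
  ext1 L
  apply Subtype.ext
  change oddShift * (∑ j, (L.1 j).1) * star oddShift + baseProj = ∑ j, ((stabLines n L).1 j).1
  rw [Fin.sum_univ_succ, Finset.mul_sum, Finset.sum_mul, add_comm]
  rfl

theorem conj_comp_sumLines (U : Op) (hU : star U * U = 1) (n : ℕ) :
    (conj U hU n).comp (sumLines n) = (sumLines n).comp (conjLines U hU n) := by
  ext1 L
  apply Subtype.ext
  change U * (∑ j, (L.1 j).1) * star U = ∑ j, U * (L.1 j).1 * star U
  rw [Finset.mul_sum, Finset.sum_mul]

/-- The products that involve the index `0` vanish; the others are indexed by order embeddings that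
factor through `Fin.succ`. -/
theorem esymmCochain_succ {X : Type*} [TopologicalSpace X] (i : ℕ) {n : ℕ}
    (a : Fin (n + 1) → Cochain 1 X) (h : a 0 = 0) :
    esymmCochain i a = esymmCochain i fun j => a j.succ := by
  funext σ
  symm
  refine Finset.sum_of_injOn (fun j => j.trans (Fin.succOrderEmb n)) ?_ (by simp) ?_
    (fun j _ => rfl)
  · intro j _ k _ hjk
    ext x
    have := congrArg (fun e : Fin i ↪o Fin (n + 1) => (e x : ℕ)) hjk
    simpa using this
  · intro j _ hj
    by_cases h0 : ∃ k, j k = 0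
    · obtain ⟨k, hk⟩ := h0
      refine Finset.prod_eq_zero (Finset.mem_univ k) ?_
      rw [hk, h]
      rfl
    · refine absurd ⟨OrderEmbedding.ofStrictMono (fun k => (j k).pred (not_exists.1 h0 k)) ?_,
        by simp, ?_⟩ hj
      · intro k l hkl
        exact Fin.pred_lt_pred_iff.2 (j.lt_iff_lt.2 hkl)
      · ext k
        exact congrArg Fin.val (Fin.succ_pred (j k) (not_exists.1 h0 k))

/-- The cocycle condition on a constant `2`-simplex reads `3 a = a = 0`. The vanishing holds for
cochains, not just for classes, as `esymmCochain_succ` requires. -/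
theorem pullCochain_const_eq_zero {X Y : Type*} [TopologicalSpace X] [TopologicalSpace Y]
    {a : Cochain 1 Y} (ha : a ∈ cocycles 1 Y) (y : Y) :
    pullCochain (ContinuousMap.const X y) 1 a = 0 := by
  have ha' : d 1 Y a = 0 := ha
  have h := congrFun ha' (ContinuousMap.const _ y)
  change ∑ j : Fin 3, a (ContinuousMap.const _ y) = 0 at h
  rw [Finset.sum_const, Finset.card_univ, Fintype.card_fin, ← Nat.cast_smul_eq_nsmul (ZMod 2)] at h
  funext σ
  rwa [show ((3 : ℕ) : ZMod 2) = 1 from rfl, one_smul] at h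

/-- Restricted along `stabLines`, the symmetric polynomial in `n + 1` variables loses the variable
of the constant line. The other lines have been moved by `oddShift`. That this move does not matter
is read off from a representative `z₀` of `c n` on the Grassmannian, where it is homotopic to the
identity; no homotopy invariance of cup products is used. -/
theorem IsUniversalSW.stab {i : ℕ} {c : ∀ n, H i (Gr n)} (hc : IsUniversalSW i c) :
    IsUniversalSW i fun n => pull (stab n) i (c (n + 1)) := by
  intro n a ha ha'
  obtain ⟨z, hz, hzb⟩ := hc (n + 1) a ha ha'
  obtain ⟨z₀, -, hzb₀⟩ := hc n a ha ha'
  refine ⟨⟨pullCochain (SW.stab n) i z.1, pullCochain_mem_cocycles _ _ z.2⟩, ?_, ?_⟩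
  · exact congrArg (pull (SW.stab n) i) hz
  have h1 := pullCochain_mem_coboundaries (stabLines n) i hzb
  have h2 := pullCochain_mem_coboundaries (conjLines oddShift star_oddShift_mul n) i hzb₀
  have h3 := pullCochain_mem_coboundaries (sumLines n) i (pullCochain_sub_mem_coboundaries
    (homotopic_conj_shift odd_injective (fun n => by omega) n) i z₀.2)
  have e1 : pullCochain (stabLines n) i
      (esymmCochain i fun j => pullCochain (line j) 1 a) =
      pullCochain (conjLines oddShift star_oddShift_mul n) i
        (esymmCochain i fun j => pullCochain (line j) 1 a) :=
    esymmCochain_succ i (fun j => pullCochain ((line j).comp (stabLines n)) 1 a)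
      (pullCochain_const_eq_zero ha _)
  have e2 : pullCochain (stabLines n) i (pullCochain (sumLines (n + 1)) i z.1) =
      pullCochain (sumLines n) i (pullCochain (SW.stab n) i z.1) := by
    change pullCochain ((sumLines (n + 1)).comp (stabLines n)) i z.1 = _
    rw [← stab_comp_sumLines]
    rfl
  have e3 : pullCochain (conjLines oddShift star_oddShift_mul n) i
      (pullCochain (sumLines n) i z₀.1) = pullCochain (sumLines n) i
        (pullCochain (conj oddShift star_oddShift_mul n) i z₀.1) := by
    change pullCochain ((sumLines n).comp (conjLines oddShift star_oddShift_mul n)) i z₀.1 = _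
    rw [← conj_comp_sumLines]
    rfl
  rw [map_sub, e1, e2] at h1
  rw [map_sub, e3] at h2
  rw [map_sub] at h3
  -- Modulo coboundaries, the chain runs from the pullback of `z` to the shifted polynomial, to the
  -- shifted `z₀`, to `z₀`, to the polynomial itself.
  have h := Submodule.add_mem _ (Submodule.add_mem _ (Submodule.sub_mem _ h1 h2) h3) hzb₀
  convert h using 1
  change _ = _ - (pullCochain (sumLines n) i (pullCochain (conj oddShift star_oddShift_mul n) i z₀.1)
    - _) + (pullCochain (sumLines n) i (pullCochain (conj oddShift star_oddShift_mul n) i z₀.1) -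
      pullCochain (sumLines n) i z₀.1) + _
  abel

theorem pull_stab_universalSW (i n : ℕ) :
    pull (stab n) i (universalSW i (n + 1)) = universalSW i n := by
  by_cases h : ∃! c : ∀ n, H i (Gr n), IsUniversalSW i c
  · have e : universalSW i = h.choose := dif_pos h
    have hc : IsUniversalSW i (universalSW i) := e ▸ h.choose_spec.1
    exact congrFun (h.unique hc.stab hc) n
  · have e : universalSW i = 0 := dif_neg h
    rw [e]
    exact map_zero _

end SW
end

noncomputable section

namespace SW

/-! ### Vector bundles as families of projections -/

theorem isProj_starProjection (W : Submodule ℝ Hilb) [FiniteDimensional ℝ W] {n : ℕ}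
    (h : Module.finrank ℝ W = n) : IsProj n W.starProjection := by
  refine ⟨isStarProjection_starProjection, ?_⟩
  have : LinearMap.range (W.starProjection : Hilb →ₗ[ℝ] Hilb) = W := W.range_starProjection
  rw [this, ← Module.finrank_eq_rank, h]

/-- A parametrization of a finite-dimensional space by a subspace of `ℓ²`. -/
theorem exists_parametrization (F : Type*) [NormedAddCommGroup F] [NormedSpace ℝ F]
    [FiniteDimensional ℝ F] : ∃ (P : Op) (ρ : Hilb →L[ℝ] F) (ι : F →ₗ[ℝ] Hilb),
      IsProj (Module.finrank ℝ F) P ∧ (∀ y, ι (ρ y) = P y) ∧ ∀ v, ρ (ι v) = v := by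
  let W : Submodule ℝ Hilb :=
    Submodule.span ℝ (Set.range fun j : Fin (Module.finrank ℝ F) => basisVec j)
  have hW : Module.finrank ℝ W = Module.finrank ℝ F := by
    have := finrank_span_eq_card (R := ℝ)
      (orthonormal_basisVec.comp (fun j : Fin (Module.finrank ℝ F) => (j : ℕ))
        Fin.val_injective).linearIndependent
    rwa [Fintype.card_fin] at this
  have : FiniteDimensional ℝ W := FiniteDimensional.span_of_finite ℝ (Set.finite_range _)
  let e : W ≃ₗ[ℝ] F := LinearEquiv.ofFinrankEq W F hW
  refine ⟨W.starProjection,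
    (LinearMap.toContinuousLinearMap e.toLinearMap).comp W.orthogonalProjectionOnto,
    W.subtype.comp e.symm.toLinearMap, isProj_starProjection W hW, fun y => ?_, fun v => ?_⟩
  · simp
  · simp

section Frame

variable {X : Type*} [TopologicalSpace X] {F : Type*} [NormedAddCommGroup F]
  [NormedSpace ℝ F] [FiniteDimensional ℝ F] {E : X → Type*} [∀ x, AddCommGroup (E x)]
  [∀ x, Module ℝ (E x)] [∀ x, TopologicalSpace (E x)] [TopologicalSpace (TotalSpace F E)]
  [FiberBundle F E] [VectorBundle ℝ F E] {n : ℕ}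

variable (F E) in
-- A local trivialization, written with the fixed model subspace `range P` of `ℓ²`. Fibrewise linear
-- maps into `ℓ²` then become families of operators on `ℓ²`, to which the Gram construction applies.
theorem exists_frame (hn : Module.finrank ℝ F = n) (x₀ : X) :
    ∃ (P : Op) (s : ∀ x, Hilb →ₗ[ℝ] E x), IsProj n P ∧
      (∀ᶠ x in nhds x₀, (∀ y, s x (P y) = s x y) ∧ (∀ y, P y = y → s x y = 0 → y = 0) ∧
        Function.Surjective (s x)) ∧
      ∀ (D : Set X) (h : ∀ x, E x →ₗ[ℝ] Hilb),
        ContinuousOn (fun v : TotalSpace F E => h v.proj v.snd) (TotalSpace.proj ⁻¹' D) →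
        x₀ ∈ D → ∃ A : X → Op, (∀ x y, A x y = h x (s x y)) ∧ ContinuousWithinAt A D x₀ := by
  subst hn
  obtain ⟨P, ρ, ι, hP, hρι, hιρ⟩ := exists_parametrization F
  let e := trivializationAt F E x₀
  have he : e.baseSet ∈ nhds x₀ := e.open_baseSet.mem_nhds (mem_baseSet_trivializationAt F E x₀)
  refine ⟨P, fun x => (e.symmₗ ℝ x).comp (ρ : Hilb →ₗ[ℝ] F), hP, ?_, ?_⟩
  · filter_upwards [he] with x hx
    have hinv : ∀ v : F, e.linearMapAt ℝ x (e.symmₗ ℝ x v) = v := e.linearMapAt_symmₗ hx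
    refine ⟨fun y => ?_, fun y hy h => ?_, fun v => ?_⟩
    · change e.symmₗ ℝ x (ρ (P y)) = e.symmₗ ℝ x (ρ y)
      rw [← hρι, hιρ]
    · have h1 := hinv (ρ y)
      change e.symmₗ ℝ x (ρ y) = 0 at h
      rw [h, map_zero] at h1
      rw [← hy, ← hρι, ← h1, map_zero]
    · refine ⟨ι (e.linearMapAt ℝ x v), ?_⟩
      change e.symmₗ ℝ x (ρ _) = v
      rw [hιρ]
      exact e.symmₗ_linearMapAt hx v
  · intro D h hh hx₀
    let b := Module.finBasis ℝ F
    -- A finite sum of rank one operators, one for each frame vector, so pointwise continuity along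
    -- the frame already gives continuity in norm.
    refine ⟨fun x => ∑ j, ((LinearMap.toContinuousLinearMap (b.coord j)).comp ρ).smulRight
      (h x (e.symmₗ ℝ x (b j))), fun x y => ?_, ?_⟩
    · have : ρ y = ∑ j, b.coord j (ρ y) • b j := (b.sum_repr (ρ y)).symm
      change _ = h x (e.symmₗ ℝ x (ρ y))
      conv_rhs => rw [this, map_sum, map_sum]
      rw [sum_apply]
      refine Finset.sum_congr rfl fun j _ => ?_
      rw [map_smul, map_smul]
      rfl
    · refine tendsto_finsetSum _ fun j _ => ?_
      have hc : ContinuousWithinAt (fun x => h x (e.symmₗ ℝ x (b j))) D x₀ := by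
        have h1 : ContinuousWithinAt (fun x => TotalSpace.mk' F x (e.symmₗ ℝ x (b j))) D x₀ := by
          have h2 : ContinuousAt (fun x => TotalSpace.mk' F x (e.symm x (b j))) x₀ := by
            have := e.continuousOn_symm.comp (f := fun x => (x, b j)) (s := e.baseSet)
              (by fun_prop) (fun x hx => ⟨hx, mem_univ _⟩)
            exact this.continuousAt he
          refine (h2.congr ?_).continuousWithinAt
          filter_upwards [he] with x hx
          rw [e.symmₗ_apply hx]
        exact ContinuousWithinAt.comp (x := x₀) (f := fun x => TotalSpace.mk' F x (e.symmₗ ℝ x (b j)))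
          (hh (TotalSpace.mk' F x₀ (e.symmₗ ℝ x₀ (b j))) hx₀) h1 fun x hx => hx
      have h3 : Continuous fun z : Hilb =>
          ((LinearMap.toContinuousLinearMap (b.coord j)).comp ρ).smulRight z :=
        (ContinuousLinearMap.smulRightL ℝ Hilb Hilb _).continuous
      exact h3.continuousAt.comp_continuousWithinAt hc

/-- The linear maps `g x` identify the fibres of a rank `n` bundle with the subspaces `f x`
of `ℓ²`. -/
structure Classifies (F : Type*) [NormedAddCommGroup F] [NormedSpace ℝ F]
    (E : X → Type*) [∀ x, AddCommGroup (E x)] [∀ x, Module ℝ (E x)]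
    [TopologicalSpace (TotalSpace F E)] (f : C(X, Gr n)) (g : ∀ x, E x →ₗ[ℝ] Hilb) : Prop where
  finrank_eq : Module.finrank ℝ F = n
  continuous : Continuous (fun v : TotalSpace F E => g v.proj v.snd)
  injective : ∀ x, Function.Injective (g x)
  apply_mem : ∀ x v, (f x).1 (g x v) = g x v

variable {f : C(X, Gr n)} {g : ∀ x, E x →ₗ[ℝ] Hilb}

theorem finrank_range_of_injective {x : X} {g : E x →ₗ[ℝ] Hilb}
    (hg : Function.Injective g) : Module.finrank ℝ (LinearMap.range g) = Module.finrank ℝ F := by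
  rw [LinearMap.finrank_range_of_inj hg]
  exact (VectorBundle.continuousLinearEquivAt ℝ F E x).toLinearEquiv.finrank_eq

theorem Classifies.range_eq (hf : Classifies F E f g) (x : X) :
    LinearMap.range (g x) = LinearMap.range ((f x).1 : Hilb →ₗ[ℝ] Hilb) := by
  have := (f x).2.finiteDimensional
  refine Submodule.eq_of_le_of_finrank_eq ?_ ?_
  · rintro _ ⟨v, rfl⟩
    exact ⟨g x v, hf.apply_mem x v⟩
  · rw [finrank_range_of_injective (F := F) (hf.injective x), (f x).2.finrank, hf.finrank_eq]

theorem Classifies.exists_apply (hf : Classifies F E f g) {x : X} {y : Hilb} (hy : (f x).1 y = y) :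
    ∃ v, g x v = y := by
  have : y ∈ LinearMap.range (g x) := by
    rw [hf.range_eq]
    exact ⟨y, hy⟩
  exact this

theorem Classifies.op_ext (hf : Classifies F E f g) {x : X} {S T : Op} (hS : S * (f x).1 = S)
    (hT : T * (f x).1 = T) (h : ∀ v, S (g x v) = T (g x v)) : S = T := by
  ext1 y
  obtain ⟨v, hv⟩ := hf.exists_apply (x := x) (y := (f x).1 y) (apply_of_mul_eq (f x).2.mul_self y)
  rw [← hS, ← hT]
  change S ((f x).1 y) = T ((f x).1 y)
  rw [← hv, h]

/-- A fibrewise linear continuous map from a classified bundle to `ℓ²` is given by a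
norm-continuous family of operators. -/
theorem Classifies.exists_fiberOp (hf : Classifies F E f g) (D : Set X) (h : ∀ x, E x →ₗ[ℝ] Hilb)
    (hh : ContinuousOn (fun v : TotalSpace F E => h v.proj v.snd) (TotalSpace.proj ⁻¹' D)) :
    ∃ T : X → Op, ContinuousOn T D ∧ ∀ x ∈ D, T x * (f x).1 = T x ∧ ∀ v, T x (g x v) = h x v := by
  have key : ∀ x₀ ∈ D, ∃ T : X → Op, ContinuousWithinAt T D x₀ ∧
      ∀ᶠ x in nhds x₀, T x * (f x).1 = T x ∧ ∀ v, T x (g x v) = h x v := by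
    intro x₀ hx₀
    obtain ⟨P, s, hP, hs, hop⟩ := exists_frame F E hf.finrank_eq x₀
    obtain ⟨A, hA, hAc⟩ := hop univ g hf.continuous.continuousOn (mem_univ _)
    obtain ⟨B, hB, hBc⟩ := hop D h hh hx₀
    have hfacts : ∀ᶠ x in nhds x₀, A x * P = A x ∧ B x * P = B x ∧ IsUnit (gram (A x) P) := by
      filter_upwards [hs] with x hx
      have hAP : A x * P = A x := by
        ext1 y
        change A x (P y) = A x y
        rw [hA, hA, hx.1]
      refine ⟨hAP, ?_, isUnit_gram hP hAP fun y hy h0 => hx.2.1 y hy ?_⟩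
      · ext1 y
        change B x (P y) = B x y
        rw [hB, hB, hx.1]
      · rw [hA] at h0
        exact hf.injective x (h0.trans (map_zero _).symm)
    -- In the frame, `A` represents `g` and `B` represents `h`, so `B A⁻¹` represents `h ∘ g⁻¹`.
    refine ⟨fun x => B x * leftInv (A x) P, ?_, ?_⟩
    · exact hBc.mul (continuousWithinAt_leftInv (hAc.mono (subset_univ _))
        continuousWithinAt_const hfacts.self_of_nhds.2.2)
    · filter_upwards [hs, hfacts] with x hx hx'
      have hfA : (f x).1 * A x = A x := by
        ext1 y
        change (f x).1 (A x y) = A x y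
        rw [hA, hf.apply_mem]
      constructor
      · have : star (A x) * (f x).1 = star (A x) := by
          have := congrArg star hfA
          rwa [star_mul, (f x).2.star_eq] at this
        rw [leftInv, mul_assoc, mul_assoc, this]
      · intro v
        obtain ⟨y, rfl⟩ := hx.2.2 v
        rw [← hA, ← hB]
        refine apply_of_mul_eq ?_ y
        rw [mul_assoc, leftInv_mul hP hx'.1 hx'.2.2, hx'.2.1]
  choose! T hTc hT using key
  -- The local solutions agree by the uniqueness in `Classifies.op_ext`, so the diagonal choice
  -- coincides near `x₀` with the single family `T x₀`.
  refine ⟨fun x => T x x, fun x₀ hx₀ => ?_, fun x hx => (hT x hx).self_of_nhds⟩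
  refine (hTc x₀ hx₀).congr_of_eventuallyEq ?_ rfl
  filter_upwards [nhdsWithin_le_nhds (hT x₀ hx₀), self_mem_nhdsWithin] with x hx hxD
  exact hf.op_ext (hT x hxD).self_of_nhds.1 hx.1 fun v => by
    rw [(hT x hxD).self_of_nhds.2, hx.2]

theorem Classifies.homotopic {f' : C(X, Gr n)} {g' : ∀ x, E x →ₗ[ℝ] Hilb}
    (hf : Classifies F E f g) (hf' : Classifies F E f' g') : f.Homotopic f' := by
  obtain ⟨T, hT, h⟩ := hf.exists_fiberOp univ g' hf'.continuous.continuousOn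
  refine homotopic_of_bundleIso T (continuousOn_univ.1 hT) (fun x y hy h0 => ?_) fun x => ?_
  · obtain ⟨v, rfl⟩ := hf.exists_apply hy
    rw [(h x (mem_univ _)).2] at h0
    rw [hf'.injective x (h0.trans (map_zero _).symm), map_zero]
  · ext1 y
    obtain ⟨v, hv⟩ := hf.exists_apply (x := x) (y := (f x).1 y)
      (apply_of_mul_eq (f x).2.mul_self y)
    change (f' x).1 (T x ((f x).1 y)) = T x ((f x).1 y)
    rw [← hv, (h x (mem_univ _)).2, hf'.apply_mem]

/-- The class is defined by a chosen classifying map, but any other one is homotopic to it, so every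
convenient map computes it. -/
theorem Classifies.swClass_eq (hf : Classifies F E f g) (i : ℕ) :
    swClass F E i = pull f i (universalSW i n) := by
  obtain rfl := hf.finrank_eq
  have hex : ∃ f : C(X, Gr (Module.finrank ℝ F)), IsClassifyingMap F E f :=
    ⟨f, g, hf.continuous, fun x => ⟨hf.injective x, hf.range_eq x⟩⟩
  have e : swClass F E i = pull hex.choose i (universalSW i _) := dif_pos hex
  obtain ⟨g', hg', h'⟩ := hex.choose_spec
  have hf' : Classifies F E hex.choose g' := by
    refine ⟨rfl, hg', fun x => (h' x).1, fun x v => ?_⟩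
    rw [← (hex.choose x).2.mem_range, ← (h' x).2]
    exact ⟨v, rfl⟩
  rw [e, pull_eq_of_homotopic (hf'.homotopic hf)]

theorem exists_classifies_of_injective (hn : Module.finrank ℝ F = n)
    (hg : Continuous (fun v : TotalSpace F E => g v.proj v.snd))
    (hinj : ∀ x, Function.Injective (g x)) : ∃ f : C(X, Gr n), Classifies F E f g := by
  have hfd : ∀ x, FiniteDimensional ℝ (E x) := fun x =>
    (VectorBundle.continuousLinearEquivAt ℝ F E x).toLinearEquiv.symm.finiteDimensional
  have hp : ∀ x, IsProj n (LinearMap.range (g x)).starProjection := fun x =>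
    isProj_starProjection _ ((finrank_range_of_injective (F := F) (hinj x)).trans hn)
  refine ⟨⟨fun x => ⟨_, hp x⟩, Continuous.subtype_mk (continuous_iff_continuousAt.2 fun x₀ => ?_) _⟩,
    hn, hg, hinj, fun x v => Submodule.starProjection_eq_self_iff.2 ⟨v, rfl⟩⟩
  obtain ⟨P, s, hP, hs, hop⟩ := exists_frame F E hn x₀
  obtain ⟨A, hA, hAc⟩ := hop univ g hg.continuousOn (mem_univ _)
  have hfacts : ∀ᶠ x in nhds x₀, A x * P = A x ∧ IsUnit (gram (A x) P) := by
    filter_upwards [hs] with x hx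
    have hAP : A x * P = A x := by
      ext1 y
      change A x (P y) = A x y
      rw [hA, hA, hx.1]
    refine ⟨hAP, isUnit_gram hP hAP fun y hy h0 => hx.2.1 y hy ?_⟩
    rw [hA] at h0
    exact hinj x (h0.trans (map_zero _).symm)
  -- Near `x₀` the projection onto the range of `g x` is `rangeProj (A x) P`, which depends
  -- continuously on `x`.
  have hc : ContinuousAt (fun x => rangeProj (A x) P) x₀ := by
    rw [← continuousWithinAt_univ]
    exact hAc.mul (continuousWithinAt_leftInv hAc continuousWithinAt_const
      hfacts.self_of_nhds.2)
  refine hc.congr ?_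
  filter_upwards [hfacts] with x hx
  refine ((hp x).eq_of_mul_eq (isProj_rangeProj hP hx.1 hx.2) ?_).symm
  rw [rangeProj, ← mul_assoc]
  congr 1
  ext1 y
  change (LinearMap.range (g x)).starProjection (A x y) = A x y
  rw [hA]
  exact Submodule.starProjection_eq_self_iff.2 ⟨_, rfl⟩

variable (F E) in
/-- Existence of classifying maps. -/
theorem exists_classifies [T2Space X] [LocallyCompactSpace X] [SigmaCompactSpace X]
    (hn : Module.finrank ℝ F = n) :
    ∃ (f : C(X, Gr n)) (g : ∀ x, E x →ₗ[ℝ] Hilb), Classifies F E f g := by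
  suffices h : ∃ g : ∀ x, E x →ₗ[ℝ] Hilb, Continuous (fun v : TotalSpace F E => g v.proj v.snd) ∧
      ∀ x, Function.Injective (g x) by
    obtain ⟨g, hg, hinj⟩ := h
    obtain ⟨f, hf⟩ := exists_classifies_of_injective hn hg hinj
    exact ⟨f, g, hf⟩
  obtain ⟨t, htc, htU⟩ := countable_cover_nhds_of_sigmaCompact fun x : X =>
    (trivializationAt F E x).open_baseSet.mem_nhds (mem_baseSet_trivializationAt F E x)
  have := htc.to_subtype
  obtain ⟨enc, henc⟩ := exists_injective_nat t
  obtain ⟨ρ, hρ⟩ := PartitionOfUnity.exists_isSubordinate (isClosed_univ (X := X))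
    (fun j : t => (trivializationAt F E (j : X)).baseSet)
    (fun j => (trivializationAt F E (j : X)).open_baseSet)
    (fun x _ => by
      have := htU ▸ mem_univ x
      simpa using this)
  obtain ⟨_, ρ', ι, -, -, hι⟩ := exists_parametrization F
  have hιinj : Function.Injective ι := Function.LeftInverse.injective hι
  let e := fun j : t => trivializationAt F E (j : X)
  have hW : ∀ k, Function.Injective (Nat.pair k) := fun k a b h => by
    simpa using congrArg Nat.unpair h
  -- Each chart of the countable cover gets its own copy of `ℓ²`, and pairing of natural numbers
  -- makes the copies orthogonal.
  let W : t → Op := fun j => shift (Nat.pair (enc j)) (hW _)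
  have hWW : ∀ j, star (W j) * W j = 1 := fun j => star_shift_mul_shift _ _
  have hWW' : ∀ j k, j ≠ k → star (W j) * W k = 0 := fun j k hjk =>
    star_shift_mul_shift_eq_zero _ _ _ _ fun a b h => hjk (henc (by
      have := congrArg Nat.unpair h
      simp only [Nat.unpair_pair, Prod.mk.injEq] at this
      exact this.1))
  let G : ∀ (j : t) (x : X), E x →ₗ[ℝ] Hilb := fun j x =>
    ρ j x • ((W j : Hilb →ₗ[ℝ] Hilb).comp (ι.comp ((e j).linearMapAt ℝ x)))
  have hfin : ∀ x, (Function.support fun j => ρ j x) ⊆ (ρ.finsupport x : Set t) := fun x => by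
    rw [ρ.coe_finsupport]
  have hsum : ∀ x, ∑ᶠ j, G j x = ∑ j ∈ ρ.finsupport x, G j x := fun x => by
    refine finsum_eq_sum_of_support_subset _ (Subset.trans ?_ (hfin x))
    intro j hj h0
    exact hj (by
      have h0 : ρ j x = 0 := h0
      simp only [G]
      rw [h0, zero_smul])
  have happ : ∀ x v, (∑ᶠ j, G j x) v = ∑ᶠ j, G j x v := fun x v => by
    rw [hsum, LinearMap.sum_apply]
    refine (finsum_eq_sum_of_support_subset _ (Subset.trans ?_ (hfin x))).symm
    intro j hj h0
    exact hj (by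
      have h0 : ρ j x = 0 := h0
      simp only [G]
      rw [h0, zero_smul]
      rfl)
  refine ⟨fun x => ∑ᶠ j, G j x, ?_, fun x => (injective_iff_map_eq_zero _).2 fun v hv => ?_⟩
  · simp only [happ]
    refine continuous_finsum (fun j => continuous_iff_continuousAt.2 fun v => ?_) ?_
    · by_cases hv : v.proj ∈ tsupport (ρ j)
      · have hb : (e j).baseSet ∈ nhds v.proj := (e j).open_baseSet.mem_nhds (hρ j hv)
        have hs : v ∈ (e j).source := (e j).mem_source.2 (hρ j hv)
        have h1 : ContinuousAt (fun w : TotalSpace F E => (e j w).2) v :=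
          continuousAt_snd.comp ((e j).continuousAt hs)
        have h2 : ContinuousAt (fun w : TotalSpace F E => W j (ι (e j w).2)) v :=
          ((W j).continuous.comp (LinearMap.continuous_of_finiteDimensional ι)).continuousAt.comp h1
        have h3 : ContinuousAt (fun w : TotalSpace F E => ρ j w.proj) v :=
          ((ρ j).continuous.comp (FiberBundle.continuous_proj F E)).continuousAt
        refine (h3.smul h2).congr ?_
        filter_upwards [(FiberBundle.continuous_proj F E).continuousAt hb] with w hw
        change _ = ρ j w.proj • W j (ι ((e j).linearMapAt ℝ w.proj w.snd))
        rw [(e j).linearMapAt_apply, if_pos (show w.proj ∈ (e j).baseSet from hw)]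
        rfl
      · refine (continuousAt_const (y := (0 : Hilb))).congr ?_
        have hn : (tsupport (ρ j))ᶜ ∈ nhds v.proj :=
          (isClosed_tsupport _).isOpen_compl.mem_nhds hv
        filter_upwards [(FiberBundle.continuous_proj F E).continuousAt hn] with w hw
        change _ = ρ j w.proj • W j (ι ((e j).linearMapAt ℝ w.proj w.snd))
        rw [image_eq_zero_of_notMem_tsupport hw, zero_smul]
    · refine (ρ.locallyFinite.preimage_continuous (FiberBundle.continuous_proj F E)).subset
        fun j w hw h0 => hw ?_
      change ρ j w.proj • W j (ι ((e j).linearMapAt ℝ w.proj w.snd)) = 0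
      have h0 : ρ j w.proj = 0 := h0
      rw [h0, zero_smul]
  · obtain ⟨j, hj⟩ := ρ.exists_pos (mem_univ x)
    have hj' : j ∈ ρ.finsupport x := (ρ.mem_finsupport x).2 hj.ne'
    have hx : x ∈ (e j).baseSet := hρ j (subset_tsupport _ hj.ne')
    have hv : (∑ᶠ j, G j x) v = 0 := hv
    rw [hsum, LinearMap.sum_apply] at hv
    -- The adjoint of `W j` isolates the summand of a chart with positive weight at `x`; there the
    -- trivialization is injective.
    have h1 := congrArg (fun z => (star (W j) : Op) z) hv
    simp only [map_sum, map_zero] at h1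
    rw [Finset.sum_eq_single_of_mem j hj'] at h1
    · have h2 : (star (W j) : Op) (ρ j x • W j (ι ((e j).linearMapAt ℝ x v))) = 0 := h1
      rw [map_smul, apply_of_mul_eq (hWW j)] at h2
      have h3 : ι ((e j).linearMapAt ℝ x v) = 0 := (smul_eq_zero.1 h2).resolve_left hj.ne'
      have h4 := hιinj (h3.trans (map_zero ι).symm)
      have h5 := (e j).symmₗ_linearMapAt (R := ℝ) hx v
      rw [h4, map_zero] at h5
      exact h5.symm
    · intro k _ hk
      change (star (W j) : Op) (ρ k x • W k (ι ((e k).linearMapAt ℝ x v))) = 0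
      rw [map_smul, apply_of_mul_eq (hWW' j k hk.symm)]
      exact smul_zero _

end Frame

end SW
end

noncomputable section

namespace SW

/-! ### The total space of a Euclidean vector bundle -/

section TotalSpace

variable {m : ℕ} {B : Type*} [TopologicalSpace B]
  [ChartedSpace (EuclideanSpace ℝ (Fin m)) B]
  {F : Type*} [NormedAddCommGroup F] [NormedSpace ℝ F]
  {E : B → Type*} [∀ b, AddCommGroup (E b)] [∀ b, Module ℝ (E b)]
  [∀ b, TopologicalSpace (E b)] [∀ b, IsTopologicalAddGroup (E b)]
  [∀ b, ContinuousConstSMul ℝ (E b)] [TopologicalSpace (TotalSpace F E)]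
  [FiberBundle F E] [VectorBundle ℝ F E]

/-- Multiplication by scalars in the fibres, as a map on the total space. -/
def scale (p : ℝ × TotalSpace F E) : TotalSpace F E := ⟨p.2.proj, p.1 • p.2.snd⟩

/-- The square of the norm on the total space of a Euclidean vector bundle. -/
def normSq (g : ContMDiffRiemannianMetric (𝓡 m) ∞ F E) (v : TotalSpace F E) : ℝ :=
  g.inner v.proj v.snd v.snd

theorem t2Space_totalSpace [T2Space B] : T2Space (TotalSpace F E) := by
  refine ⟨fun v w hvw => ?_⟩
  by_cases h : v.proj = w.proj
  · let e := trivializationAt F E v.proj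
    have hv : v ∈ e.source := e.mem_source.2 (mem_baseSet_trivializationAt F E _)
    have hw : w ∈ e.source := e.mem_source.2 (h ▸ mem_baseSet_trivializationAt F E _)
    obtain ⟨U, W, hU, hW, hvU, hwW, hUW⟩ := t2_separation fun h' => hvw (e.injOn hv hw h')
    exact ⟨e.source ∩ e ⁻¹' U, e.source ∩ e ⁻¹' W, e.isOpen_inter_preimage hU,
      e.isOpen_inter_preimage hW, ⟨hv, hvU⟩, ⟨hw, hwW⟩,
      (hUW.preimage e).mono inter_subset_right inter_subset_right⟩
  · exact separated_by_continuous (FiberBundle.continuous_proj F E) h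

theorem normSq_scale (g : ContMDiffRiemannianMetric (𝓡 m) ∞ F E) (t : ℝ) (v : TotalSpace F E) :
    normSq g (scale (t, v)) = t ^ 2 * normSq g v := by
  change g.inner v.proj (t • v.snd) (t • v.snd) = t ^ 2 * g.inner v.proj v.snd v.snd
  rw [map_smul, map_smul, smul_apply, smul_eq_mul, smul_eq_mul]
  ring

theorem contMDiff_normSq (g : ContMDiffRiemannianMetric (𝓡 m) ∞ F E) :
    ContMDiff ((𝓡 m).prod 𝓘(ℝ, F)) 𝓘(ℝ, ℝ) ∞ (normSq g) := by
  let : RiemannianBundle E := ⟨g.toRiemannianMetric⟩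
  -- The identity of the total space, seen as a tautological section along the projection.
  have h : ContMDiff ((𝓡 m).prod 𝓘(ℝ, F)) ((𝓡 m).prod 𝓘(ℝ, F)) ∞
      (fun v : TotalSpace F E => (⟨v.proj, v.snd⟩ : TotalSpace F E)) := contMDiff_id
  exact ContMDiff.inner_bundle (IB := 𝓡 m) h h

theorem contMDiff_scale :
    ContMDiff (𝓘(ℝ, ℝ).prod ((𝓡 m).prod 𝓘(ℝ, F))) ((𝓡 m).prod 𝓘(ℝ, F)) ∞
      (scale : ℝ × TotalSpace F E → TotalSpace F E) := by
  intro p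
  have hid : ContMDiff ((𝓡 m).prod 𝓘(ℝ, F)) ((𝓡 m).prod 𝓘(ℝ, F)) ∞
      (id : TotalSpace F E → TotalSpace F E) := contMDiff_id
  have h2 := (contMDiffAt_totalSpace (F := F) (E := E)).1 (hid p.2)
  have hs : ContMDiffAt (𝓘(ℝ, ℝ).prod ((𝓡 m).prod 𝓘(ℝ, F))) ((𝓡 m).prod 𝓘(ℝ, F)) ∞
    (Prod.snd : ℝ × TotalSpace F E → TotalSpace F E) p := contMDiffAt_snd
  rw [contMDiffAt_totalSpace]
  refine ⟨h2.1.comp p hs, ?_⟩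
  have h3 := (contMDiffAt_fst (I := 𝓘(ℝ, ℝ)) (J := (𝓡 m).prod 𝓘(ℝ, F)) (n := ∞) (p := p)).smul
    (h2.2.comp p hs)
  refine h3.congr_of_eventuallyEq ?_
  have hb : (trivializationAt F E p.2.proj).baseSet ∈ nhds p.2.proj :=
    (trivializationAt F E p.2.proj).open_baseSet.mem_nhds (mem_baseSet_trivializationAt F E _)
  filter_upwards [((FiberBundle.continuous_proj F E).comp continuous_snd).continuousAt hb] with w hw
  exact ((trivializationAt F E p.2.proj).linear ℝ hw).map_smul w.1 w.2.snd

theorem isCompact_normSq_le [T2Space B] [CompactSpace B] [FiniteDimensional ℝ F]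
    (g : ContMDiffRiemannianMetric (𝓡 m) ∞ F E) (R : ℝ) :
    IsCompact {v : TotalSpace F E | normSq g v ≤ R} := by
  have hT2 : T2Space (TotalSpace F E) := t2Space_totalSpace
  let : RiemannianBundle E := ⟨g.toRiemannianMetric⟩
  have hR : IsContinuousRiemannianBundle F E := ⟨g.inner, g.contMDiff.continuous, fun _ _ _ => rfl⟩
  have hproper : ProperSpace F := FiniteDimensional.proper ℝ F
  have hLC : LocallyCompactSpace B :=
    ChartedSpace.locallyCompactSpace (EuclideanSpace ℝ (Fin m)) B
  have hclosed : IsClosed {v : TotalSpace F E | normSq g v ≤ R} :=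
    isClosed_le (contMDiff_normSq g).continuous continuous_const
  have key : ∀ b : B, ∃ K ∈ nhds b, IsCompact K ∧
      IsCompact ((TotalSpace.proj : TotalSpace F E → B) ⁻¹' K ∩ {v | normSq g v ≤ R}) := by
    intro b
    let e := trivializationAt F E b
    -- A local bound for the trivialization puts the vectors with `normSq g v ≤ R` over a small
    -- compact `K` into the image of `K` times a closed ball.
    obtain ⟨C, hC, hbound⟩ := eventually_norm_trivializationAt_lt F E b
    obtain ⟨K, hK, hKs, hKc⟩ := local_compact_nhds (Filter.inter_mem
      (e.open_baseSet.mem_nhds (mem_baseSet_trivializationAt F E b)) hbound)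
    refine ⟨K, hK, hKc, ?_⟩
    have hcpt : IsCompact (e.toOpenPartialHomeomorph.symm ''
        (K ×ˢ Metric.closedBall (0 : F) (C * Real.sqrt R))) := by
      refine (hKc.prod (isCompact_closedBall _ _)).image_of_continuousOn ?_
      refine e.toOpenPartialHomeomorph.continuousOn_symm.mono ?_
      rintro ⟨x, y⟩ ⟨hx, -⟩
      exact e.mem_target.2 (hKs hx).1
    refine hcpt.of_isClosed_subset
      ((hKc.isClosed.preimage (FiberBundle.continuous_proj F E)).inter hclosed) ?_
    rintro v ⟨hv, hvR⟩
    have hvb : v.proj ∈ e.baseSet := (hKs hv).1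
    refine ⟨e v, ⟨by rwa [e.coe_fst' hvb], ?_⟩,
      e.toOpenPartialHomeomorph.left_inv (e.mem_source.2 hvb)⟩
    rw [mem_closedBall_zero_iff]
    have h1 : (e v).2 = e.continuousLinearMapAt ℝ v.proj v.snd := by
      change _ = e.linearMapAt ℝ v.proj v.snd
      rw [e.linearMapAt_apply, if_pos hvb]
    have h2 : ‖v.snd‖ ≤ Real.sqrt R := by
      apply Real.le_sqrt_of_sq_le
      rw [← real_inner_self_eq_norm_sq]
      exact hvR
    rw [h1]
    exact (ContinuousLinearMap.le_opNorm _ _).trans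
      (mul_le_mul (le_of_lt (hKs hv).2) h2 (norm_nonneg _) hC.le)
  choose K hK _ hKc using key
  obtain ⟨t, ht⟩ := isCompact_univ.elim_nhds_subcover K fun b _ => hK b
  have hU := t.isCompact_biUnion fun b _ => hKc b
  refine hU.of_isClosed_subset hclosed fun v hv => ?_
  have := ht.2 (mem_univ v.proj)
  simp only [mem_iUnion] at this ⊢
  obtain ⟨b, hb, hvb⟩ := this
  exact ⟨b, hb, hvb, hv⟩

theorem sigmaCompactSpace_totalSpace [T2Space B] [CompactSpace B] [FiniteDimensional ℝ F]
    (g : ContMDiffRiemannianMetric (𝓡 m) ∞ F E) : SigmaCompactSpace (TotalSpace F E) := by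
  refine SigmaCompactSpace_iff_exists_compact_covering.2
    ⟨fun n => {v | normSq g v ≤ n}, fun n => isCompact_normSq_le g n, ?_⟩
  refine eq_univ_of_forall fun v => mem_iUnion.2 ?_
  exact exists_nat_ge (normSq g v)

theorem locallyCompactSpace_totalSpace (m : ℕ)
    [ChartedSpace (EuclideanSpace ℝ (Fin m)) B] [FiniteDimensional ℝ F] :
    LocallyCompactSpace (TotalSpace F E) :=
  Manifold.locallyCompact_of_finiteDimensional ((𝓡 m).prod 𝓘(ℝ, F))

/-- The zero section. -/
def zeroMap : C(B, TotalSpace F E) := ⟨zeroSection F E, Bundle.Trivialization.continuous_zeroSection ℝ⟩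

/-- The bundle projection. -/
def projMap : C(TotalSpace F E, B) := ⟨TotalSpace.proj, FiberBundle.continuous_proj F E⟩

theorem zeroMap_comp_projMap_homotopic (m : ℕ) [ChartedSpace (EuclideanSpace ℝ (Fin m)) B] :
    ((zeroMap : C(B, TotalSpace F E)).comp projMap).Homotopic (.id _) :=
  ⟨{ toFun := fun p => scale (p.1.1, p.2)
     continuous_toFun := (contMDiff_scale (m := m)).continuous.comp (by fun_prop)
     map_zero_left := fun v => by simp [scale, zeroMap, projMap, zeroSection]
     map_one_left := fun v => by simp [scale] }⟩

/-- The projection is a homotopy inverse of the zero section, by scaling. -/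
theorem pull_zeroMap_injective (m : ℕ) [ChartedSpace (EuclideanSpace ℝ (Fin m)) B] (i : ℕ) :
    Function.Injective (pull (zeroMap : C(B, TotalSpace F E)) i) := by
  refine Function.LeftInverse.injective (g := pull projMap i) fun c => ?_
  rw [← pull_comp, pull_eq_of_homotopic (zeroMap_comp_projMap_homotopic m), pull_id]

end TotalSpace

end SW
end

noncomputable section

namespace SW

/-! ### The tangent bundle of the total space along the zero section -/

section ZeroSection

variable {m : ℕ} {B : Type*} [TopologicalSpace B]
  [ChartedSpace (EuclideanSpace ℝ (Fin m)) B] [IsManifold (𝓡 m) ∞ B]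
  {F : Type*} [NormedAddCommGroup F] [NormedSpace ℝ F]
  {E : B → Type*} [∀ b, AddCommGroup (E b)] [∀ b, Module ℝ (E b)]
  [∀ b, TopologicalSpace (E b)] [∀ b, IsTopologicalAddGroup (E b)]
  [∀ b, ContinuousConstSMul ℝ (E b)] [TopologicalSpace (TotalSpace F E)]
  [FiberBundle F E] [VectorBundle ℝ F E] [ContMDiffVectorBundle ∞ F E (𝓡 m)]

/-- The vertical tangent vector at a zero vector given by an element of the fibre. -/
def vertical (m : ℕ) [ChartedSpace (EuclideanSpace ℝ (Fin m)) B] (b : B) :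
    E b →ₗ[ℝ] TangentSpace ((𝓡 m).prod 𝓘(ℝ, F)) (zeroSection F E b) :=
  (LinearMap.inr ℝ (EuclideanSpace ℝ (Fin m)) F).comp
    ((trivializationAt F E b).linearMapAt ℝ b)

theorem vertical_injective (b : B) : Function.Injective (vertical (F := F) (E := E) m b) := by
  intro v w h
  have h1 : (trivializationAt F E b).linearMapAt ℝ b v = (trivializationAt F E b).linearMapAt ℝ b w :=
    congrArg (fun z : EuclideanSpace ℝ (Fin m) × F => z.2) h
  have h2 := (trivializationAt F E b).symmₗ_linearMapAt (R := ℝ) (mem_baseSet_trivializationAt F E b)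
  rw [← h2 v, h1, h2]

/-- The chart at the zero vector is built from the trivialization at `b`, in which the curve `t ↦ t
e` is a straight line over a fixed base point. -/
theorem hasMFDerivAt_scale_left (b : B) (e : E b) :
    HasMFDerivAt 𝓘(ℝ, ℝ) ((𝓡 m).prod 𝓘(ℝ, F)) (fun t : ℝ => scale (t, (⟨b, e⟩ : TotalSpace F E))) 0
      (ContinuousLinearMap.toSpanSingleton ℝ (vertical (F := F) m b e)) := by
  refine ⟨((contMDiff_scale (m := m)).continuous.comp (by fun_prop :
    Continuous fun t : ℝ => (t, (⟨b, e⟩ : TotalSpace F E)))).continuousAt, ?_⟩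
  have hb := mem_baseSet_trivializationAt F E b
  have h1 : writtenInExtChartAt 𝓘(ℝ, ℝ) ((𝓡 m).prod 𝓘(ℝ, F)) 0
      (fun t : ℝ => scale (t, (⟨b, e⟩ : TotalSpace F E))) = fun t : ℝ =>
        (extChartAt (𝓡 m) b b, t • (trivializationAt F E b).linearMapAt ℝ b e) := by
    funext t
    rw [writtenInExtChartAt, FiberBundle.extChartAt, ← map_smul,
      (trivializationAt F E b).linearMapAt_apply, if_pos hb]
    change (extChartAt (𝓡 m) b (trivializationAt F E b (⟨b, t • e⟩ : TotalSpace F E)).1, _) = _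
    rw [(trivializationAt F E b).coe_fst' hb]
    rfl
  rw [h1]
  have h2 : HasFDerivAt (fun t : ℝ =>
      (extChartAt (𝓡 m) b b, t • (trivializationAt F E b).linearMapAt ℝ b e))
      (ContinuousLinearMap.toSpanSingleton ℝ
        ((0, (trivializationAt F E b).linearMapAt ℝ b e) : EuclideanSpace ℝ (Fin m) × F))
      (extChartAt 𝓘(ℝ, ℝ) (0 : ℝ) 0) := by
    have h3 : HasDerivAt (fun t : ℝ => t • (trivializationAt F E b).linearMapAt ℝ b e)
        ((1 : ℝ) • (trivializationAt F E b).linearMapAt ℝ b e) 0 :=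
      (hasDerivAt_id (0 : ℝ)).smul_const _
    rw [one_smul] at h3
    exact ((hasDerivAt_const (0 : ℝ) (extChartAt (𝓡 m) b b)).prodMk h3).hasFDerivAt
  exact h2.hasFDerivWithinAt

theorem mfderiv_scale_zero (b : B) (e : E b) :
    mfderiv (𝓘(ℝ, ℝ).prod ((𝓡 m).prod 𝓘(ℝ, F))) ((𝓡 m).prod 𝓘(ℝ, F)) scale
      ((0 : ℝ), (⟨b, e⟩ : TotalSpace F E)) ((1 : ℝ), (0 : EuclideanSpace ℝ (Fin m) × F)) =
        vertical (F := F) m b e := by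
  have h1 : MDifferentiableAt (𝓘(ℝ, ℝ).prod ((𝓡 m).prod 𝓘(ℝ, F))) ((𝓡 m).prod 𝓘(ℝ, F)) scale
      ((0 : ℝ), (⟨b, e⟩ : TotalSpace F E)) := (contMDiff_scale _).mdifferentiableAt (by simp)
  have h2 : HasMFDerivAt 𝓘(ℝ, ℝ) (𝓘(ℝ, ℝ).prod ((𝓡 m).prod 𝓘(ℝ, F)))
      (fun t : ℝ => (t, (⟨b, e⟩ : TotalSpace F E))) 0 _ :=
    (hasMFDerivAt_id (0 : ℝ)).prodMk (hasMFDerivAt_const (⟨b, e⟩ : TotalSpace F E) (0 : ℝ))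
  have h3 := hasMFDerivAt_unique (HasMFDerivAt.comp (0 : ℝ) h1.hasMFDerivAt h2)
    (hasMFDerivAt_scale_left b e)
  have h4 := congrArg (fun L : ℝ →L[ℝ] EuclideanSpace ℝ (Fin m) × F => L 1) h3
  refine Eq.trans ?_ (h4.trans (one_smul ℝ _))
  rfl

theorem tangentBundle_mk_congr {W K M : Type*} [NormedAddCommGroup W] [NormedSpace ℝ W]
    [TopologicalSpace K] {I : ModelWithCorners ℝ W K} [TopologicalSpace M] [ChartedSpace K M]
    {x y : M} (h : x = y) (a : W) : (⟨x, a⟩ : TangentBundle I M) = ⟨y, a⟩ := by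
  subst h
  rfl

/-- `vertical` is defined by a trivialization that varies with the point, so its continuity is not
visible. It is obtained by writing it as the derivative of the smooth map `scale` at parameter `0`
in the direction of the parameter. -/
theorem continuous_vertical :
    Continuous fun v : TotalSpace F E => (⟨zeroSection F E v.proj, vertical (F := F) m v.proj v.snd⟩ :
      TangentBundle ((𝓡 m).prod 𝓘(ℝ, F)) (TotalSpace F E)) := by
  have h1 : Continuous (tangentMap (𝓘(ℝ, ℝ).prod ((𝓡 m).prod 𝓘(ℝ, F))) ((𝓡 m).prod 𝓘(ℝ, F))
      (scale : ℝ × TotalSpace F E → TotalSpace F E)) :=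
    contMDiff_scale.continuous_tangentMap (by simp)
  have h2 : Continuous fun v : TotalSpace F E =>
      (equivTangentBundleProd 𝓘(ℝ, ℝ) ℝ ((𝓡 m).prod 𝓘(ℝ, F)) (TotalSpace F E)).symm
        (⟨(0 : ℝ), (1 : ℝ)⟩, ⟨v, (0 : EuclideanSpace ℝ (Fin m) × F)⟩) := by
    refine (contMDiff_equivTangentBundleProd_symm (n := 0)).continuous.comp ?_
    exact continuous_const.prodMk (Bundle.Trivialization.continuous_zeroSection ℝ
      (F := EuclideanSpace ℝ (Fin m) × F)
      (E := (TangentSpace ((𝓡 m).prod 𝓘(ℝ, F)) : TotalSpace F E → Type _)))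
  refine (h1.comp h2).congr fun v => ?_
  have h3 : scale ((0 : ℝ), v) = zeroSection F E v.proj := by simp [scale, zeroSection]
  rw [← mfderiv_scale_zero]
  exact tangentBundle_mk_congr h3 _

variable [FiniteDimensional ℝ F]

theorem mfderiv_proj_zeroSection (b : B) (x : TangentSpace (𝓡 m) b) :
    mfderiv ((𝓡 m).prod 𝓘(ℝ, F)) (𝓡 m) (TotalSpace.proj : TotalSpace F E → B) (zeroSection F E b)
      (mfderiv (𝓡 m) ((𝓡 m).prod 𝓘(ℝ, F)) (zeroSection F E) b x) = x := by
  have h1 : MDifferentiableAt ((𝓡 m).prod 𝓘(ℝ, F)) (𝓡 m) (TotalSpace.proj : TotalSpace F E → B)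
    (zeroSection F E b) := (contMDiff_proj E (n := ∞) _).mdifferentiableAt (by simp)
  have h2 : MDifferentiableAt (𝓡 m) ((𝓡 m).prod 𝓘(ℝ, F)) (zeroSection F E) b :=
    (contMDiff_zeroSection ℝ E (n := ∞) b).mdifferentiableAt (by simp)
  have h3 := hasMFDerivAt_unique (HasMFDerivAt.comp b h1.hasMFDerivAt h2.hasMFDerivAt)
    (hasMFDerivAt_id b)
  exact congrArg (fun L : EuclideanSpace ℝ (Fin m) →L[ℝ] EuclideanSpace ℝ (Fin m) => L x) h3

theorem mfderiv_proj_vertical (b : B) (e : E b) :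
    mfderiv ((𝓡 m).prod 𝓘(ℝ, F)) (𝓡 m) (TotalSpace.proj : TotalSpace F E → B) (zeroSection F E b)
      (vertical m b e) = 0 := by
  have h0 : scale ((0 : ℝ), (⟨b, e⟩ : TotalSpace F E)) = zeroSection F E b := by
    simp [scale, zeroSection]
  have h1 : MDifferentiableAt ((𝓡 m).prod 𝓘(ℝ, F)) (𝓡 m) (TotalSpace.proj : TotalSpace F E → B)
    (scale ((0 : ℝ), (⟨b, e⟩ : TotalSpace F E))) :=
      (contMDiff_proj E (n := ∞) _).mdifferentiableAt (by simp)
  have h2 := hasMFDerivAt_unique (HasMFDerivAt.comp (0 : ℝ) h1.hasMFDerivAt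
    (hasMFDerivAt_scale_left b e)) (hasMFDerivAt_const b (0 : ℝ))
  rw [← h0]
  have h3 := congrArg (fun L : ℝ →L[ℝ] EuclideanSpace ℝ (Fin m) => L 1) h2
  refine Eq.trans ?_ h3
  change _ = mfderiv ((𝓡 m).prod 𝓘(ℝ, F)) (𝓡 m) (TotalSpace.proj : TotalSpace F E → B)
    (scale ((0 : ℝ), (⟨b, e⟩ : TotalSpace F E))) ((1 : ℝ) • (vertical m b e))
  rw [one_smul]
  rfl

/-- The restriction of the tangent bundle of the total space to the zero section is the direct sum
of the bundle and the tangent bundle of the base. -/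
theorem Classifies.comp_zeroMap {n : ℕ} {f : C(TotalSpace F E, Gr n)}
    {g : ∀ v : TotalSpace F E, TangentSpace ((𝓡 m).prod 𝓘(ℝ, F)) v →ₗ[ℝ] Hilb}
    (hf : Classifies (EuclideanSpace ℝ (Fin m) × F)
      (TangentSpace ((𝓡 m).prod 𝓘(ℝ, F)) : TotalSpace F E → Type _) f g) :
    Classifies (F × EuclideanSpace ℝ (Fin m)) (E ×ᵇ (TangentSpace (𝓡 m) : B → Type _))
      (f.comp zeroMap) fun b => (g (zeroSection F E b)).comp
        ((vertical m b).coprod (mfderiv (𝓡 m) ((𝓡 m).prod 𝓘(ℝ, F)) (zeroSection F E) b).toLinearMap) := by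
  refine ⟨?_, ?_, fun b => ?_, fun b v => hf.apply_mem _ _⟩
  · rw [← hf.finrank_eq, Module.finrank_prod, Module.finrank_prod, add_comm]
  · have hz : Continuous (tangentMap (𝓡 m) ((𝓡 m).prod 𝓘(ℝ, F)) (zeroSection F E)) :=
      (contMDiff_zeroSection ℝ E (n := ∞)).continuous_tangentMap (by simp)
    have hd := (FiberBundle.Prod.isInducing_diag F E (EuclideanSpace ℝ (Fin m))
      (TangentSpace (𝓡 m) : B → Type _)).continuous
    have h1 := hf.continuous.comp ((continuous_vertical (m := m) (F := F) (E := E)).comp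
      (continuous_fst.comp hd))
    have h2 := hf.continuous.comp (hz.comp (continuous_snd.comp hd))
    refine (h1.add h2).congr fun v => ?_
    exact (map_add (g (zeroSection F E v.proj)) _ _).symm
  · refine (injective_iff_map_eq_zero _).2 ?_
    rintro ⟨e, x⟩ h
    have h1 : vertical m b e + mfderiv (𝓡 m) ((𝓡 m).prod 𝓘(ℝ, F)) (zeroSection F E) b x = 0 :=
      hf.injective _ (h.trans (map_zero _).symm)
    -- The derivative of the projection kills the vertical summand and is the identity on the image
    -- of `TB`, so the two summands are independent.
    have h2 := congrArg (mfderiv ((𝓡 m).prod 𝓘(ℝ, F)) (𝓡 m) (TotalSpace.proj : TotalSpace F E → B)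
      (zeroSection F E b)) h1
    rw [map_add, mfderiv_proj_vertical, mfderiv_proj_zeroSection, map_zero] at h2
    have h2 : x = 0 := (zero_add (M := EuclideanSpace ℝ (Fin m)) x).symm.trans h2
    rw [h2, map_zero, add_zero] at h1
    exact Prod.ext (vertical_injective b (h1.trans (map_zero _).symm)) h2

end ZeroSection

end SW
end

noncomputable section

namespace SW

/-! ### Sublevel sets of smooth functions -/

/-- The tangent cone contains the open half space `l < 0`, which spans the whole space. -/
theorem uniqueDiffWithinAt_sublevel {W : Type*} [NormedAddCommGroup W] [NormedSpace ℝ W]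
    {q : W → ℝ} {l : W →L[ℝ] ℝ} {a : W} (hq : HasFDerivAt q l a) (hl : l ≠ 0) :
    UniqueDiffWithinAt ℝ {x | q x ≤ q a} a := by
  have hcone : ∀ y, l y < 0 → y ∈ tangentConeAt ℝ {x | q x ≤ q a} a := by
    intro y hy
    have h1 : HasDerivAt (fun t : ℝ => q (a + t • y)) (l y) 0 := by
      have h2 : HasDerivAt (fun t : ℝ => a + t • y) y 0 := by
        simpa using ((hasDerivAt_id (0 : ℝ)).smul_const y).const_add a
      have hq' : HasFDerivAt q l (a + (0 : ℝ) • y) := by simpa using hq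
      exact hq'.comp_hasDerivAt (0 : ℝ) h2
    have h3 : ∀ᶠ t in nhdsWithin (0 : ℝ) (Ioi 0), q (a + t • y) ≤ q a := by
      have h4 := (hasDerivAt_iff_tendsto_slope.1 h1).mono_left (nhdsGT_le_nhdsNE (0 : ℝ))
      filter_upwards [h4.eventually_lt_const hy, self_mem_nhdsWithin] with t ht ht0
      simp only [slope_def_field, sub_zero, zero_smul, add_zero] at ht
      have := (div_lt_iff₀ ht0).1 ht
      linarith
    exact mem_tangentConeAt_of_add_smul_mem
      (Filter.tendsto_id'.2 (nhdsGT_le_nhdsNE (0 : ℝ))) h3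
  obtain ⟨y, hy⟩ : ∃ y, l y < 0 := by
    obtain ⟨y, hy⟩ : ∃ y, l y ≠ 0 := by
      by_contra! h
      exact hl (ContinuousLinearMap.ext h)
    rcases lt_or_gt_of_ne hy with h | h
    · exact ⟨y, h⟩
    · exact ⟨-y, by rw [map_neg]; linarith⟩
  refine ⟨?_, subset_closure (le_refl (q a))⟩
  have htop : Submodule.span ℝ (tangentConeAt ℝ {x | q x ≤ q a} a) = ⊤ := by
    refine eq_top_iff.2 fun x _ => ?_
    -- Any `x` is a difference of vectors of the half space: the coefficient is large enough to make
    -- `l` negative on the sum.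
    have h1 : l (x + (|l x| / (-l y) + 1) • y) < 0 := by
      rw [map_add, map_smul, smul_eq_mul]
      have h2 : |l x| / (-l y) * l y = - |l x| := by
        rw [div_neg, neg_mul, div_mul_cancel₀ _ hy.ne]
      have := le_abs_self (l x)
      rw [add_mul, h2]
      linarith
    have h2 := Submodule.sub_mem _ (Submodule.subset_span (R := ℝ) (hcone _ h1))
      (Submodule.smul_mem _ (|l x| / (-l y) + 1) (Submodule.subset_span (hcone y hy)))
    rwa [add_sub_cancel_right] at h2
  rw [htop]
  exact dense_univ

/-! ### Sublevel sets and tangent cones in charts -/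

section Manifold

variable {W K : Type*} [NormedAddCommGroup W] [NormedSpace ℝ W] [TopologicalSpace K]
  {I : ModelWithCorners ℝ W K} [I.Boundaryless]
  {M : Type*} [TopologicalSpace M] [ChartedSpace K M]
  {W' K' : Type*} [NormedAddCommGroup W'] [NormedSpace ℝ W'] [TopologicalSpace K']
  {I' : ModelWithCorners ℝ W' K'} [I'.Boundaryless]
  {S : Type*} [TopologicalSpace S] [ChartedSpace K' S]

theorem HasMFDerivAt.hasFDerivAt_comp_symm {q : M → ℝ} {v : M} {l : W →L[ℝ] ℝ}
    (hq : HasMFDerivAt I 𝓘(ℝ, ℝ) q v l) :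
    HasFDerivAt (q ∘ (extChartAt I v).symm) l (extChartAt I v v) := by
  have h : HasFDerivWithinAt (q ∘ (extChartAt I v).symm) l (range I) (extChartAt I v v) := hq.2
  rw [I.range_eq_univ, hasFDerivWithinAt_univ] at h
  exact h

theorem uniqueMDiffOn_sublevel {q : M → ℝ} {c : ℝ} (hq : MDifferentiable I 𝓘(ℝ, ℝ) q)
    (h : ∀ x, q x = c → ∃ y : W, (mfderiv I 𝓘(ℝ, ℝ) q x : W →L[ℝ] ℝ) y ≠ 0) :
    UniqueMDiffOn I {x | q x ≤ c} := by
  intro x hx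
  rcases (show q x ≤ c from hx).lt_or_eq with hx | hx
  · refine uniqueMDiffWithinAt_univ I |>.mono_nhds ?_
    rw [nhdsWithin_univ, nhdsWithin_eq_nhds.2]
    filter_upwards [(hq x).continuousAt.eventually_lt_const hx] with y hy using hy.le
  · have h1 := HasMFDerivAt.hasFDerivAt_comp_symm (hq x).hasMFDerivAt
    obtain ⟨y, hy⟩ := h x hx
    have h2 := uniqueDiffWithinAt_sublevel h1 fun h0 => hy (by
      have := congrArg (fun L : W →L[ℝ] ℝ => L y) h0
      exact this)
    rw [UniqueMDiffWithinAt, I.range_eq_univ, inter_univ]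
    simp only [Function.comp_apply, extChartAt_to_inv, hx] at h2
    exact h2

/-- If `j` embeds the set `D`, on which the function `q` is maximal at `v`, then the vectors tangent to
the image of `D` at `j v` point in directions in which `q` does not increase. -/
theorem apply_symm_nonpos_of_mem_posTangentConeAt {j : M → S} {r : S → M} {D : Set M} {v : M}
    (hv : v ∈ D) {e : W ≃L[ℝ] W'} (hj : HasMFDerivWithinAt I I' j D v (e : W →L[ℝ] W'))
    (hr : ContinuousWithinAt r (j '' D) (j v)) (hrj : ∀ w ∈ D, r (j w) = w)
    {q : M → ℝ} {l : W →L[ℝ] ℝ} (hq : HasMFDerivAt I 𝓘(ℝ, ℝ) q v l)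
    (hmax : ∀ w ∈ D, q w ≤ q v) {x : W'}
    (hx : x ∈ posTangentConeAt ((extChartAt I' (j v)).symm ⁻¹' (j '' D))
      (extChartAt I' (j v) (j v))) : l (e.symm x) ≤ 0 := by
  set s := (extChartAt I' (j v)).symm ⁻¹' (j '' D) with hs
  set b := extChartAt I' (j v) (j v) with hb
  have hsym : (extChartAt I' (j v)).symm b = j v := extChartAt_to_inv (I := I') (j v)
  -- `G` is the inverse `r` of `j` in charts. It is a one-sided local inverse on `s`, hence has
  -- derivative `e.symm` within `s`.
  let G : W' → W := fun z => extChartAt I v (r ((extChartAt I' (j v)).symm z))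
  have hbs : b ∈ s := by
    change (extChartAt I' (j v)).symm b ∈ j '' D
    rw [hsym]
    exact mem_image_of_mem j hv
  have hGb : G b = extChartAt I v v := by
    change extChartAt I v (r ((extChartAt I' (j v)).symm b)) = _
    rw [hsym, hrj v hv]
  have hcont : Filter.Tendsto (fun z => r ((extChartAt I' (j v)).symm z)) (nhdsWithin b s) (nhds v) := by
    have h1 : ContinuousWithinAt (extChartAt I' (j v)).symm s b :=
      (continuousAt_extChartAt_symm (I := I') (j v)).continuousWithinAt
    have hr' : ContinuousWithinAt r (j '' D) ((extChartAt I' (j v)).symm b) := by rwa [hsym]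
    have h2 := hr'.comp h1 (fun z hz => hz)
    have h3 : (r ∘ (extChartAt I' (j v)).symm) b = v := by
      rw [Function.comp_apply, hsym, hrj v hv]
    have h4 := h2.tendsto
    rwa [h3] at h4
  have hsrc : ∀ᶠ z in nhdsWithin b s, r ((extChartAt I' (j v)).symm z) ∈ (extChartAt I v).source :=
    hcont (extChartAt_source_mem_nhds (I := I) v)
  have hG : HasFDerivWithinAt G (e.symm : W' →L[ℝ] W) s b := by
    refine HasFDerivWithinAt.of_local_left_inverse
      (f := writtenInExtChartAt I I' v j) (t := (extChartAt I v).symm ⁻¹' D ∩ range I) ?_ ?_ hbs ?_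
    · refine tendsto_nhdsWithin_iff.2 ⟨?_, ?_⟩
      · rw [hGb]
        exact (continuousAt_extChartAt (I := I) v).tendsto.comp hcont
      · filter_upwards [hsrc, self_mem_nhdsWithin] with z hz hzs
        obtain ⟨w, hw, hwz⟩ := hzs
        refine ⟨?_, by rw [I.range_eq_univ]; trivial⟩
        change (extChartAt I v).symm (extChartAt I v (r ((extChartAt I' (j v)).symm z))) ∈ D
        rw [(extChartAt I v).left_inv hz, ← hwz, hrj w hw]
        exact hw
    · rw [hGb]
      exact hj.2
    · filter_upwards [hsrc, self_mem_nhdsWithin, mem_nhdsWithin_of_mem_nhds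
        (extChartAt_target_mem_nhds (I := I') (j v))] with z hz hzs hzt
      obtain ⟨w, hw, hwz⟩ := hzs
      change extChartAt I' (j v) (j ((extChartAt I v).symm (extChartAt I v
        (r ((extChartAt I' (j v)).symm z))))) = z
      rw [(extChartAt I v).left_inv hz, ← hwz, hrj w hw, hwz, (extChartAt I' (j v)).right_inv hzt]
  have hq' := HasMFDerivAt.hasFDerivAt_comp_symm hq
  rw [← hGb] at hq'
  have hcomp := hq'.comp_hasFDerivWithinAt b hG
  -- On `s` the composite takes values of `q` on `D`, so it is maximal at `b`, and its derivative is
  -- nonpositive on the positive tangent cone.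
  have hloc : IsLocalMaxOn ((q ∘ (extChartAt I v).symm) ∘ G) s b := by
    filter_upwards [hsrc, self_mem_nhdsWithin] with z hz hzs
    obtain ⟨w, hw, hwz⟩ := hzs
    have h1 : ((q ∘ (extChartAt I v).symm) ∘ G) z = q w := by
      change q ((extChartAt I v).symm (extChartAt I v (r ((extChartAt I' (j v)).symm z)))) = q w
      rw [(extChartAt I v).left_inv hz, ← hwz, hrj w hw]
    have h2 : ((q ∘ (extChartAt I v).symm) ∘ G) b = q v := by
      rw [Function.comp_apply, hGb, Function.comp_apply, extChartAt_to_inv]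
    rw [h1, h2]
    exact hmax w hw
  exact hloc.hasFDerivWithinAt_nonpos hcomp hx

/-- For arbitrarily small `t > 0` the point `a + t • x` lies in the same one of the two sets. At a
seam point, every tangent vector therefore points into one of the halves. -/
theorem mem_posTangentConeAt_or {C₁ C₂ : Set W} (h : C₁ ∪ C₂ = univ) (a x : W) :
    x ∈ posTangentConeAt C₁ a ∨ x ∈ posTangentConeAt C₂ a := by
  have h1 : ∃ᶠ t : ℝ in nhdsWithin 0 (Ioi 0), a + t • x ∈ C₁ ∨ a + t • x ∈ C₂ := by
    refine Filter.Eventually.frequently (.of_forall fun t => ?_)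
    have : a + t • x ∈ C₁ ∪ C₂ := h ▸ mem_univ _
    exact this
  rcases Filter.frequently_or_distrib.1 h1 with h2 | h2
  · exact Or.inl (mem_posTangentConeAt_of_frequently_mem h2)
  · exact Or.inr (mem_posTangentConeAt_of_frequently_mem h2)

theorem HasMFDerivAt.congr_point {f : M → S} {x y : M} {f' : W →L[ℝ] W'}
    (h : HasMFDerivAt I I' f y f') (hxy : y = x) : HasMFDerivAt I I' f x f' := by
  subst hxy
  exact h

end Manifold

/-! ### The sphere bundle -/

section Sphere

variable {m : ℕ} {B : Type*} [TopologicalSpace B]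
  [ChartedSpace (EuclideanSpace ℝ (Fin m)) B] [IsManifold (𝓡 m) ∞ B]
  {F : Type*} [NormedAddCommGroup F] [NormedSpace ℝ F]
  {E : B → Type*} [∀ b, AddCommGroup (E b)] [∀ b, Module ℝ (E b)]
  [∀ b, TopologicalSpace (E b)] [∀ b, IsTopologicalAddGroup (E b)]
  [∀ b, ContinuousConstSMul ℝ (E b)] [TopologicalSpace (TotalSpace F E)]
  [FiberBundle F E] [VectorBundle ℝ F E] [ContMDiffVectorBundle ∞ F E (𝓡 m)]

theorem mdifferentiable_normSq (g : ContMDiffRiemannianMetric (𝓡 m) ∞ F E) :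
    MDifferentiable ((𝓡 m).prod 𝓘(ℝ, F)) 𝓘(ℝ, ℝ) (normSq g) :=
  (contMDiff_normSq g).mdifferentiable (by simp)

theorem scale_one (v : TotalSpace F E) : scale (1, v) = v := by
  simp [scale]

theorem hasMFDerivAt_scale (t : ℝ) (v : TotalSpace F E) :
    HasMFDerivAt (𝓘(ℝ, ℝ).prod ((𝓡 m).prod 𝓘(ℝ, F))) ((𝓡 m).prod 𝓘(ℝ, F)) scale (t, v)
      (mfderiv (𝓘(ℝ, ℝ).prod ((𝓡 m).prod 𝓘(ℝ, F))) ((𝓡 m).prod 𝓘(ℝ, F)) scale (t, v)) :=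
  ((contMDiff_scale _).mdifferentiableAt (by simp)).hasMFDerivAt

/-- On the sphere bundle the derivative of the square of the norm does not vanish. -/
theorem exists_mfderiv_normSq_ne_zero (g : ContMDiffRiemannianMetric (𝓡 m) ∞ F E)
    {v : TotalSpace F E} (hv : normSq g v = 1) : ∃ y : EuclideanSpace ℝ (Fin m) × F,
      (mfderiv ((𝓡 m).prod 𝓘(ℝ, F)) 𝓘(ℝ, ℝ) (normSq g) v :
        EuclideanSpace ℝ (Fin m) × F →L[ℝ] ℝ) y ≠ 0 := by
  have h2 : HasMFDerivAt 𝓘(ℝ, ℝ) (𝓘(ℝ, ℝ).prod ((𝓡 m).prod 𝓘(ℝ, F)))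
      (fun t : ℝ => (t, v)) 1 _ :=
    (hasMFDerivAt_id (1 : ℝ)).prodMk (hasMFDerivAt_const v (1 : ℝ))
  have h3 := HasMFDerivAt.comp (1 : ℝ) (hasMFDerivAt_scale (m := m) 1 v) h2
  have h4 : HasMFDerivAt ((𝓡 m).prod 𝓘(ℝ, F)) 𝓘(ℝ, ℝ) (normSq g) (scale (1, v))
      (mfderiv ((𝓡 m).prod 𝓘(ℝ, F)) 𝓘(ℝ, ℝ) (normSq g) v :
        EuclideanSpace ℝ (Fin m) × F →L[ℝ] ℝ) :=
    HasMFDerivAt.congr_point (mdifferentiable_normSq g v).hasMFDerivAt (scale_one v).symm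
  have h5 := HasMFDerivAt.comp (1 : ℝ) h4 h3
  have h6 : HasMFDerivAt 𝓘(ℝ, ℝ) 𝓘(ℝ, ℝ) (fun t : ℝ => t ^ 2) 1
      (ContinuousLinearMap.toSpanSingleton ℝ (2 : ℝ)) := by
    have : HasDerivAt (fun t : ℝ => t ^ 2) 2 1 := by simpa using hasDerivAt_pow 2 (1 : ℝ)
    exact this.hasFDerivAt.hasMFDerivAt
  -- Along the ray through `v` the function is `t ^ 2`, with derivative `2` at `t = 1`.
  have h7 : (normSq g ∘ scale ∘ fun t : ℝ => (t, v)) = fun t : ℝ => t ^ 2 := by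
    funext t
    simp [normSq_scale, hv]
  rw [h7] at h5
  have h8 := congrArg (fun L : ℝ →L[ℝ] ℝ => L 1) (hasMFDerivAt_unique h5 h6)
  refine ⟨(mfderiv (𝓘(ℝ, ℝ).prod ((𝓡 m).prod 𝓘(ℝ, F))) ((𝓡 m).prod 𝓘(ℝ, F)) scale
    ((1 : ℝ), v) : ℝ × (EuclideanSpace ℝ (Fin m) × F) →L[ℝ] EuclideanSpace ℝ (Fin m) × F) (1, 0),
    fun h0 => ?_⟩
  have h9 : (1 : ℝ) • (2 : ℝ) = 0 := h8.symm.trans h0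
  norm_num at h9

theorem uniqueMDiffOn_diskBundle (g : ContMDiffRiemannianMetric (𝓡 m) ∞ F E) :
    UniqueMDiffOn ((𝓡 m).prod 𝓘(ℝ, F)) (diskBundle g) :=
  uniqueMDiffOn_sublevel (mdifferentiable_normSq g) fun _ => exists_mfderiv_normSq_ne_zero g

variable {W' K' : Type*} [NormedAddCommGroup W'] [NormedSpace ℝ W'] [TopologicalSpace K']
  {I' : ModelWithCorners ℝ W' K'}
  {S : Type*} [TopologicalSpace S] [ChartedSpace K' S]

/-! ### The radial projection and derivatives along the sphere bundle -/

theorem mfderiv_scale_one (v : TotalSpace F E) (y : EuclideanSpace ℝ (Fin m) × F) :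
    (mfderiv (𝓘(ℝ, ℝ).prod ((𝓡 m).prod 𝓘(ℝ, F))) ((𝓡 m).prod 𝓘(ℝ, F)) scale
      ((1 : ℝ), v) : ℝ × (EuclideanSpace ℝ (Fin m) × F) →L[ℝ] _) (0, y) = y := by
  have h2 : HasMFDerivAt ((𝓡 m).prod 𝓘(ℝ, F)) (𝓘(ℝ, ℝ).prod ((𝓡 m).prod 𝓘(ℝ, F)))
      (fun w : TotalSpace F E => ((1 : ℝ), w)) v _ :=
    (hasMFDerivAt_const (1 : ℝ) v).prodMk (hasMFDerivAt_id v)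
  have h3 := HasMFDerivAt.comp v (hasMFDerivAt_scale (m := m) 1 v) h2
  have h4 : (scale ∘ fun w : TotalSpace F E => ((1 : ℝ), w)) = id := funext scale_one
  rw [h4] at h3
  have h5 := hasMFDerivAt_unique h3 (hasMFDerivAt_id v)
  exact congrArg (fun L : EuclideanSpace ℝ (Fin m) × F →L[ℝ] EuclideanSpace ℝ (Fin m) × F => L y) h5

/-- The radial projection onto the sphere bundle. -/
def radial (g : ContMDiffRiemannianMetric (𝓡 m) ∞ F E) (v : TotalSpace F E) : TotalSpace F E :=
  scale ((Real.sqrt (normSq g v))⁻¹, v)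

theorem normSq_radial (g : ContMDiffRiemannianMetric (𝓡 m) ∞ F E) {v : TotalSpace F E}
    (hv : 0 < normSq g v) : normSq g (radial g v) = 1 := by
  rw [radial, normSq_scale, inv_pow, Real.sq_sqrt hv.le, inv_mul_cancel₀ hv.ne']

theorem radial_eq_self (g : ContMDiffRiemannianMetric (𝓡 m) ∞ F E) {v : TotalSpace F E}
    (hv : normSq g v = 1) : radial g v = v := by
  rw [radial, hv, Real.sqrt_one, inv_one, scale_one]

/-- On the kernel of the derivative of `normSq` the scaling factor is constant to first order, so
the radial projection is tangent to the identity there. -/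
theorem exists_hasMFDerivAt_radial (g : ContMDiffRiemannianMetric (𝓡 m) ∞ F E) {v : TotalSpace F E}
    (hv : normSq g v = 1) : ∃ N : EuclideanSpace ℝ (Fin m) × F →L[ℝ] EuclideanSpace ℝ (Fin m) × F,
      HasMFDerivAt ((𝓡 m).prod 𝓘(ℝ, F)) ((𝓡 m).prod 𝓘(ℝ, F)) (radial g) v N ∧
      ∀ y, (mfderiv ((𝓡 m).prod 𝓘(ℝ, F)) 𝓘(ℝ, ℝ) (normSq g) v :
        EuclideanSpace ℝ (Fin m) × F →L[ℝ] ℝ) y = 0 → N y = y := by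
  let ρ : ℝ → ℝ := fun t => (Real.sqrt t)⁻¹
  have h1 : HasMFDerivAt 𝓘(ℝ, ℝ) 𝓘(ℝ, ℝ) ρ (normSq g v)
      (fderiv ℝ ρ (normSq g v)) := by
    have h0 : normSq g v ≠ 0 := by rw [hv]; exact one_ne_zero
    have : DifferentiableAt ℝ ρ (normSq g v) :=
      (Real.hasDerivAt_sqrt h0).differentiableAt.inv (by rw [hv]; simp)
    exact this.hasFDerivAt.hasMFDerivAt
  have h2 := HasMFDerivAt.comp v h1 (mdifferentiable_normSq g v).hasMFDerivAt
  have h3 := h2.prodMk (hasMFDerivAt_id v)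
  have h4 : HasMFDerivAt (𝓘(ℝ, ℝ).prod ((𝓡 m).prod 𝓘(ℝ, F))) ((𝓡 m).prod 𝓘(ℝ, F)) scale
      ((ρ ∘ normSq g) v, id v)
      (mfderiv (𝓘(ℝ, ℝ).prod ((𝓡 m).prod 𝓘(ℝ, F))) ((𝓡 m).prod 𝓘(ℝ, F)) scale ((1 : ℝ), v) :
        ℝ × (EuclideanSpace ℝ (Fin m) × F) →L[ℝ] EuclideanSpace ℝ (Fin m) × F) := by
    refine HasMFDerivAt.congr_point (hasMFDerivAt_scale (m := m) 1 v) ?_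
    simp [ρ, hv]
  refine ⟨_, HasMFDerivAt.comp v h4 h3, fun y hy => ?_⟩
  refine Eq.trans ?_ (mfderiv_scale_one v y)
  refine congrArg (mfderiv (𝓘(ℝ, ℝ).prod ((𝓡 m).prod 𝓘(ℝ, F))) ((𝓡 m).prod 𝓘(ℝ, F)) scale ((1 : ℝ), v) :
        ℝ × (EuclideanSpace ℝ (Fin m) × F) →L[ℝ] EuclideanSpace ℝ (Fin m) × F) ?_
  refine Prod.ext ?_ rfl
  refine Eq.trans ?_ (map_zero (fderiv ℝ ρ (normSq g v)))
  exact congrArg _ hy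

/-- Two maps that agree on the sphere bundle have the same derivative along it. -/
theorem mfderivWithin_eq_of_eqOn_sphereBundle (g : ContMDiffRiemannianMetric (𝓡 m) ∞ F E)
    {j₁ j₂ : TotalSpace F E → S} {v : TotalSpace F E} (hv : v ∈ sphereBundle g)
    {L₁ L₂ : EuclideanSpace ℝ (Fin m) × F →L[ℝ] W'}
    (h₁ : HasMFDerivWithinAt ((𝓡 m).prod 𝓘(ℝ, F)) I' j₁ (diskBundle g) v L₁)
    (h₂ : HasMFDerivWithinAt ((𝓡 m).prod 𝓘(ℝ, F)) I' j₂ (diskBundle g) v L₂)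
    (h : EqOn j₁ j₂ (sphereBundle g)) {y : EuclideanSpace ℝ (Fin m) × F}
    (hy : (mfderiv ((𝓡 m).prod 𝓘(ℝ, F)) 𝓘(ℝ, ℝ) (normSq g) v :
        EuclideanSpace ℝ (Fin m) × F →L[ℝ] ℝ) y = 0) : L₁ y = L₂ y := by
  have hv1 : normSq g v = 1 := hv
  obtain ⟨N, hN, hNy⟩ := exists_hasMFDerivAt_radial g hv1
  let U : Set (TotalSpace F E) := {w | 0 < normSq g w}
  have hU : IsOpen U := isOpen_lt continuous_const (contMDiff_normSq g).continuous
  have hvU : v ∈ U := by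
    change 0 < normSq g v
    rw [hv1]
    exact one_pos
  have hsub : U ⊆ radial g ⁻¹' diskBundle g := fun w hw => (normSq_radial g hw).le
  have hNU : HasMFDerivWithinAt ((𝓡 m).prod 𝓘(ℝ, F)) ((𝓡 m).prod 𝓘(ℝ, F)) (radial g) U v N :=
    hN.hasMFDerivWithinAt
  have key : ∀ {j : TotalSpace F E → S} {L : EuclideanSpace ℝ (Fin m) × F →L[ℝ] W'},
      HasMFDerivWithinAt ((𝓡 m).prod 𝓘(ℝ, F)) I' j (diskBundle g) v L →
      HasMFDerivWithinAt ((𝓡 m).prod 𝓘(ℝ, F)) I' (j ∘ radial g) U v (L.comp N) := by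
    intro j L hj
    have hj' : HasMFDerivWithinAt ((𝓡 m).prod 𝓘(ℝ, F)) I' j (diskBundle g) (radial g v) L := by
      rwa [radial_eq_self g hv1]
    exact HasMFDerivWithinAt.comp v hj' hNU hsub
  -- After composition with the radial projection the two maps agree on an open set, so their
  -- derivatives agree without a manifold structure on the sphere bundle.
  have hj : EqOn (j₂ ∘ radial g) (j₁ ∘ radial g) U := fun w hw => (h (normSq_radial g hw)).symm
  have h3 := (key h₂).congr_of_eventuallyEq (f₁ := j₁ ∘ radial g)
    (Filter.eventuallyEq_of_mem self_mem_nhdsWithin hj.symm) (hj hvU).symm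
  have h4 := (hU.uniqueMDiffWithinAt hvU).eq (key h₁) h3
  have h5 := congrArg (fun L : EuclideanSpace ℝ (Fin m) × F →L[ℝ] W' => L y) h4
  have h6 : L₁ (N y) = L₂ (N y) := h5
  rwa [hNy y hy] at h6

end Sphere

end SW
end

noncomputable section

namespace SW

/-! ### Interpolation between two bundle isomorphisms across a seam -/

/-- Vectors of the stabilized subspace are pairs `(y, t)` of a vector of the subspace and a
coordinate on the added line. -/
theorem stab_apply_eq_self {n : ℕ} {P : Gr n} {z : Hilb} (h : (stab n P).1 z = z) :
    P.1 (star oddShift z) = star oddShift z ∧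
      z = oddShift (star oddShift z) + (inner ℝ baseVec z : ℝ) • baseVec := by
  have h1 : oddShift (P.1 (star oddShift z)) + (inner ℝ baseVec z : ℝ) • baseVec = z := h
  have h2 : P.1 (star oddShift z) = star oddShift z := by
    conv_rhs => rw [← h1]
    rw [map_add, map_smul, star_oddShift_baseVec, smul_zero, add_zero,
      apply_of_mul_eq star_oddShift_mul, one_apply_eq_self]
  refine ⟨h2, ?_⟩
  rw [h2] at h1
  exact h1.symm

theorem inner_baseVec_oddShift (y : Hilb) : (inner ℝ baseVec (oddShift y) : ℝ) = 0 := by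
  rw [← ContinuousLinearMap.adjoint_inner_left, ← ContinuousLinearMap.star_eq_adjoint,
    star_oddShift_baseVec, inner_zero_left]

theorem inner_baseVec_self : (inner ℝ baseVec baseVec : ℝ) = 1 := by
  rw [real_inner_self_eq_norm_sq, norm_baseVec, one_pow]

theorem eq_zero_of_oddShift_add_smul {y : Hilb} {t : ℝ} (h : oddShift y + t • baseVec = 0) :
    y = 0 ∧ t = 0 := by
  constructor
  · have := congrArg (fun z => (star oddShift : Op) z) h
    rwa [map_add, map_smul, star_oddShift_baseVec, smul_zero, add_zero,
      apply_of_mul_eq star_oddShift_mul, one_apply_eq_self, map_zero] at this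
  · have := congrArg (fun z => (inner ℝ baseVec z : ℝ)) h
    rwa [inner_add_right, inner_smul_right, inner_baseVec_oddShift, inner_baseVec_self, zero_add,
      mul_one, inner_zero_right] at this

theorem stab_apply_oddShift_add {n : ℕ} {P : Gr n} {y : Hilb} (hy : P.1 y = y) (t : ℝ) :
    (stab n P).1 (oddShift y + t • baseVec) = oddShift y + t • baseVec := by
  change oddShift (P.1 (star oddShift (oddShift y + t • baseVec))) +
    (inner ℝ baseVec (oddShift y + t • baseVec) : ℝ) • baseVec = _
  rw [map_add, map_smul, star_oddShift_baseVec, smul_zero, add_zero,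
      apply_of_mul_eq star_oddShift_mul, one_apply_eq_self, hy, inner_add_right,
      inner_smul_right, inner_baseVec_oddShift, inner_baseVec_self, zero_add, mul_one]

theorem continuous_rankOne_right :
    Continuous fun x : Hilb => (InnerProductSpace.rankOne ℝ baseVec x : Op) :=
  (InnerProductSpace.rankOne ℝ baseVec).continuous

/-- On the direct sum of a vector space and a line, the operator that interpolates between two
linear maps `a₁` and `a₂`. -/
def seamOp (a₁ a₂ : Op) (γ : Hilb) (p κ θ : ℝ) : Op :=
  -- Put `a = (1 - θ) a₁ + θ a₂`. In pairs, the map is `(y, t) ↦ (a y - p t γ, p ⟨γ, (1 - θ) a₁ y -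
  -- θ a₂ y⟩ + κ t)`. The minus sign before `θ a₂` compensates for the reflection.
  oddShift * ((1 - θ) • a₁ + θ • a₂) * star oddShift
    - p • InnerProductSpace.rankOne ℝ (oddShift γ) baseVec
    + p • (InnerProductSpace.rankOne ℝ baseVec γ * ((1 - θ) • a₁ - θ • a₂) * star oddShift)
    + κ • baseProj

theorem seamOp_apply (a₁ a₂ : Op) (γ : Hilb) (p κ θ : ℝ) (z : Hilb) :
    seamOp a₁ a₂ γ p κ θ z =
      oddShift ((1 - θ) • a₁ (star oddShift z) + θ • a₂ (star oddShift z) -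
        (p * inner ℝ baseVec z) • γ) +
      (p * ((1 - θ) * inner ℝ γ (a₁ (star oddShift z)) - θ * inner ℝ γ (a₂ (star oddShift z))) +
        κ * inner ℝ baseVec z) • baseVec := by
  have h : seamOp a₁ a₂ γ p κ θ z =
      oddShift ((1 - θ) • a₁ (star oddShift z) + θ • a₂ (star oddShift z)) -
        p • (inner ℝ baseVec z : ℝ) • oddShift γ +
        p • (inner ℝ γ ((1 - θ) • a₁ (star oddShift z) - θ • a₂ (star oddShift z)) : ℝ) • baseVec +
        κ • (inner ℝ baseVec z : ℝ) • baseVec := rfl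
  rw [h, map_sub, map_smul oddShift (p * _), inner_sub_right, inner_smul_right, inner_smul_right]
  module

theorem stab_mul_seamOp {n : ℕ} {P : Gr n} {a₁ a₂ : Op} {γ : Hilb} (h₁ : P.1 * a₁ = a₁)
    (h₂ : P.1 * a₂ = a₂) (hγ : P.1 γ = γ) (p κ θ : ℝ) :
    (stab n P).1 * seamOp a₁ a₂ γ p κ θ = seamOp a₁ a₂ γ p κ θ := by
  ext1 z
  change (stab n P).1 (seamOp a₁ a₂ γ p κ θ z) = _
  rw [seamOp_apply]
  refine stab_apply_oddShift_add ?_ _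
  rw [map_sub, map_add, map_smul, map_smul, map_smul, apply_of_mul_eq h₁, apply_of_mul_eq h₂, hγ]

/-- The case `θ = 0` or `θ = 1`, with `σ = 1` or `σ = -1`. Substituting `a y = p t γ` into the
second component leaves `(p² ‖γ‖² + 1 - p) t = 0`, with a positive factor. -/
theorem seamOp_injective_of_eq {a a₁ a₂ : Op} {γ z : Hilb} {p κ θ σ : ℝ}
    (ha : (1 - θ) • a₁ + θ • a₂ = a) (ha' : (1 - θ) • a₁ - θ • a₂ = σ • a)
    (hσ : σ * κ = 1 - p) (hσ2 : σ * σ = 1) (hp : p ≤ 1) (hγ : p = 1 → γ ≠ 0)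
    (hz : z = oddShift (star oddShift z) + (inner ℝ baseVec z : ℝ) • baseVec)
    (ha0 : a (star oddShift z) = 0 → star oddShift z = 0) (h : seamOp a₁ a₂ γ p κ θ z = 0) :
    z = 0 := by
  set y := star oddShift z
  set t : ℝ := inner ℝ baseVec z
  have e1 : (1 - θ) • a₁ y + θ • a₂ y = a y := congrArg (fun T : Op => T y) ha
  have e2 : (1 - θ) • a₁ y - θ • a₂ y = σ • a y := congrArg (fun T : Op => T y) ha'
  have e3 : (1 - θ) * inner ℝ γ (a₁ y) - θ * inner ℝ γ (a₂ y) = σ * (inner ℝ γ (a y) : ℝ) := by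
    rw [← inner_smul_right, ← inner_smul_right, ← inner_smul_right, ← inner_sub_right, e2]
  rw [seamOp_apply] at h
  obtain ⟨h1, h2⟩ := eq_zero_of_oddShift_add_smul h
  rw [e1, sub_eq_zero] at h1
  rw [e3, h1, inner_smul_right, real_inner_self_eq_norm_sq] at h2
  have h3 : (p ^ 2 * ‖γ‖ ^ 2 + (1 - p)) * t = 0 := by
    rw [← hσ]
    linear_combination σ * h2 - p ^ 2 * ‖γ‖ ^ 2 * t * hσ2
  have h4 : p ^ 2 * ‖γ‖ ^ 2 + (1 - p) ≠ 0 := by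
    rcases hp.lt_or_eq with h | h
    · have : 0 ≤ p ^ 2 * ‖γ‖ ^ 2 := by positivity
      linarith
    · have := norm_pos_iff.2 (hγ h)
      rw [h]
      positivity
  have ht : t = 0 := (mul_eq_zero.1 h3).resolve_left h4
  change a y = (p * t) • γ at h1
  rw [ht, mul_zero, zero_smul] at h1
  rw [hz, ht, ha0 h1, map_zero, zero_smul, add_zero]

/-- On the seam the second component is `((1 - θ) + θ c) ⟨γ, a₁ y⟩`. It vanishes only if `a₁ y` is
orthogonal to `γ`, where `a₁` and `a₂` agree; then `a₁ y = t γ` forces both to be zero. -/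
theorem seamOp_injective_of_seam {a₁ a₂ : Op} {γ z : Hilb} {θ c : ℝ}
    (hθ0 : 0 ≤ θ) (hθ1 : θ ≤ 1) (hc : 0 < c) (hγ : γ ≠ 0)
    (hz : z = oddShift (star oddShift z) + (inner ℝ baseVec z : ℝ) • baseVec)
    (ha0 : a₁ (star oddShift z) = 0 → star oddShift z = 0)
    (hac : (inner ℝ γ (a₂ (star oddShift z)) : ℝ) = - c * inner ℝ γ (a₁ (star oddShift z)))
    (haa : (inner ℝ γ (a₁ (star oddShift z)) : ℝ) = 0 →
      a₂ (star oddShift z) = a₁ (star oddShift z))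
    (h : seamOp a₁ a₂ γ 1 0 θ z = 0) : z = 0 := by
  set y := star oddShift z
  set t : ℝ := inner ℝ baseVec z
  rw [seamOp_apply] at h
  obtain ⟨h1, h2⟩ := eq_zero_of_oddShift_add_smul h
  rw [hac] at h2
  have h3 : ((1 - θ) + θ * c) * (inner ℝ γ (a₁ y) : ℝ) = 0 := by linear_combination h2
  have h4 : (1 - θ) + θ * c ≠ 0 := by
    rcases hθ1.lt_or_eq with h | h
    · have := mul_nonneg hθ0 hc.le
      linarith
    · rw [h]
      linarith
  have h5 := (mul_eq_zero.1 h3).resolve_left h4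
  rw [haa h5, ← add_smul, sub_add_cancel, one_smul, one_mul, sub_eq_zero] at h1
  rw [h1, inner_smul_right, real_inner_self_eq_norm_sq] at h5
  have ht : t = 0 := (mul_eq_zero.1 h5).resolve_right (by
    have := norm_pos_iff.2 hγ
    positivity)
  change a₁ y = t • γ at h1
  rw [ht, zero_smul] at h1
  rw [hz, ht, ha0 h1, map_zero, zero_smul, add_zero]

/-- Let `f₀` and `f₁` classify vector bundles over a union of closed sets `D₁` and `D₂`. Over `D₁`
and `D₂` let there be isomorphisms `a₁` and `a₂` between them that differ over `D₁ ∩ D₂` by a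
reflection in the direction of `γ`. Then the bundles are stably isomorphic. -/
theorem stab_homotopic_of_reflection {S : Type*} [TopologicalSpace S] [CompactSpace S] [T2Space S]
    {n : ℕ} {f₀ f₁ : C(S, Gr n)} {D₁ D₂ : Set S} (hD₁ : IsClosed D₁) (hD₂ : IsClosed D₂)
    (hD : D₁ ∪ D₂ = univ) {a₁ a₂ : S → Op} (ha₁ : Continuous a₁) (ha₂ : Continuous a₂)
    {γ : S → Hilb} (hγ : Continuous γ) {p κ : S → ℝ} (hp : Continuous p) (hκ : Continuous κ)
    (hfa₁ : ∀ s, (f₁ s).1 * a₁ s = a₁ s) (hfa₂ : ∀ s, (f₁ s).1 * a₂ s = a₂ s)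
    (hfγ : ∀ s, (f₁ s).1 (γ s) = γ s)
    (hinj₁ : ∀ s ∈ D₁, ∀ y, (f₀ s).1 y = y → a₁ s y = 0 → y = 0)
    (hinj₂ : ∀ s ∈ D₂, ∀ y, (f₀ s).1 y = y → a₂ s y = 0 → y = 0)
    (hp1 : ∀ s, p s ≤ 1) (hκ₁ : ∀ s ∈ D₁, κ s = 1 - p s) (hκ₂ : ∀ s ∈ D₂, κ s = -(1 - p s))
    (hγ0 : ∀ s, p s = 1 → γ s ≠ 0)
    (hseam : ∀ s ∈ D₁ ∩ D₂, p s = 1 ∧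
      (∃ c : ℝ, 0 < c ∧ ∀ y, (f₀ s).1 y = y →
        (inner ℝ (γ s) (a₂ s y) : ℝ) = - c * inner ℝ (γ s) (a₁ s y)) ∧
      ∀ y, (f₀ s).1 y = y → (inner ℝ (γ s) (a₁ s y) : ℝ) = 0 → a₂ s y = a₁ s y) :
    ((stab n).comp f₀).Homotopic ((stab n).comp f₁) := by
  let P : S → Op := fun s => (stab n (f₀ s)).1
  have hP : ∀ s, IsProj (n + 1) (P s) := fun s => (stab n (f₀ s)).2
  have hPc : Continuous P := continuous_subtype_val.comp ((stab n).comp f₀).continuous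
  let T : S × ℝ → Op := fun q => seamOp (a₁ q.1) (a₂ q.1) (γ q.1) (p q.1) (κ q.1) q.2
  have hT : Continuous T := by
    have c1 : Continuous fun q : S × ℝ => a₁ q.1 := ha₁.comp continuous_fst
    have c2 : Continuous fun q : S × ℝ => a₂ q.1 := ha₂.comp continuous_fst
    have c3 : Continuous fun q : S × ℝ => γ q.1 := hγ.comp continuous_fst
    have c4 : Continuous fun q : S × ℝ => p q.1 := hp.comp continuous_fst
    have c5 : Continuous fun q : S × ℝ => κ q.1 := hκ.comp continuous_fst
    have c6 : Continuous fun q : S × ℝ => (1 - q.2) • a₁ q.1 :=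
      (continuous_const.sub continuous_snd).smul c1
    have c7 : Continuous fun q : S × ℝ => q.2 • a₂ q.1 := continuous_snd.smul c2
    have c8 : Continuous fun q : S × ℝ =>
        InnerProductSpace.rankOne ℝ (oddShift (γ q.1)) baseVec :=
      (continuous_rankOne_right.comp (oddShift.continuous.comp c3)).star.congr fun q =>
        InnerProductSpace.adjoint_rankOne _ _
    have c9 : Continuous fun q : S × ℝ =>
        InnerProductSpace.rankOne ℝ baseVec (γ q.1) := continuous_rankOne_right.comp c3
    exact ((((continuous_const.mul (c6.add c7)).mul continuous_const).sub (c4.smul c8)).add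
      (c4.smul ((c9.mul (c6.sub c7)).mul continuous_const))).add (c5.smul continuous_const)
  -- The open set of parameters at which the interpolating operator is injective. It contains the
  -- seam times the unit interval.
  let O : Set (S × ℝ) := {q | IsUnit (gram (T q * P q.1) (P q.1))}
  have hO : IsOpen O := by
    refine Units.isOpen.preimage ?_
    have c1 : Continuous fun q : S × ℝ => P q.1 := hPc.comp continuous_fst
    have c2 : Continuous fun q : S × ℝ => T q * P q.1 := hT.mul c1
    exact (c2.star.mul c2).add (continuous_const.sub c1)
  have hmul : ∀ {q : S × ℝ} {z : Hilb}, P q.1 z = z → (T q * P q.1) z = T q z := by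
    intro q z hz
    change T q (P q.1 z) = _
    rw [hz]
  have hsub : (D₁ ∩ D₂) ×ˢ Icc (0 : ℝ) 1 ⊆ O := by
    rintro ⟨s, θ⟩ ⟨hs, hθ⟩
    refine isUnit_gram (hP s) (by rw [mul_assoc, (hP s).mul_self]) fun z hz h0 => ?_
    rw [hmul (q := (s, θ)) hz] at h0
    obtain ⟨hy, hz'⟩ := stab_apply_eq_self hz
    obtain ⟨hp1, ⟨c, hc, hac⟩, haa⟩ := hseam s hs
    have hκ0 : κ s = 0 := by rw [hκ₁ s hs.1, hp1, sub_self]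
    change seamOp (a₁ s) (a₂ s) (γ s) (p s) (κ s) θ z = 0 at h0
    rw [hp1, hκ0] at h0
    exact seamOp_injective_of_seam hθ.1 hθ.2 hc (hγ0 s hp1) hz' (hinj₁ s hs.1 _ hy) (hac _ hy)
      (haa _ hy) h0
  -- By the tube lemma all `θ` in the unit interval are admissible over a neighbourhood `N` of the
  -- seam.
  obtain ⟨N, N', hN, -, hsN, hN', hNN⟩ := generalized_tube_lemma
    (hD₁.inter hD₂).isCompact isCompact_Icc hO hsub
  -- Outside `N` the parameter is `0` on `D₁` and `1` on `D₂`, where the operator is an isomorphism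
  -- by itself; the transition takes place inside `N`.
  obtain ⟨θ, hθ₁, hθ₂, hθ⟩ := exists_continuous_zero_one_of_isClosed
    (hD₁.sdiff hN) (hD₂.sdiff hN) (disjoint_left.2 fun s h1 h2 => h1.2 (hsN ⟨h1.1, h2.1⟩))
  refine homotopic_of_bundleIso (fun s => T (s, θ s))
    (hT.comp (continuous_id.prodMk θ.continuous)) (fun s z hz h0 => ?_) fun s => ?_
  · have hz : P s z = z := hz
    obtain ⟨hy, hz'⟩ := stab_apply_eq_self hz
    by_cases hsN' : s ∈ N
    · have hu : IsUnit (gram (T (s, θ s) * P s) (P s)) := hNN ⟨hsN', hN' (hθ s)⟩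
      exact eq_zero_of_isUnit_gram hu hz (by rw [hmul (q := (s, θ s)) hz, h0])
    · rcases (hD ▸ mem_univ s : s ∈ D₁ ∪ D₂) with hs | hs
      · have h1 : θ s = 0 := hθ₁ ⟨hs, hsN'⟩
        exact seamOp_injective_of_eq (a := a₁ s) (σ := 1) (by simp [h1]) (by simp [h1])
          (by rw [one_mul, hκ₁ s hs]) (one_mul 1) (hp1 s) (hγ0 s) hz' (hinj₁ s hs _ hy) h0
      · have h1 : θ s = 1 := hθ₂ ⟨hs, hsN'⟩
        exact seamOp_injective_of_eq (a := a₂ s) (σ := -1) (by simp [h1]) (by simp [h1])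
          (by rw [hκ₂ s hs]; ring) (by norm_num) (hp1 s) (hγ0 s) hz' (hinj₂ s hs _ hy) h0
  · have h : (stab n (f₁ s)).1 * T (s, θ s) = T (s, θ s) :=
      stab_mul_seamOp (hfa₁ s) (hfa₂ s) (hfγ s) _ _ _
    change (stab n (f₁ s)).1 * (T (s, θ s) * P s) = T (s, θ s) * P s
    rw [← mul_assoc, h]

end SW
end

noncomputable section

namespace SW

/-! ### The double of a domain -/

section Topology

variable {M S : Type*} [TopologicalSpace M] [TopologicalSpace S]

/-- The folding map of a double. -/
theorem exists_fold [T2Space S] {D A : Set M} (hD : IsCompact D) (hA : A ⊆ D) {j₁ j₂ : M → S}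
    (hj₁ : ContinuousOn j₁ D) (hj₂ : ContinuousOn j₂ D) (hinj₁ : InjOn j₁ D) (hinj₂ : InjOn j₂ D)
    (hcover : j₁ '' D ∪ j₂ '' D = univ) (heq : EqOn j₁ j₂ A)
    (hinter : j₁ '' D ∩ j₂ '' D = j₁ '' A) :
    ∃ r : C(S, M), (∀ s, r s ∈ D) ∧ (∀ v ∈ D, r (j₁ v) = v) ∧ ∀ v ∈ D, r (j₂ v) = v := by
  classical
  have h : ∀ s, ∃ v ∈ D, j₁ v = s ∨ j₂ v = s := by
    intro s
    rcases (hcover ▸ mem_univ s : s ∈ j₁ '' D ∪ j₂ '' D) with ⟨v, hv, hs⟩ | ⟨v, hv, hs⟩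
    · exact ⟨v, hv, Or.inl hs⟩
    · exact ⟨v, hv, Or.inr hs⟩
  have key : ∀ v ∈ D, ∀ w ∈ D, j₁ v = j₂ w → v = w := by
    intro v hv w hw hvw
    obtain ⟨a, ha, hav⟩ : j₁ v ∈ j₁ '' A := hinter ▸ ⟨⟨v, hv, rfl⟩, ⟨w, hw, hvw.symm⟩⟩
    have h1 : a = v := hinj₁ (hA ha) hv hav
    have h2 : a = w := hinj₂ (hA ha) hw (by rw [← heq ha, hav, hvw])
    rw [← h1, h2]
  choose r hrD hr using h
  have hr₁ : ∀ v ∈ D, r (j₁ v) = v := fun v hv => by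
    rcases hr (j₁ v) with h | h
    · exact hinj₁ (hrD _) hv h
    · exact (key v hv _ (hrD _) h.symm).symm
  have hr₂ : ∀ v ∈ D, r (j₂ v) = v := fun v hv => by
    rcases hr (j₂ v) with h | h
    · exact key _ (hrD _) v hv h
    · exact hinj₂ (hrD _) hv h
  refine ⟨⟨r, continuous_iff_isClosed.2 fun C hC => ?_⟩, hrD, hr₁, hr₂⟩
  -- Preimages of closed sets are unions of two compact images, which gives continuity.
  have hpre : r ⁻¹' C = j₁ '' (D ∩ C) ∪ j₂ '' (D ∩ C) := by
    ext s
    constructor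
    · intro hs
      rcases hr s with h | h
      · exact Or.inl ⟨r s, ⟨hrD s, hs⟩, h⟩
      · exact Or.inr ⟨r s, ⟨hrD s, hs⟩, h⟩
    · rintro (⟨v, hv, rfl⟩ | ⟨v, hv, rfl⟩)
      · rw [mem_preimage, hr₁ v hv.1]
        exact hv.2
      · rw [mem_preimage, hr₂ v hv.1]
        exact hv.2
  rw [hpre]
  exact ((hD.inter_right hC).image_of_continuousOn (hj₁.mono inter_subset_left)).isClosed.union
    ((hD.inter_right hC).image_of_continuousOn (hj₂.mono inter_subset_left)).isClosed

theorem exists_continuous_glue {D₁ D₂ : Set S} (h₁ : IsClosed D₁) (h₂ : IsClosed D₂)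
    (h : D₁ ∪ D₂ = univ) {u₁ u₂ : S → ℝ} (hu₁ : Continuous u₁) (hu₂ : Continuous u₂)
    (hu : EqOn u₁ u₂ (D₁ ∩ D₂)) : ∃ κ : S → ℝ, Continuous κ ∧ EqOn κ u₁ D₁ ∧ EqOn κ u₂ D₂ := by
  classical
  have e₁ : EqOn (fun s => if s ∈ D₁ then u₁ s else u₂ s) u₁ D₁ := fun s hs => if_pos hs
  have e₂ : EqOn (fun s => if s ∈ D₁ then u₁ s else u₂ s) u₂ D₂ := fun s hs => by
    by_cases hs1 : s ∈ D₁
    · exact (if_pos hs1).trans (hu ⟨hs1, hs⟩)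
    · exact if_neg hs1
  refine ⟨_, ?_, e₁, e₂⟩
  rw [← continuousOn_univ, ← h]
  exact (hu₁.continuousOn.congr e₁).union_of_isClosed (hu₂.continuousOn.congr e₂) h₁ h₂

end Topology

/-- Two isomorphisms that agree on a hyperplane and map a half space to opposite sides. -/
theorem exists_neg_mul_of_opposite {W W' : Type*} [NormedAddCommGroup W] [NormedSpace ℝ W]
    [NormedAddCommGroup W'] [NormedSpace ℝ W'] {l : W →L[ℝ] ℝ} (hl : ∃ y, l y ≠ 0)
    {e₁ e₂ : W ≃L[ℝ] W'} (h : ∀ y, l y = 0 → e₁ y = e₂ y)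
    (hs : ∀ x, l (e₁.symm x) ≤ 0 ∨ l (e₂.symm x) ≤ 0) :
    (∃ c : ℝ, 0 < c ∧ ∀ x, l (e₂.symm x) = -c * l (e₁.symm x)) ∧
      ∀ x, l (e₁.symm x) = 0 → e₂.symm x = e₁.symm x := by
  have h2 : ∀ x, l (e₁.symm x) = 0 → e₂.symm x = e₁.symm x := fun x hx => by
    rw [ContinuousLinearEquiv.symm_apply_eq, ← h _ hx, ContinuousLinearEquiv.apply_symm_apply]
  refine ⟨?_, h2⟩
  obtain ⟨y, hy⟩ := hl
  -- Normalized so that `l (e₁.symm x₀) = 1`. The functional `l ∘ e₂.symm` vanishes on the kernel of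
  -- `l ∘ e₁.symm`, so it is the multiple given by its value at `x₀`.
  let x₀ := e₁ ((l y)⁻¹ • y)
  have hx₀ : l (e₁.symm x₀) = 1 := by
    rw [ContinuousLinearEquiv.symm_apply_apply, map_smul, smul_eq_mul, inv_mul_cancel₀ hy]
  have key : ∀ x, l (e₂.symm x) = l (e₂.symm x₀) * l (e₁.symm x) := fun x => by
    have h3 : l (e₁.symm (x - l (e₁.symm x) • x₀)) = 0 := by
      rw [map_sub, map_sub, map_smul, map_smul, hx₀, smul_eq_mul, mul_one, sub_self]
    have h4 := congrArg l (h2 _ h3)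
    rw [h3, map_sub, map_sub, map_smul, map_smul, smul_eq_mul] at h4
    linarith
  refine ⟨-l (e₂.symm x₀), ?_, fun x => by rw [key x]; ring⟩
  have h5 : l (e₂.symm x₀) ≤ 0 := by
    refine (hs x₀).resolve_left ?_
    rw [hx₀]
    norm_num
  have h6 : l (e₂.symm x₀) ≠ 0 := fun h0 => hy (by
    have := key (e₂ y)
    rwa [ContinuousLinearEquiv.symm_apply_apply, h0, zero_mul] at this)
  have := lt_of_le_of_ne h5 h6
  linarith

/-! ### Derivatives and gradients as continuous families in `ℓ²` -/

section Tangent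

variable {W K : Type*} [NormedAddCommGroup W] [NormedSpace ℝ W] [FiniteDimensional ℝ W]
  [TopologicalSpace K] {I : ModelWithCorners ℝ W K}
  {M : Type*} [TopologicalSpace M] [ChartedSpace K M] [IsManifold I ∞ M]
  {W' K' : Type*} [NormedAddCommGroup W'] [NormedSpace ℝ W'] [FiniteDimensional ℝ W']
  [TopologicalSpace K'] {I' : ModelWithCorners ℝ W' K'}
  {S : Type*} [TopologicalSpace S] [ChartedSpace K' S] [IsManifold I' ∞ S]
  {n : ℕ} {f : C(M, Gr n)} {g : ∀ v : M, TangentSpace I v →ₗ[ℝ] Hilb}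
  {f' : C(S, Gr n)} {g' : ∀ s : S, TangentSpace I' s →ₗ[ℝ] Hilb}

/-- The inverses of the derivatives of an immersion `j` of `D`, as a family of operators over `S`,
extended along a map `r : S → D`. -/
theorem Classifies.exists_leftInverse (hf : Classifies W (TangentSpace I : M → Type _) f g)
    (hf' : Classifies W' (TangentSpace I' : S → Type _) f' g') {D : Set M}
    (hD : UniqueMDiffOn I D) {j : M → S} (hj : ContMDiffOn I I' ∞ j D)
    (himm : ∀ v ∈ D, Function.Injective (mfderivWithin I I' j D v)) {r : C(S, M)}
    (hrD : ∀ s, r s ∈ D) (hr : ∀ v ∈ D, r (j v) = v) :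
    ∃ a : S → Op, Continuous a ∧ (∀ s, (f (r s)).1 * a s = a s) ∧
      ∀ v ∈ D, ∀ x, a (j v) (g' (j v) (mfderivWithin I I' j D v x)) = g v x := by
  obtain ⟨J, hJ, hJg⟩ := hf.exists_fiberOp D
    (fun v => (g' (j v)).comp (mfderivWithin I I' j D v).toLinearMap) (by
      have h1 : ContinuousOn (tangentMapWithin I I' j D) (TotalSpace.proj ⁻¹' D) :=
        hj.continuousOn_tangentMapWithin (by simp) hD
      exact hf'.continuous.comp_continuousOn h1)
  have hu : ∀ v ∈ D, IsUnit (gram (J v) (f v).1) := fun v hv => by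
    refine isUnit_gram (f v).2 (hJg v hv).1 fun y hy h0 => ?_
    obtain ⟨x, rfl⟩ := hf.exists_apply hy
    rw [(hJg v hv).2] at h0
    have h1 := hf'.injective _ (h0.trans (map_zero _).symm)
    rw [himm v hv (h1.trans (map_zero _).symm), map_zero]
  -- Outside the image of `j` the operator belongs to the tangent space at `j (r s)`, not at `s`.
  -- There it serves only as a continuous extension.
  refine ⟨fun s => leftInv (J (r s)) (f (r s)).1, ?_,
    fun s => mul_leftInv (f (r s)).2 (hJg _ (hrD s)).1 (hu _ (hrD s)), fun v hv x => ?_⟩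
  · rw [← continuousOn_univ]
    have h1 : ContinuousOn (fun s => J (r s)) univ :=
      hJ.comp r.continuous.continuousOn fun s _ => hrD s
    have h2 : Continuous fun s => (f (r s)).1 :=
      continuous_subtype_val.comp (f.continuous.comp r.continuous)
    exact fun s hs => continuousWithinAt_leftInv (h1 s hs) h2.continuousWithinAt (hu _ (hrD s))
  · change leftInv (J (r (j v))) (f (r (j v))).1 _ = _
    rw [hr v hv]
    have h1 := (hJg v hv).2 x
    have h2 : g' (j v) (mfderivWithin I I' j D v x) = J v (g v x) := h1.symm
    rw [h2, apply_of_mul_eq (leftInv_mul (f v).2 (hJg v hv).1 (hu v hv)), hf.apply_mem]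

/-- The gradient of a function as a vector field in `ℓ²`. -/
theorem Classifies.exists_gradient (hf : Classifies W (TangentSpace I : M → Type _) f g)
    {q : M → ℝ} (hq : ContMDiff I 𝓘(ℝ, ℝ) ∞ q) :
    ∃ γ : M → Hilb, Continuous γ ∧ (∀ v, (f v).1 (γ v) = γ v) ∧
      ∀ v x, (inner ℝ (γ v) (g v x) : ℝ) = (mfderiv I 𝓘(ℝ, ℝ) q v : W →L[ℝ] ℝ) x := by
  let dq : ∀ v : M, W →L[ℝ] ℝ := fun v => mfderiv I 𝓘(ℝ, ℝ) q v
  let h : ∀ v : M, W →ₗ[ℝ] Hilb := fun v => ((dq v).smulRight baseVec).toLinearMap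
  obtain ⟨L, hL, hLg⟩ := hf.exists_fiberOp univ h (by
      have h1 : Continuous (tangentMap I 𝓘(ℝ, ℝ) q) := hq.continuous_tangentMap (by simp)
      have h2 := (tangentBundleModelSpaceHomeomorph 𝓘(ℝ, ℝ)).continuous.comp h1
      have h3 : Continuous fun v : TotalSpace W (TangentSpace I : M → Type _) =>
          dq v.proj v.snd := continuous_snd.comp h2
      exact (h3.smul continuous_const).continuousOn)
  -- `L v` represents the differential with values in the line of `baseVec`, so its adjoint turns
  -- `baseVec` into the gradient.
  refine ⟨fun v => star (L v) baseVec,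
    (continuousOn_univ.1 hL).star.clm_apply continuous_const, fun v => ?_, fun v x => ?_⟩
  · refine apply_of_mul_eq ?_ _
    rw [← (f v).2.star_eq, ← star_mul, (hLg v (mem_univ v)).1]
  · change (inner ℝ (star (L v) baseVec) (g v x) : ℝ) = dq v x
    rw [ContinuousLinearMap.star_eq_adjoint, ContinuousLinearMap.adjoint_inner_left,
      (hLg v (mem_univ v)).2]
    change (inner ℝ baseVec (dq v x • baseVec) : ℝ) = dq v x
    rw [inner_smul_right, inner_baseVec_self, mul_one]

end Tangent

end SW
end

noncomputable section

namespace SW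

/-! ### The tangent bundle of the double of a disk bundle -/

theorem exists_continuousLinearEquiv_of_injective {W W' : Type*} [NormedAddCommGroup W]
    [NormedSpace ℝ W] [FiniteDimensional ℝ W] [NormedAddCommGroup W'] [NormedSpace ℝ W']
    [FiniteDimensional ℝ W'] (h : Module.finrank ℝ W = Module.finrank ℝ W') {L : W →L[ℝ] W'}
    (hL : Function.Injective L) : ∃ e : W ≃L[ℝ] W', (e : W →L[ℝ] W') = L :=
  ⟨(LinearEquiv.ofInjectiveOfFinrankEq L.toLinearMap hL h).toContinuousLinearEquiv, rfl⟩

section Double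

variable {m : ℕ} {B : Type*} [TopologicalSpace B] [T2Space B] [CompactSpace B]
  [ChartedSpace (EuclideanSpace ℝ (Fin m)) B] [IsManifold (𝓡 m) ∞ B]
  {F : Type*} [NormedAddCommGroup F] [NormedSpace ℝ F] [FiniteDimensional ℝ F]
  {E : B → Type*} [∀ b, AddCommGroup (E b)] [∀ b, Module ℝ (E b)]
  [∀ b, TopologicalSpace (E b)] [∀ b, IsTopologicalAddGroup (E b)]
  [∀ b, ContinuousConstSMul ℝ (E b)] [TopologicalSpace (TotalSpace F E)]
  [FiberBundle F E] [VectorBundle ℝ F E] [ContMDiffVectorBundle ∞ F E (𝓡 m)]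
  {g : ContMDiffRiemannianMetric (𝓡 m) ∞ F E}
  {W' K' : Type*} [NormedAddCommGroup W'] [NormedSpace ℝ W'] [FiniteDimensional ℝ W']
  [TopologicalSpace K'] {I' : ModelWithCorners ℝ W' K'} [I'.Boundaryless]
  {S : Type*} [TopologicalSpace S] [T2Space S] [ChartedSpace K' S] [IsManifold I' ∞ S]
  {j₁ j₂ : TotalSpace F E → S}

/-- At a point of the sphere bundle, the derivatives of the two embeddings differ by a
reflection. -/
theorem IsDouble.opposite
    (hS : IsDouble ((𝓡 m).prod 𝓘(ℝ, F)) I' (diskBundle g) (sphereBundle g) j₁ j₂)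
    {r : C(S, TotalSpace F E)} (hr₁ : ∀ v ∈ diskBundle g, r (j₁ v) = v)
    (hr₂ : ∀ v ∈ diskBundle g, r (j₂ v) = v) {v : TotalSpace F E} (hv : v ∈ sphereBundle g)
    {e₁ e₂ : (EuclideanSpace ℝ (Fin m) × F) ≃L[ℝ] W'}
    (he₁ : (e₁ : EuclideanSpace ℝ (Fin m) × F →L[ℝ] W') =
      mfderivWithin ((𝓡 m).prod 𝓘(ℝ, F)) I' j₁ (diskBundle g) v)
    (he₂ : (e₂ : EuclideanSpace ℝ (Fin m) × F →L[ℝ] W') =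
      mfderivWithin ((𝓡 m).prod 𝓘(ℝ, F)) I' j₂ (diskBundle g) v)
    {l : EuclideanSpace ℝ (Fin m) × F →L[ℝ] ℝ}
    (hl : l = mfderiv ((𝓡 m).prod 𝓘(ℝ, F)) 𝓘(ℝ, ℝ) (normSq g) v) :
    (∃ c : ℝ, 0 < c ∧ ∀ x, l (e₂.symm x) = -c * l (e₁.symm x)) ∧
      ∀ x, l (e₁.symm x) = 0 → e₂.symm x = e₁.symm x := by
  have hvD : v ∈ diskBundle g := le_of_eq hv
  have h₁ : HasMFDerivWithinAt ((𝓡 m).prod 𝓘(ℝ, F)) I' j₁ (diskBundle g) v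
      (e₁ : EuclideanSpace ℝ (Fin m) × F →L[ℝ] W') := by
    rw [he₁]
    exact ((hS.contMDiffOn₁ v hvD).mdifferentiableWithinAt (by simp)).hasMFDerivWithinAt
  have h₂ : HasMFDerivWithinAt ((𝓡 m).prod 𝓘(ℝ, F)) I' j₂ (diskBundle g) v
      (e₂ : EuclideanSpace ℝ (Fin m) × F →L[ℝ] W') := by
    rw [he₂]
    exact ((hS.contMDiffOn₂ v hvD).mdifferentiableWithinAt (by simp)).hasMFDerivWithinAt
  have hq : HasMFDerivAt ((𝓡 m).prod 𝓘(ℝ, F)) 𝓘(ℝ, ℝ) (normSq g) v l := by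
    rw [hl]
    exact (mdifferentiable_normSq g v).hasMFDerivAt
  have hmax : ∀ w ∈ diskBundle g, normSq g w ≤ normSq g v := fun w hw => by
    have h1 : normSq g v = 1 := hv
    rw [h1]
    exact hw
  refine exists_neg_mul_of_opposite ?_ (fun y hy => ?_) fun x => ?_
  · rw [hl]
    exact exists_mfderiv_normSq_ne_zero g hv
  · rw [hl] at hy
    exact mfderivWithin_eq_of_eqOn_sphereBundle g hv h₁ h₂ hS.eqOn hy
  -- The two halves cover a chart, so each vector at the seam points into one of them, and the
  -- inverse derivative of that half does not increase the norm.
  · have hcov : (extChartAt I' (j₁ v)).symm ⁻¹' (j₁ '' diskBundle g) ∪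
        (extChartAt I' (j₁ v)).symm ⁻¹' (j₂ '' diskBundle g) = univ := by
      rw [← preimage_union, hS.cover, preimage_univ]
    refine (mem_posTangentConeAt_or hcov (extChartAt I' (j₁ v) (j₁ v)) x).imp (fun hx => ?_)
      fun hx => ?_
    · exact apply_symm_nonpos_of_mem_posTangentConeAt hvD h₁ r.continuous.continuousWithinAt hr₁
        hq hmax hx
    · rw [hS.eqOn hv] at hx
      exact apply_symm_nonpos_of_mem_posTangentConeAt hvD h₂ r.continuous.continuousWithinAt hr₂
        hq hmax hx

/-- The tangent bundle of the double of a disk bundle is stably isomorphic to the pullback of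
the tangent bundle of the total space along the folding map. -/
theorem IsDouble.exists_stab_homotopic
    (hS : IsDouble ((𝓡 m).prod 𝓘(ℝ, F)) I' (diskBundle g) (sphereBundle g) j₁ j₂) [CompactSpace S]
    {n : ℕ} {f : C(TotalSpace F E, Gr n)}
    {G : ∀ v : TotalSpace F E, TangentSpace ((𝓡 m).prod 𝓘(ℝ, F)) v →ₗ[ℝ] Hilb}
    (hf : Classifies (EuclideanSpace ℝ (Fin m) × F)
      (TangentSpace ((𝓡 m).prod 𝓘(ℝ, F)) : TotalSpace F E → Type _) f G)
    {f' : C(S, Gr n)} {G' : ∀ s : S, TangentSpace I' s →ₗ[ℝ] Hilb}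
    (hf' : Classifies W' (TangentSpace I' : S → Type _) f' G') :
    ∃ r : C(S, TotalSpace F E), (∀ v ∈ diskBundle g, r (j₁ v) = v) ∧
      ((stab n).comp f').Homotopic ((stab n).comp (f.comp r)) := by
  have hT2 : T2Space (TotalSpace F E) := t2Space_totalSpace
  have hDc : IsCompact (diskBundle g) := isCompact_normSq_le g 1
  have hAD : sphereBundle g ⊆ diskBundle g := fun v hv => le_of_eq hv
  have hdim : Module.finrank ℝ (EuclideanSpace ℝ (Fin m) × F) = Module.finrank ℝ W' :=
    hf.finrank_eq.trans hf'.finrank_eq.symm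
  obtain ⟨r, hrD, hr₁, hr₂⟩ := exists_fold hDc hAD hS.contMDiffOn₁.continuousOn
    hS.contMDiffOn₂.continuousOn hS.injOn₁ hS.injOn₂ hS.cover hS.eqOn hS.inter
  refine ⟨r, hr₁, ?_⟩
  have hc₁ : IsClosed (j₁ '' diskBundle g) :=
    (hDc.image_of_continuousOn hS.contMDiffOn₁.continuousOn).isClosed
  have hc₂ : IsClosed (j₂ '' diskBundle g) :=
    (hDc.image_of_continuousOn hS.contMDiffOn₂.continuousOn).isClosed
  have hq : Continuous fun s => normSq g (r s) :=
    (contMDiff_normSq g).continuous.comp r.continuous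
  have hseam : ∀ s ∈ j₁ '' diskBundle g ∩ j₂ '' diskBundle g,
      ∃ v ∈ sphereBundle g, j₁ v = s ∧ j₂ v = s := fun s hs => by
    rw [hS.inter] at hs
    obtain ⟨v, hv, rfl⟩ := hs
    exact ⟨v, hv, rfl, (hS.eqOn hv).symm⟩
  -- The coefficient of the added line has opposite signs on the two halves. Both expressions vanish
  -- on the seam, so they glue.
  obtain ⟨κ, hκ, hκ₁, hκ₂⟩ := exists_continuous_glue hc₁ hc₂ hS.cover
    (continuous_const.sub hq : Continuous fun s => 1 - normSq g (r s))
    ((continuous_const.sub hq).neg : Continuous fun s => -(1 - normSq g (r s))) (fun s hs => by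
      obtain ⟨v, hv, rfl, -⟩ := hseam s hs
      have h1 : normSq g v = 1 := hv
      simp [hr₁ v (hAD hv), h1])
  have hD := uniqueMDiffOn_diskBundle g
  obtain ⟨a₁, ha₁, hfa₁, hG₁⟩ :=
    hf.exists_leftInverse hf' hD hS.contMDiffOn₁ hS.immersion₁ hrD hr₁
  obtain ⟨a₂, ha₂, hfa₂, hG₂⟩ :=
    hf.exists_leftInverse hf' hD hS.contMDiffOn₂ hS.immersion₂ hrD hr₂
  obtain ⟨γ, hγ, hfγ, hGγ⟩ := hf.exists_gradient (contMDiff_normSq g)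
  have key : ∀ {j : TotalSpace F E → S} {a : S → Op}, (∀ v ∈ diskBundle g, ∀ x, a (j v)
      (G' (j v) (mfderivWithin ((𝓡 m).prod 𝓘(ℝ, F)) I' j (diskBundle g) v x)) = G v x) →
      ∀ {s v}, v ∈ diskBundle g → j v = s →
      ∀ {e : (EuclideanSpace ℝ (Fin m) × F) ≃L[ℝ] W'},
      (e : EuclideanSpace ℝ (Fin m) × F →L[ℝ] W') =
        mfderivWithin ((𝓡 m).prod 𝓘(ℝ, F)) I' j (diskBundle g) v →
      ∀ x : W', a s (G' s x) = G v (e.symm x) := by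
    rintro j a ha s v hv rfl e he x
    refine Eq.trans (congrArg (fun z : W' => a (j v) (G' (j v) z)) ?_) (ha v hv (e.symm x))
    exact (e.apply_symm_apply x).symm.trans (congrArg
      (fun L : EuclideanSpace ℝ (Fin m) × F →L[ℝ] W' => L (e.symm x)) he)
  have hinj : ∀ {j : TotalSpace F E → S} {a : S → Op}, (∀ v ∈ diskBundle g, ∀ x, a (j v)
      (G' (j v) (mfderivWithin ((𝓡 m).prod 𝓘(ℝ, F)) I' j (diskBundle g) v x)) = G v x) →
      (∀ v ∈ diskBundle g,
        Function.Injective (mfderivWithin ((𝓡 m).prod 𝓘(ℝ, F)) I' j (diskBundle g) v)) →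
      ∀ s ∈ j '' diskBundle g, ∀ y, (f' s).1 y = y → a s y = 0 → y = 0 := by
    rintro j a ha himm s ⟨v, hv, hs⟩ y hy h0
    obtain ⟨x, rfl⟩ := hf'.exists_apply hy
    obtain ⟨e, he⟩ := exists_continuousLinearEquiv_of_injective hdim (himm v hv)
    have h1 := (key ha hv hs he x).symm.trans h0
    have h2 : e.symm x = 0 := hf.injective v (h1.trans (map_zero _).symm)
    have h3 : x = 0 := e.symm.map_eq_zero_iff.1 h2
    rw [h3, map_zero]
  -- Here `p` is the squared norm of the folded point and `γ` its gradient; `p ≤ 1`, and `γ` does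
  -- not vanish where `p = 1`.
  refine stab_homotopic_of_reflection (f₁ := f.comp r) hc₁ hc₂ hS.cover ha₁ ha₂
    (hγ.comp r.continuous) hq hκ hfa₁ hfa₂ (fun s => hfγ (r s)) (hinj hG₁ hS.immersion₁)
    (hinj hG₂ hS.immersion₂) (fun s => hrD s) hκ₁ hκ₂ (fun s hs h0 => ?_) fun s hs => ?_
  · obtain ⟨y, hy⟩ := exists_mfderiv_normSq_ne_zero g hs
    refine hy ?_
    have h0 : γ (r s) = 0 := h0
    have h1 : (inner ℝ (γ (r s)) (G (r s) y) : ℝ) = 0 := by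
      rw [h0]
      exact inner_zero_left _
    exact (hGγ (r s) y).symm.trans h1
  · obtain ⟨v, hv, hs₁, hs₂⟩ := hseam s hs
    have hvD := hAD hv
    have hrs : r s = v := by rw [← hs₁, hr₁ v hvD]
    obtain ⟨e₁, he₁⟩ := exists_continuousLinearEquiv_of_injective hdim (hS.immersion₁ v hvD)
    obtain ⟨e₂, he₂⟩ := exists_continuousLinearEquiv_of_injective hdim (hS.immersion₂ v hvD)
    let l : EuclideanSpace ℝ (Fin m) × F →L[ℝ] ℝ :=
      mfderiv ((𝓡 m).prod 𝓘(ℝ, F)) 𝓘(ℝ, ℝ) (normSq g) v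
    obtain ⟨⟨c, hc, hcl⟩, hl⟩ := hS.opposite hr₁ hr₂ hv he₁ he₂ (l := l) rfl
    have i₁ : ∀ x : W', (inner ℝ (γ (r s)) (a₁ s (G' s x)) : ℝ) = l (e₁.symm x) := fun x => by
      rw [hrs]
      exact (congrArg _ (key hG₁ hvD hs₁ he₁ x)).trans (hGγ v _)
    have i₂ : ∀ x : W', (inner ℝ (γ (r s)) (a₂ s (G' s x)) : ℝ) = l (e₂.symm x) := fun x => by
      rw [hrs]
      exact (congrArg _ (key hG₂ hvD hs₂ he₂ x)).trans (hGγ v _)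
    refine ⟨by rw [hrs]; exact hv, ⟨c, hc, fun y hy => ?_⟩, fun y hy h0 => ?_⟩
    · obtain ⟨x, rfl⟩ := hf'.exists_apply hy
      exact (i₂ x).trans ((hcl x).trans (congrArg (fun t => -c * t) (i₁ x).symm))
    · obtain ⟨x, rfl⟩ := hf'.exists_apply hy
      have h1 := hl x ((i₁ x).symm.trans h0)
      exact (key hG₂ hvD hs₂ he₂ x).trans
        ((congrArg (fun z : EuclideanSpace ℝ (Fin m) × F => G v z) h1).trans
          (key hG₁ hvD hs₁ he₁ x).symm)

end Double

end SW
end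

/-! ### Comparison of the three classes -/

theorem mainTheorem8 {m k : ℕ}
    {B : Type*} [TopologicalSpace B] [T2Space B] [CompactSpace B]
    [ChartedSpace (EuclideanSpace ℝ (Fin m)) B] [IsManifold (𝓡 m) ∞ B]
    (E : B → Type*) [∀ b, AddCommGroup (E b)] [∀ b, Module ℝ (E b)]
    [∀ b, TopologicalSpace (E b)] [∀ b, IsTopologicalAddGroup (E b)]
    [∀ b, ContinuousConstSMul ℝ (E b)]
    [TopologicalSpace (Bundle.TotalSpace (EuclideanSpace ℝ (Fin k)) E)]
    [FiberBundle (EuclideanSpace ℝ (Fin k)) E] [VectorBundle ℝ (EuclideanSpace ℝ (Fin k)) E]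
    [ContMDiffVectorBundle ∞ (EuclideanSpace ℝ (Fin k)) E (𝓡 m)]
    (g : Bundle.ContMDiffRiemannianMetric (𝓡 m) ∞ (EuclideanSpace ℝ (Fin k)) E)
    {S : Type*} [TopologicalSpace S] [T2Space S]
    [ChartedSpace (EuclideanSpace ℝ (Fin (m + k))) S] [IsManifold (𝓡 (m + k)) ∞ S]
    (j₁ j₂ : Bundle.TotalSpace (EuclideanSpace ℝ (Fin k)) E → S)
    (hS : SW.IsDouble ((𝓡 m).prod 𝓘(ℝ, EuclideanSpace ℝ (Fin k))) (𝓡 (m + k))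
      (SW.diskBundle g) (SW.sphereBundle g) j₁ j₂)
    (i : ℕ) :
    (SW.manifoldSW (𝓡 (m + k)) S i = 0 ↔
      SW.swClass (EuclideanSpace ℝ (Fin k) × EuclideanSpace ℝ (Fin m))
        (E ×ᵇ (TangentSpace (𝓡 m) : B → Type _)) i = 0) ∧
    (SW.swClass (EuclideanSpace ℝ (Fin k) × EuclideanSpace ℝ (Fin m))
        (E ×ᵇ (TangentSpace (𝓡 m) : B → Type _)) i = 0 ↔
      SW.manifoldSW ((𝓡 m).prod 𝓘(ℝ, EuclideanSpace ℝ (Fin k)))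
        (Bundle.TotalSpace (EuclideanSpace ℝ (Fin k)) E) i = 0) := by
  have hT2 : T2Space (TotalSpace (EuclideanSpace ℝ (Fin k)) E) := SW.t2Space_totalSpace
  have hLC : LocallyCompactSpace (TotalSpace (EuclideanSpace ℝ (Fin k)) E) :=
    SW.locallyCompactSpace_totalSpace m
  have hSC : SigmaCompactSpace (TotalSpace (EuclideanSpace ℝ (Fin k)) E) :=
    SW.sigmaCompactSpace_totalSpace g
  have hD : IsCompact (SW.diskBundle g) := SW.isCompact_normSq_le g 1
  have hc : CompactSpace S := ⟨by
    rw [← hS.cover]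
    exact (hD.image_of_continuousOn hS.contMDiffOn₁.continuousOn).union
      (hD.image_of_continuousOn hS.contMDiffOn₂.continuousOn)⟩
  obtain ⟨f, G, hf⟩ := SW.exists_classifies (EuclideanSpace ℝ (Fin m) × EuclideanSpace ℝ (Fin k))
    (TangentSpace ((𝓡 m).prod 𝓘(ℝ, EuclideanSpace ℝ (Fin k))) :
      TotalSpace (EuclideanSpace ℝ (Fin k)) E → Type _) (n := m + k) (by simp)
  obtain ⟨f', G', hf'⟩ := SW.exists_classifies (EuclideanSpace ℝ (Fin (m + k)))
    (TangentSpace (𝓡 (m + k)) : S → Type _) (n := m + k) (by simp)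
  obtain ⟨r, hr, hrf⟩ := hS.exists_stab_homotopic hf hf'
  have hV : SW.manifoldSW ((𝓡 m).prod 𝓘(ℝ, EuclideanSpace ℝ (Fin k)))
      (TotalSpace (EuclideanSpace ℝ (Fin k)) E) i = SW.pull f i (SW.universalSW i (m + k)) :=
    hf.swClass_eq i
  have hS' : SW.manifoldSW (𝓡 (m + k)) S i = SW.pull r i (SW.manifoldSW
      ((𝓡 m).prod 𝓘(ℝ, EuclideanSpace ℝ (Fin k))) (TotalSpace (EuclideanSpace ℝ (Fin k)) E) i) := by
    -- The homotopy exists only after stabilization, so the universal class is first written as a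
    -- pullback from `BO(m + k + 1)`.
    rw [hV, ← SW.pull_stab_universalSW, ← SW.pull_comp, ← SW.pull_comp, ← SW.pull_eq_of_homotopic hrf,
      SW.pull_comp, SW.pull_stab_universalSW]
    exact hf'.swClass_eq i
  have hB : SW.swClass (EuclideanSpace ℝ (Fin k) × EuclideanSpace ℝ (Fin m))
      (E ×ᵇ (TangentSpace (𝓡 m) : B → Type _)) i = SW.pull SW.zeroMap i (SW.manifoldSW
        ((𝓡 m).prod 𝓘(ℝ, EuclideanSpace ℝ (Fin k))) (TotalSpace (EuclideanSpace ℝ (Fin k)) E) i) := by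
    rw [hV, ← SW.pull_comp]
    exact hf.comp_zeroMap.swClass_eq i
  have hz : ∀ b : B, (SW.zeroMap b : TotalSpace (EuclideanSpace ℝ (Fin k)) E) ∈ SW.diskBundle g :=
    fun b => by
      change g.inner b 0 0 ≤ 1
      simp
  let s : C(B, S) := ⟨fun b => j₁ (SW.zeroMap b),
    hS.contMDiffOn₁.continuousOn.comp_continuous SW.zeroMap.continuous hz⟩
  -- The zero section factors through the double, so the class on `B` is also a pullback of the
  -- class of `S`.
  have hs : r.comp s = SW.zeroMap := ContinuousMap.ext fun b => hr _ (hz b)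
  have hBV : SW.swClass (EuclideanSpace ℝ (Fin k) × EuclideanSpace ℝ (Fin m))
      (E ×ᵇ (TangentSpace (𝓡 m) : B → Type _)) i = 0 ↔
      SW.manifoldSW ((𝓡 m).prod 𝓘(ℝ, EuclideanSpace ℝ (Fin k)))
        (TotalSpace (EuclideanSpace ℝ (Fin k)) E) i = 0 := by
    rw [hB]
    exact map_eq_zero_iff _ (SW.pull_zeroMap_injective m i)
  refine ⟨⟨fun h => ?_, fun h => ?_⟩, hBV⟩
  · rw [hB, ← hs, SW.pull_comp, ← hS', h, map_zero]
  · rw [hS', hBV.1 h, map_zero]
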